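/- Conventions. An explicit finite $3$-complex $K$ is given by finite lists: vertices, oriented edges, $2$-cells $j$ attached along closed edge paths $r_j$, and $3$-cells attached along spherical diagrams, i.e. finite sequences $(q_i,j_i,\varepsilon_i)_i$, where $q_i$ is an edge path from a fixed vertex to the starting corner of the $2$-cell $j_i$, $\varepsilon_i=\pm1$, and $\prod_i q_i r_{j_i}^{\varepsilon_i}q_i^{-1}$ is freely trivial. It is an explicit finite model of the $3$-skeleton of a $K(G,1)$ if $K$ is connected, $\pi_1(K)\cong G$ and $\pi_2(K)=0$ (where $\pi_1$ is the group of edge loops modulo the $2$-cells, and $\pi_2$ is the kernel of the boundary map of the free crossed module on the $2$-cells, modulo the attaching maps of the $3$-cells). A central extension of $G$ by an abelian group $A$ is a short exact sequence $1\to A\to E\to G\to 1$ with the image of $A$ central in $E$; two of them are equivalent if there is an isomorphism of the middle groups that induces the identity on $A$ and on $G$. Cellular cochains have trivial coefficients in $A$; a $2$-cochain assigns to each oriented $2$-cell an element of $A$, and is a cocycle if it vanishes on the boundary of every $3$-cell. Let $K$ be an explicit finite model of the $3$-skeleton of a $K(G,1)$, let $A=\langle X\mid Y\rangle$ be an abelian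 group given by a finite presentation, let $T$ be a maximal tree in the $1$-skeleton of $K$, and let $S$ be the set of edges outside $T$; we regard the $r_j$ as words in $S^{\pm1}$ by deleting the letters in $T$. **(1)** Let $\sigma$ be a cellular $2$-cocycle on $K$ with values in $A$, and for each $2$-cell $j$ let $a_j$ be a word in $X^{\pm1}$ that equals $\sigma(j)$ in $A$. Then the group $$E_\sigma=\langle S\cup X\mid Y;\ r_j=a_j \text{ for all } j;\ [x,s]=1 \text{ for all } x\in X,\ s\in S\rangle$$ is a central extension of $G$ by $A$, via $x\mapsto x$ on $A$ and the projection to $G\cong\pi_1(K)\cong\pi_1(K/T)=\langle S\mid r_j\rangle$ that kills $X$. Two extensions $E_\sigma$, $E_{\sigma'}$ are equivalent if and only if $\sigma$ and $\sigma'$ differ by a cellular coboundary. Every central extension $E$ of $G$ by $A$ is equivalent to some $E_\sigma$: lifts to $E$ of the generators $s\in S$ of $G$ exist, and for every choice of lifts $\tilde s$, the elements $\sigma(j)=r_j(\tilde s)\in A$ form such a cocycle. **(2)** There is one algorithm which, given any such $K$ and any such presentation $\langle X\mid Y\rangle$ (and proceeding under the assumption that they are as described), lists finite presentations of the form in (1),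 for a fixed maximal tree $T$ and for words $a_j$ that represent cellular $2$-cocycles, such that every central extension of $G$ by $A$ is equivalent to exactly one extension on the list. If the list is finite, the algorithm reports when it has ended. -/

import Mathlib

/-! ## Finite presentations -/

/-- A finite presentation, as raw data: a list of generators (names from `α`) and a list of
relators, which are words in the names; `(x, true)` is the letter `x` and `(x, false)` is its
formal inverse, as in `FreeGroup.mk`. -/
structure FinPresentation (α : Type) where
  gens : List α
  rels : List (List (α × Bool))

namespace FinPresentation

variable {α : Type}

/-- All relators are words in the listed generators. -/
def WellFormed (P : FinPresentation α) : Prop :=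
  ∀ r ∈ P.rels, ∀ l ∈ r, l.1 ∈ P.gens

/-- The underlying product, through which presentations are encoded as numbers. -/
def equivProd : FinPresentation α ≃ List α × List (List (α × Bool)) where
  toFun P := (P.gens, P.rels)
  invFun x := ⟨x.1, x.2⟩
  left_inv _ := rfl
  right_inv _ := rfl

instance [Primcodable α] : Primcodable (FinPresentation α) :=
  Primcodable.ofEquiv _ equivProd

/-- Reading a word as an element of the free group on the listed generators. Letters that are not
among the generators (which do not occur in well-formed presentations) are read as `1`. -/
def freeWord [DecidableEq α] (P : FinPresentation α) :
    FreeGroup α →* FreeGroup {x : α // x ∈ P.gens} :=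
  FreeGroup.lift fun x => if h : x ∈ P.gens then FreeGroup.of ⟨x, h⟩ else 1

/-- The group `⟨gens | rels⟩`. -/
abbrev Presented [DecidableEq α] (P : FinPresentation α) : Type :=
  PresentedGroup {g : FreeGroup {x : α // x ∈ P.gens} |
    ∃ r ∈ P.rels, g = P.freeWord (FreeGroup.mk r)}

/-- The element of `⟨gens | rels⟩` that is represented by a word. -/
def eval [DecidableEq α] (P : FinPresentation α) : FreeGroup α →* P.Presented :=
  (PresentedGroup.mk _).comp P.freeWord

end FinPresentation

/-! ## Explicit finite 3-dimensional cell complexes -/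

/-- An explicit finite cell complex of dimension at most 3, as raw data.
* The 0-cells are `0, …, numVertices - 1`.
* `edges` lists the initial and the terminal vertex of each (oriented) 1-cell.
* `faces` lists, for each 2-cell, the vertex of its starting corner and its attaching path, a word
  in the oriented 1-cells.
* `solids` lists the 3-cells. The attaching map of a 3-cell is a spherical diagram on the
  2-skeleton: a base vertex `c` and a list of triples `(q, j, ε)`, where `q` is an edge path from
  `c` to the starting corner of the 2-cell `j` and `ε` is an orientation; the product of the loops
  `q (∂j)^ε q⁻¹` has to be null-homotopic in the 1-skeleton, so that folding up the boundary of
  this planar bouquet of 2-cells gives a map of the 2-sphere. -/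
structure CellComplex3 where
  numVertices : ℕ
  edges : List (ℕ × ℕ)
  faces : List (ℕ × List (ℕ × Bool))
  solids : List (ℕ × List (List (ℕ × Bool) × ℕ × Bool))

namespace CellComplex3

/-- The underlying product, through which complexes are encoded as numbers. -/
def equivProd : CellComplex3 ≃ ℕ × List (ℕ × ℕ) × List (ℕ × List (ℕ × Bool)) ×
    List (ℕ × List (List (ℕ × Bool) × ℕ × Bool)) where
  toFun K := (K.numVertices, K.edges, K.faces, K.solids)
  invFun x := ⟨x.1, x.2.1, x.2.2.1, x.2.2.2⟩
  left_inv _ := rfl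
  right_inv _ := rfl

instance : Primcodable CellComplex3 := Primcodable.ofEquiv _ equivProd

/-- `K.IsWalk u w v`: the word `w` is an edge path in `K` from `u` to `v`. -/
inductive IsWalk (K : CellComplex3) : ℕ → List (ℕ × Bool) → ℕ → Prop
  | nil (u : ℕ) : IsWalk K u [] u
  | fwd {e u u' v : ℕ} {w : List (ℕ × Bool)} :
      K.edges[e]? = some (u, u') → IsWalk K u' w v → IsWalk K u ((e, true) :: w) v
  | bwd {e u u' v : ℕ} {w : List (ℕ × Bool)} :
      K.edges[e]? = some (u', u) → IsWalk K u' w v → IsWalk K u ((e, false) :: w) v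

theorem IsWalk.append {K : CellComplex3} {u v x : ℕ} {w w' : List (ℕ × Bool)}
    (h : K.IsWalk u w v) (h' : K.IsWalk v w' x) : K.IsWalk u (w ++ w') x := by
  induction h with
  | nil u => simpa using h'
  | fwd he _ ih => exact IsWalk.fwd he (ih h')
  | bwd he _ ih => exact IsWalk.bwd he (ih h')

theorem IsWalk.invRev {K : CellComplex3} {u v : ℕ} {w : List (ℕ × Bool)}
    (h : K.IsWalk u w v) : K.IsWalk v (FreeGroup.invRev w) u := by
  induction h with
  | nil u => exact IsWalk.nil u
  | fwd he _ ih =>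
    simpa [FreeGroup.invRev] using ih.append (IsWalk.bwd he (IsWalk.nil _))
  | bwd he _ ih =>
    simpa [FreeGroup.invRev] using ih.append (IsWalk.fwd he (IsWalk.nil _))

/-- Homotopy classes, rel endpoints, of edge paths from `u` to `v` in the 1-skeleton; two edge
paths are homotopic there if and only if they are freely equal as words. -/
def paths (K : CellComplex3) (u v : ℕ) : Set (FreeGroup ℕ) :=
  {g | ∃ w, K.IsWalk u w v ∧ FreeGroup.mk w = g}

/-- The fundamental group of the 1-skeleton, based at `v`. -/
def loopGroup (K : CellComplex3) (v : ℕ) : Subgroup (FreeGroup ℕ) where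
  carrier := K.paths v v
  one_mem' := ⟨[], IsWalk.nil v, rfl⟩
  mul_mem' := by
    rintro _ _ ⟨w, hw, rfl⟩ ⟨w', hw', rfl⟩
    exact ⟨w ++ w', hw.append hw', by simp⟩
  inv_mem' := by
    rintro _ ⟨w, hw, rfl⟩
    exact ⟨FreeGroup.invRev w, hw.invRev, by simp⟩

/-- The loops `p (∂j) p⁻¹` at `v`, for the 2-cells `j` and the paths `p` from `v` to their
starting corners. -/
def faceLoops (K : CellComplex3) (v : ℕ) : Set (K.loopGroup v) :=
  {γ | ∃ f ∈ K.faces, ∃ p ∈ K.paths v f.1,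
    (γ : FreeGroup ℕ) = p * FreeGroup.mk f.2 * p⁻¹}

/-- The fundamental group of `K`, based at `v`: edge loops modulo the boundaries of 2-cells. -/
abbrev Pi1 (K : CellComplex3) (v : ℕ) : Type :=
  K.loopGroup v ⧸ Subgroup.normalClosure (K.faceLoops v)

/-- The boundary loop of a 2-cell conjugated by a path, `q (∂j)^ε q⁻¹`. -/
def tripleLoop (K : CellComplex3) (y : List (ℕ × Bool) × ℕ × Bool) : FreeGroup ℕ :=
  FreeGroup.mk y.1 *
    (cond y.2.2 (FreeGroup.mk (K.faces.getD y.2.1 (0, [])).2)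
      (FreeGroup.mk (K.faces.getD y.2.1 (0, [])).2)⁻¹) * (FreeGroup.mk y.1)⁻¹

/-- The raw data describe a cell complex. -/
structure WellFormed (K : CellComplex3) : Prop where
  edges_lt : ∀ e ∈ K.edges, e.1 < K.numVertices ∧ e.2 < K.numVertices
  faces_closed : ∀ f ∈ K.faces, f.1 < K.numVertices ∧ K.IsWalk f.1 f.2 f.1
  solids_base : ∀ s ∈ K.solids, s.1 < K.numVertices
  solids_walk : ∀ s ∈ K.solids, ∀ y ∈ s.2, ∃ f, K.faces[y.2.1]? = some f ∧ K.IsWalk s.1 y.1 f.1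
  solids_spherical : ∀ s ∈ K.solids, (s.2.map K.tripleLoop).prod = 1

/-- `K` is nonempty and path-connected. -/
def Connected (K : CellComplex3) : Prop :=
  0 < K.numVertices ∧ ∀ u < K.numVertices, ∀ v < K.numVertices, ∃ w, K.IsWalk u w v

/-- A 2-cell together with a homotopy class of paths in the 1-skeleton from `v` to its corner.
These are the free generators, up to the Peiffer relations, of the relative homotopy group
`π₂(K⁽²⁾, K⁽¹⁾, v)`. -/
structure BasedFace (K : CellComplex3) (v : ℕ) where
  idx : Fin K.faces.length
  path : FreeGroup ℕ
  path_mem : path ∈ K.paths v (K.faces[idx]).1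

/-- The boundary loop of a based 2-cell. -/
def BasedFace.boundary {K : CellComplex3} {v : ℕ} (x : K.BasedFace v) : FreeGroup ℕ :=
  x.path * FreeGroup.mk (K.faces[x.idx]).2 * x.path⁻¹

/-- The boundary homomorphism `∂` from the free group on the based 2-cells to the fundamental
group of the 1-skeleton (regarded inside the free group on all edges). -/
def boundaryHom (K : CellComplex3) (v : ℕ) : FreeGroup (K.BasedFace v) →* FreeGroup ℕ :=
  FreeGroup.lift BasedFace.boundary

/-- The Peiffer elements `x y x⁻¹ (∂x • y)⁻¹`. -/
def peiffer (K : CellComplex3) (v : ℕ) : Set (FreeGroup (K.BasedFace v)) :=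
  {h | ∃ x y z : K.BasedFace v, z.idx = y.idx ∧ z.path = x.boundary * y.path ∧
    h = FreeGroup.of x * FreeGroup.of y * (FreeGroup.of x)⁻¹ * (FreeGroup.of z)⁻¹}

/-- The elements of `π₂(K⁽²⁾, K⁽¹⁾, v)` given by the attaching maps of the 3-cells, transported to
`v` along all paths `p`. -/
def solidSpheres (K : CellComplex3) (v : ℕ) : Set (FreeGroup (K.BasedFace v)) :=
  {h | ∃ s ∈ K.solids, ∃ p ∈ K.paths v s.1, ∃ L : List (K.BasedFace v × Bool),
    L.map (fun x => (x.1.path, (x.1.idx : ℕ), x.2)) =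
      s.2.map (fun y => (p * FreeGroup.mk y.1, y.2.1, y.2.2)) ∧
    h = FreeGroup.mk L}

/-- `π₂(K, v) = 0`. The group `π₂(K⁽²⁾, K⁽¹⁾, v)` is the free crossed module on the 2-cells, that
is, the free group on the based 2-cells modulo the Peiffer elements; `π₂(K⁽²⁾, v)` is the kernel
of its boundary map, and `π₂(K, v)` is the quotient of that by the classes of the attaching maps
of the 3-cells. -/
def Pi2Trivial (K : CellComplex3) (v : ℕ) : Prop :=
  (K.boundaryHom v).ker ≤ Subgroup.normalClosure (K.peiffer v ∪ K.solidSpheres v)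

/-- `K` is a connected 3-complex with `π₂ = 0`; equivalently, adding cells of dimension at least 4
makes it the 3-skeleton of a `K(π₁ K, 1)`. -/
structure IsThreeSkeleton (K : CellComplex3) : Prop where
  wellFormed : K.WellFormed
  connected : K.Connected
  pi2 : ∀ v < K.numVertices, K.Pi2Trivial v

/-- `T` is (the list of edges of) a maximal tree in the 1-skeleton. -/
structure IsMaximalTree (K : CellComplex3) (T : List ℕ) : Prop where
  lt : ∀ t ∈ T, t < K.edges.length
  connected : ∀ u < K.numVertices, ∀ v < K.numVertices,
    ∃ w, K.IsWalk u w v ∧ ∀ l ∈ w, l.1 ∈ T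
  acyclic : ∀ v w, K.IsWalk v w v → (∀ l ∈ w, l.1 ∈ T) → FreeGroup.mk w = 1

/-! ### Cellular cochains, with trivial coefficients in an abelian group written multiplicatively -/

/-- The cellular 2-cochain `σ`, which assigns `σ j` to the 2-cell `j`, vanishes on the boundary of
every 3-cell. -/
def IsCocycle (K : CellComplex3) {A : Type*} [Group A] (σ : ℕ → A) : Prop :=
  ∀ s ∈ K.solids, (s.2.map fun y => cond y.2.2 (σ y.2.1) (σ y.2.1)⁻¹).prod = 1

/-- The 2-cochains `σ` and `σ'` differ by the coboundary of a 1-cochain `τ`. -/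
def Cohomologous (K : CellComplex3) {A : Type*} [Group A] (σ σ' : ℕ → A) : Prop :=
  ∃ τ : ℕ → A, ∀ j f, K.faces[j]? = some f →
    σ j = σ' j * FreeGroup.lift τ (FreeGroup.mk f.2)

end CellComplex3

/-! ## The presentations of the central extensions -/

/-- The 2-cochain with values in `⟨X | Y⟩` given by a list of words in `X`, one for each 2-cell. -/
def FinPresentation.cochain (P : FinPresentation ℕ) (a : List (List (ℕ × Bool))) (j : ℕ) :
    P.Presented :=
  P.eval (FreeGroup.mk (a.getD j []))

namespace CellComplex3

/-- The words `a_j` in `X^{±1}`, one for each 2-cell, represent a cellular 2-cocycle with values in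
`A = ⟨X | Y⟩`. -/
structure CocycleWords (K : CellComplex3) (P : FinPresentation ℕ) (a : List (List (ℕ × Bool))) :
    Prop where
  length_eq : a.length = K.faces.length
  letters : ∀ w ∈ a, ∀ l ∈ w, l.1 ∈ P.gens
  cocycle : K.IsCocycle (P.cochain a)

/-- The edges that survive when the maximal tree `T` is contracted. -/
def outside (K : CellComplex3) (T : List ℕ) : List ℕ :=
  (List.range K.edges.length).filter (fun e => e ∉ T)

/-- The presentation `⟨S ∪ X | Y; r_j = a_j; [x, s] = 1⟩`, where `P = ⟨X | Y⟩`, `S` is the set of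
edges outside the maximal tree `T`, and `r_j` is the attaching path of the 2-cell `j` in the
complex with `T` contracted. -/
def centralPresentation (K : CellComplex3) (T : List ℕ) (P : FinPresentation ℕ)
    (a : List (List (ℕ × Bool))) : FinPresentation (ℕ ⊕ ℕ) where
  gens := (K.outside T).map Sum.inl ++ P.gens.map Sum.inr
  rels :=
    P.rels.map (fun r => r.map (Prod.map Sum.inr id)) ++
    List.zipWith (fun f w => (f.2.filter (fun l => l.1 ∉ T)).map (Prod.map Sum.inl id) ++
      FreeGroup.invRev (w.map (Prod.map Sum.inr id))) K.faces a ++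
    P.gens.flatMap (fun x => (K.outside T).map (fun s =>
      [(Sum.inr x, true), (Sum.inl s, true), (Sum.inr x, false), (Sum.inl s, false)]))

/-- `S` is the standard extension `1 → A → ⟨S ∪ X | Y; r_j = a_j; [x, s] = 1⟩ → G → 1`, for
identifications `φ : π₁(K, v) ≃ G` and `ψ : ⟨X | Y⟩ ≃ A`: the inclusion sends `x` to `x`, and an
edge loop at `v`, read in the generators `S` after contracting `T`, projects to its class. -/
structure IsStandardExtension (K : CellComplex3) (T : List ℕ) (P : FinPresentation ℕ)
    (a : List (List (ℕ × Bool))) {v : ℕ} {G A : Type*} [Group G] [CommGroup A]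
    (φ : K.Pi1 v ≃* G) (ψ : P.Presented ≃* A)
    (S : GroupExtension A (K.centralPresentation T P a).Presented G) : Prop where
  inl_eval : ∀ g : FreeGroup ℕ,
    S.inl (ψ (P.eval g)) = (K.centralPresentation T P a).eval (FreeGroup.map Sum.inr g)
  rightHom_eval : ∀ γ : K.loopGroup v,
    S.rightHom ((K.centralPresentation T P a).eval (FreeGroup.map Sum.inl (γ : FreeGroup ℕ))) =
      φ (QuotientGroup.mk γ)

/-- `τ` chooses, in the extension `S` of `G ≅ π₁(K, v)`, lifts of the generators of `G` given by
the edges outside the maximal tree `T` (and the identity for the edges of `T`). -/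
structure IsLift (K : CellComplex3) (T : List ℕ) {v : ℕ} {G A E : Type*} [Group G] [CommGroup A]
    [Group E] (φ : K.Pi1 v ≃* G) (S : GroupExtension A E G) (τ : ℕ → E) : Prop where
  tree : ∀ t ∈ T, τ t = 1
  lifts : ∀ γ : K.loopGroup v,
    S.rightHom (FreeGroup.lift τ (γ : FreeGroup ℕ)) = φ (QuotientGroup.mk γ)

end CellComplex3

/-- A group extension is central if the image of the kernel lies in the center. -/
def GroupExtension.IsCentral {A E G : Type*} [Group A] [Group E] [Group G]
    (S : GroupExtension A E G) : Prop :=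
  S.inl.range ≤ Subgroup.center E

/-! ## Homomorphisms out of presented groups -/

/-! Let `F` be the fundamental group of the 1-skeleton and `C` the free group on the based 2-cells,
with boundary map `∂ : C → F`; the image of `∂` is the kernel of `F → G`. A 2-cochain `σ` extends to
`C → A` by forgetting the paths. It kills the Peiffer elements because `A` is abelian, and a cocycle
kills the attaching spheres of the 3-cells, so `π₂ = 0` makes a cocycle vanish on the kernel of `∂`.
Therefore `A` embeds in the quotient of `F × A` by the pairs `(∂h, σ(h)⁻¹)`. The group `E_σ` maps to
this quotient compatibly with `A`, so `A` embeds in `E_σ` as well (`coeffHom_injective`). The rest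
of exactness is formal: every element of `E_σ` is an edge word times a coefficient, and boundary
loops are coefficients.

Conversely, lifts of the generators to a central extension define a homomorphism on `F`. The value
of `r_j` lies in `A`, since `r_j` is trivial in `G`. A spherical diagram is trivial in `F` and its
conjugating paths drop out by centrality, so these values form a cocycle. The lifts then satisfy the
relations of `E_σ`, which gives a map of extensions, automatically an isomorphism
(`nonempty_equiv`). Two choices of lifts differ by a 1-cochain, and the values on the 2-cells by its
coboundary. Together this is `classification`.

For the algorithm, words are replaced by exponent vectors, and cochains with values in `A` by
integer cochains modulo the relations of `A` (`vecEval_eq_zero_iff`). The second cohomology is a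
finitely generated abelian group, hence a direct sum of cyclic groups of orders `d` (with `0` for
infinite order) generated by cocycles `z`. That `(d, z)` is such a basis amounts to four assertions
of the form "every integral solution of `g x = 0` has `f x` in the image of `h`". Such an assertion
holds if and only if there is an identity `N (f - h μ) = Y g` with `N ≠ 0`
(`exists_linear_certificate`, `Check.holds`). An unbounded search over certificates, each checked
primitive recursively, therefore finds a maximal tree and a basis. The classes are then listed by
their coefficient vectors, reduced modulo the orders (`unrank`). -/

theorem FreeGroup.lift_mk_eq_one {α H : Type*} [Group H] {f : α → H} {w : List (α × Bool)}
    (h : ∀ l ∈ w, f l.1 = 1) : FreeGroup.lift f (FreeGroup.mk w) = 1 := by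
  rw [FreeGroup.lift_mk]
  apply List.prod_eq_one
  simp only [List.mem_map]
  rintro x ⟨⟨a, b⟩, hl, rfl⟩
  have := h _ hl
  cases b <;> simp_all

theorem FreeGroup.mk_cons {α : Type*} (l : α × Bool) (w : List (α × Bool)) :
    FreeGroup.mk (l :: w) = FreeGroup.mk [l] * FreeGroup.mk w := by
  simp [FreeGroup.mul_mk]

namespace FinPresentation

variable {α : Type} [DecidableEq α] (P : FinPresentation α)

theorem eval_surjective : Function.Surjective P.eval := by
  intro x
  obtain ⟨g, rfl⟩ := PresentedGroup.mk_surjective _ x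
  refine ⟨FreeGroup.map Subtype.val g, ?_⟩
  have : P.freeWord.comp (FreeGroup.map Subtype.val) = MonoidHom.id _ := by
    ext x
    simp [freeWord, x.2]
  have h := DFunLike.congr_fun this g
  simp only [MonoidHom.comp_apply, MonoidHom.id_apply] at h
  simp [eval, h]

theorem eval_of_eq_one {x : α} (hx : x ∉ P.gens) : P.eval (FreeGroup.of x) = 1 := by
  have : P.freeWord (FreeGroup.of x) = 1 := by simp [freeWord, hx]
  rw [eval, MonoidHom.comp_apply, this, map_one]

theorem eval_mk_eq_one {r : List (α × Bool)} (hr : r ∈ P.rels) : P.eval (FreeGroup.mk r) = 1 :=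
  PresentedGroup.one_of_mem ⟨r, hr, rfl⟩

/-- Every element is represented by a word in the listed generators. -/
theorem exists_word (x : P.Presented) :
    ∃ w : List (α × Bool), (∀ l ∈ w, l.1 ∈ P.gens) ∧ P.eval (FreeGroup.mk w) = x := by
  obtain ⟨g, rfl⟩ := PresentedGroup.mk_surjective _ x
  refine ⟨g.toWord.map (Prod.map Subtype.val id), ?_, ?_⟩
  · simp only [List.mem_map]
    rintro _ ⟨⟨y, b⟩, _, rfl⟩
    exact y.2
  · have : P.freeWord.comp (FreeGroup.map Subtype.val) = MonoidHom.id _ := by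
      ext x
      simp [freeWord, x.2]
    have h := DFunLike.congr_fun this g
    simp only [MonoidHom.comp_apply, MonoidHom.id_apply] at h
    have h2 : FreeGroup.mk (g.toWord.map (Prod.map Subtype.val id)) =
        FreeGroup.map Subtype.val g := by
      conv_rhs => rw [← FreeGroup.mk_toWord (x := g)]
      rw [FreeGroup.map.mk]
      rfl
    rw [h2]
    simp [eval, h]

/-- The universal property of a finitely presented group. -/
theorem exists_hom {H : Type*} [Group H] (f : α → H) (hf : ∀ x ∉ P.gens, f x = 1)
    (hr : ∀ r ∈ P.rels, FreeGroup.lift f (FreeGroup.mk r) = 1) :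
    ∃ h : P.Presented →* H, ∀ g, h (P.eval g) = FreeGroup.lift f g := by
  have key : ∀ g, FreeGroup.lift (fun x : {x // x ∈ P.gens} => f x) (P.freeWord g) =
      FreeGroup.lift f g := by
    intro g
    have : (FreeGroup.lift (fun x : {x // x ∈ P.gens} => f x)).comp P.freeWord =
        FreeGroup.lift f := by
      ext x
      by_cases hx : x ∈ P.gens
      · simp [freeWord, hx]
      · simp [freeWord, hx, hf x hx]
    exact DFunLike.congr_fun this g
  refine ⟨PresentedGroup.toGroup (f := fun x => f x.1) ?_, ?_⟩
  · rintro _ ⟨r, hr', rfl⟩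
    rw [key, hr r hr']
  · intro g
    rw [← key]
    rfl

end FinPresentation

/-! ### The group given by the central presentation -/

namespace CellComplex3

variable (K : CellComplex3) (T : List ℕ) (P : FinPresentation ℕ) (a : List (List (ℕ × Bool)))

/-- Words in the edges, read in the central extension. -/
def edgeHom : FreeGroup ℕ →* (K.centralPresentation T P a).Presented :=
  (K.centralPresentation T P a).eval.comp (FreeGroup.map Sum.inl)

theorem mem_gens_inl {e : ℕ} : Sum.inl e ∈ (K.centralPresentation T P a).gens ↔
    e ∈ K.outside T := by
  simp [centralPresentation]

theorem mem_gens_inr {x : ℕ} : Sum.inr x ∈ (K.centralPresentation T P a).gens ↔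
    x ∈ P.gens := by
  simp [centralPresentation]

theorem edgeHom_of_eq_one {e : ℕ} (he : e ∉ K.outside T) :
    K.edgeHom T P a (FreeGroup.of e) = 1 := by
  simp only [edgeHom, MonoidHom.comp_apply, FreeGroup.map.of]
  exact FinPresentation.eval_of_eq_one _ (by rwa [mem_gens_inl])

theorem exists_coeffHom : ∃ c : P.Presented →* (K.centralPresentation T P a).Presented,
    ∀ g, c (P.eval g) = (K.centralPresentation T P a).eval (FreeGroup.map Sum.inr g) := by
  obtain ⟨c, hc⟩ := P.exists_hom
    (fun x => (K.centralPresentation T P a).eval (FreeGroup.of (Sum.inr x)))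
    (fun x hx => FinPresentation.eval_of_eq_one _ (by rwa [mem_gens_inr])) (by
      intro r hr
      have h := (K.centralPresentation T P a).eval_mk_eq_one
        (r := r.map (Prod.map Sum.inr id)) (by
          simp only [centralPresentation, List.mem_append, List.mem_map]
          exact Or.inl (Or.inl ⟨r, hr, rfl⟩))
      rw [← h]
      have : FreeGroup.lift (fun x => (K.centralPresentation T P a).eval
          (FreeGroup.of (Sum.inr x))) =
          (K.centralPresentation T P a).eval.comp (FreeGroup.map Sum.inr) := by
        ext x; simp
      rw [this, MonoidHom.comp_apply, FreeGroup.map.mk]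
      rfl)
  refine ⟨c, fun g => ?_⟩
  rw [hc]
  have : FreeGroup.lift (fun x => (K.centralPresentation T P a).eval
      (FreeGroup.of (Sum.inr x))) =
      (K.centralPresentation T P a).eval.comp (FreeGroup.map Sum.inr) := by
    ext x; simp
  rw [this]
  rfl

/-- The homomorphism from the coefficients to the central extension. -/
noncomputable def coeffHom : P.Presented →* (K.centralPresentation T P a).Presented :=
  (K.exists_coeffHom T P a).choose

theorem coeffHom_eval (g : FreeGroup ℕ) : K.coeffHom T P a (P.eval g) =
    (K.centralPresentation T P a).eval (FreeGroup.map Sum.inr g) :=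
  (K.exists_coeffHom T P a).choose_spec g

/-- A property of elements of the central extension follows from its closure properties. -/
theorem central_closure_eq_top (H : Subgroup (K.centralPresentation T P a).Presented)
    (h₁ : ∀ e ∈ K.outside T, K.edgeHom T P a (FreeGroup.of e) ∈ H)
    (h₂ : ∀ x, K.coeffHom T P a x ∈ H) : H = ⊤ := by
  rw [eq_top_iff]
  rintro g -
  obtain ⟨w, rfl⟩ := FinPresentation.eval_surjective _ g
  induction w using FreeGroup.induction_on with
  | C1 => simp
  | of x =>
    rcases x with e | x
    · by_cases he : e ∈ K.outside T
      · simpa [edgeHom] using h₁ e he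
      · have := K.edgeHom_of_eq_one T P a he
        simp only [edgeHom, MonoidHom.comp_apply, FreeGroup.map.of] at this
        simp [this]
    · simpa [coeffHom_eval] using h₂ (P.eval (FreeGroup.of x))
  | inv_of x hx => rw [map_inv]; exact H.inv_mem hx
  | mul x y hx hy => rw [map_mul]; exact H.mul_mem hx hy

/-- The presentation imposes commutators only between a letter of `X` and a letter of `S`.
Centralizers are subgroups, so this spreads from letters to all coefficients; that coefficients
commute with each other comes from `hP`. -/
theorem coeffHom_mem_center (hP : ∀ x y : P.Presented, x * y = y * x) (x : P.Presented) :
    K.coeffHom T P a x ∈ Subgroup.center (K.centralPresentation T P a).Presented := by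
  have hcomm : ∀ e ∈ K.outside T, ∀ y : P.Presented,
      K.coeffHom T P a y ∈ Subgroup.centralizer {K.edgeHom T P a (FreeGroup.of e)} := by
    intro e he y
    obtain ⟨w, rfl⟩ := P.eval_surjective y
    induction w using FreeGroup.induction_on with
    | C1 => rw [map_one, map_one]; exact one_mem _
    | of x =>
      by_cases hx : x ∈ P.gens
      · have h := (K.centralPresentation T P a).eval_mk_eq_one
          (r := [(Sum.inr x, true), (Sum.inl e, true), (Sum.inr x, false), (Sum.inl e, false)]) (by
            simp only [centralPresentation, List.mem_append, List.mem_flatMap, List.mem_map]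
            exact Or.inr ⟨x, hx, e, he, rfl⟩)
        rw [Subgroup.mem_centralizer_singleton_iff]
        rw [coeffHom_eval]
        simp only [edgeHom, MonoidHom.comp_apply, FreeGroup.map.of]
        rw [← mul_inv_eq_one, mul_inv_rev, ← mul_assoc]
        rw [← h, ← map_mul, ← map_inv, ← map_inv, ← map_mul, ← map_mul]
        congr 1
      · rw [P.eval_of_eq_one hx, map_one]; exact one_mem _
    | inv_of x hx => rw [map_inv, map_inv]; exact Subgroup.inv_mem _ hx
    | mul x y hx hy => rw [map_mul, map_mul]; exact Subgroup.mul_mem _ hx hy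
  have := K.central_closure_eq_top T P a (Subgroup.centralizer {K.coeffHom T P a x})
    (fun e he => by
      have := hcomm e he x
      rw [Subgroup.mem_centralizer_singleton_iff] at this ⊢
      exact this.symm)
    (fun y => by
      rw [Subgroup.mem_centralizer_singleton_iff, ← map_mul, hP, map_mul])
  rw [Subgroup.mem_center_iff]
  intro g
  have hg : g ∈ Subgroup.centralizer {K.coeffHom T P a x} := this ▸ Subgroup.mem_top g
  rw [Subgroup.mem_centralizer_singleton_iff] at hg
  exact hg

/-- Letters of `T` are not generators of the presentation, and such letters are read as `1`.
Attaching paths can therefore be evaluated without deleting the tree edges. -/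
theorem edgeHom_mk_filter (hT : ∀ t ∈ T, t ∉ K.outside T) (w : List (ℕ × Bool)) :
    K.edgeHom T P a (FreeGroup.mk (w.filter (fun l => l.1 ∉ T))) =
      K.edgeHom T P a (FreeGroup.mk w) := by
  induction w with
  | nil => rfl
  | cons l w ih =>
    rw [FreeGroup.mk_cons l w, map_mul, ← ih]
    by_cases hl : l.1 ∈ T
    · rw [List.filter_cons_of_neg (by simpa using hl)]
      have h1 := K.edgeHom_of_eq_one T P a (hT _ hl)
      obtain ⟨e, b⟩ := l
      have h2 : K.edgeHom T P a (FreeGroup.mk [(e, b)]) = 1 := by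
        cases b
        · have : FreeGroup.mk [(e, false)] = (FreeGroup.of e)⁻¹ := rfl
          rw [this, map_inv, h1, inv_one]
        · exact h1
      rw [h2, one_mul]
    · rw [List.filter_cons_of_pos (by simpa using hl), FreeGroup.mk_cons, map_mul]

theorem notMem_outside_of_mem {t : ℕ} (ht : t ∈ T) : t ∉ K.outside T := by
  simp [outside, ht]

theorem edgeHom_face (ha : a.length = K.faces.length) {j : ℕ} {f : ℕ × List (ℕ × Bool)}
    (hj : K.faces[j]? = some f) :
    K.edgeHom T P a (FreeGroup.mk f.2) = K.coeffHom T P a (P.cochain a j) := by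
  rw [← K.edgeHom_mk_filter T P a (fun t => K.notMem_outside_of_mem T)]
  rw [FinPresentation.cochain, coeffHom_eval]
  have hlt : j < K.faces.length := (List.getElem?_eq_some_iff.mp hj).1
  have h := (K.centralPresentation T P a).eval_mk_eq_one
    (r := (f.2.filter (fun l => l.1 ∉ T)).map (Prod.map Sum.inl id) ++
      FreeGroup.invRev ((a.getD j []).map (Prod.map Sum.inr id))) (by
        simp only [centralPresentation, List.mem_append]
        refine Or.inl (Or.inr ?_)
        rw [List.mem_iff_getElem?]
        refine ⟨j, ?_⟩
        rw [List.getElem?_zipWith, hj, List.getElem?_eq_getElem (by omega)]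
        simp [List.getD_eq_getElem?_getD, List.getElem?_eq_getElem (show j < a.length by omega)])
  rw [← FreeGroup.mul_mk, ← FreeGroup.inv_mk, map_mul, map_inv, mul_inv_eq_one] at h
  rw [edgeHom, MonoidHom.comp_apply, FreeGroup.map.mk, FreeGroup.map.mk]
  exact h

/-- The universal property of the presentation of the central extension. -/
theorem exists_central_hom {H : Type*} [Group H] (f : ℕ → H) (g : P.Presented →* H)
    (hf : ∀ e ∉ K.outside T, f e = 1)
    (hj : ∀ j r, K.faces[j]? = some r →
      FreeGroup.lift f (FreeGroup.mk r.2) = g (P.cochain a j))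
    (hc : ∀ e x, Commute (g x) (f e)) :
    ∃ h : (K.centralPresentation T P a).Presented →* H,
      (∀ w, h (K.edgeHom T P a w) = FreeGroup.lift f w) ∧
      (∀ x, h (K.coeffHom T P a x) = g x) := by
  set F : ℕ ⊕ ℕ → H := Sum.elim f (fun x => g (P.eval (FreeGroup.of x))) with hF
  have hinl : ∀ w, FreeGroup.lift F (FreeGroup.map Sum.inl w) = FreeGroup.lift f w := by
    intro w
    have : (FreeGroup.lift F).comp (FreeGroup.map Sum.inl) = FreeGroup.lift f := by
      ext x; simp [hF]
    exact DFunLike.congr_fun this w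
  have hinr : ∀ w, FreeGroup.lift F (FreeGroup.map Sum.inr w) = g (P.eval w) := by
    intro w
    have : (FreeGroup.lift F).comp (FreeGroup.map Sum.inr) = g.comp P.eval := by
      ext x; simp [hF]
    exact DFunLike.congr_fun this w
  have hfilter : ∀ w : List (ℕ × Bool), FreeGroup.lift f (FreeGroup.mk
      (w.filter (fun l => l.1 ∉ T))) = FreeGroup.lift f (FreeGroup.mk w) := by
    intro w
    induction w with
    | nil => rfl
    | cons l w ih =>
      rw [FreeGroup.mk_cons l w, map_mul, ← ih]
      by_cases hl : l.1 ∈ T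
      · rw [List.filter_cons_of_neg (by simpa using hl), FreeGroup.lift_mk_eq_one (w := [l]),
          one_mul]
        simpa using hf _ (K.notMem_outside_of_mem T hl)
      · rw [List.filter_cons_of_pos (by simpa using hl), FreeGroup.mk_cons, map_mul]
  obtain ⟨h, hh⟩ := (K.centralPresentation T P a).exists_hom F (by
    rintro (e | x) hx
    · exact hf e (by rwa [mem_gens_inl] at hx)
    · rw [mem_gens_inr] at hx
      simp [hF, P.eval_of_eq_one hx]) (by
    intro r hr
    simp only [centralPresentation, List.mem_append, List.mem_map, List.mem_flatMap] at hr
    rcases hr with (⟨r, hr, rfl⟩ | hr) | ⟨x, hx, s, hs, rfl⟩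
    · have := hinr (FreeGroup.mk r)
      rw [FreeGroup.map.mk] at this
      rw [P.eval_mk_eq_one hr, map_one] at this
      exact this
    · rw [List.mem_iff_getElem?] at hr
      obtain ⟨j, hr⟩ := hr
      rw [List.getElem?_zipWith_eq_some] at hr
      obtain ⟨r', w, h1, h2, rfl⟩ := hr
      rw [← FreeGroup.mul_mk, ← FreeGroup.inv_mk, map_mul, map_inv, mul_inv_eq_one]
      have e1 := hinl (FreeGroup.mk (r'.2.filter (fun l => l.1 ∉ T)))
      have e2 := hinr (FreeGroup.mk w)
      rw [FreeGroup.map.mk] at e1 e2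
      refine e1.trans (Eq.trans ?_ e2.symm)
      rw [hfilter, hj j r' h1, FinPresentation.cochain, List.getD_eq_getElem?_getD, h2]
      rfl
    · have hcc := hc s (P.eval (FreeGroup.of x))
      have : FreeGroup.mk [(Sum.inr x, true), (Sum.inl s, true), (Sum.inr x, false),
          (Sum.inl s, false)] = FreeGroup.of (Sum.inr x) * FreeGroup.of (Sum.inl s) *
          (FreeGroup.of (Sum.inr x))⁻¹ * (FreeGroup.of (Sum.inl s))⁻¹ := rfl
      rw [this]
      simp only [map_mul, map_inv, FreeGroup.lift_apply_of, hF, Sum.elim_inl, Sum.elim_inr]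
      rw [hcc.eq]
      group)
  refine ⟨h, fun w => ?_, fun x => ?_⟩
  · rw [edgeHom, MonoidHom.comp_apply, hh, hinl]
  · obtain ⟨w, rfl⟩ := P.eval_surjective x
    rw [coeffHom_eval, hh, hinr]

end CellComplex3

/-! ### Contraction of a maximal tree, and the boundary map of the 2-cells -/

namespace CellComplex3

variable {K : CellComplex3}

theorem mul_mem_paths {u v x : ℕ} {g h : FreeGroup ℕ} (hg : g ∈ K.paths u v)
    (hh : h ∈ K.paths v x) : g * h ∈ K.paths u x := by
  obtain ⟨w, hw, rfl⟩ := hg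
  obtain ⟨w', hw', rfl⟩ := hh
  exact ⟨w ++ w', hw.append hw', by simp⟩

theorem inv_mem_paths {u v : ℕ} {g : FreeGroup ℕ} (hg : g ∈ K.paths u v) :
    g⁻¹ ∈ K.paths v u := by
  obtain ⟨w, hw, rfl⟩ := hg
  exact ⟨_, hw.invRev, by simp⟩

theorem of_mem_paths {e u v : ℕ} (he : K.edges[e]? = some (u, v)) :
    FreeGroup.of e ∈ K.paths u v :=
  ⟨_, IsWalk.fwd he (IsWalk.nil _), rfl⟩

/-- Contraction of a maximal tree: a retraction of words in the edges to loops, given by the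
paths `t u` from `v` to `u` in the tree. -/
structure TreeRetraction (K : CellComplex3) (T : List ℕ) (v : ℕ) where
  path : ℕ → FreeGroup ℕ
  hom : FreeGroup ℕ →* K.loopGroup v
  path_mem : ∀ u < K.numVertices, path u ∈ K.paths v u
  path_tree : ∀ u < K.numVertices, ∃ w : List (ℕ × Bool),
    (∀ l ∈ w, l.1 ∈ T) ∧ path u = FreeGroup.mk w
  hom_walk : ∀ u w x, u < K.numVertices → K.IsWalk u w x →
    (hom (FreeGroup.mk w) : FreeGroup ℕ) = path u * FreeGroup.mk w * (path x)⁻¹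
  hom_loop : ∀ γ : K.loopGroup v, hom (γ : FreeGroup ℕ) = γ
  hom_of : ∀ e ∉ K.outside T, hom (FreeGroup.of e) = 1

theorem IsMaximalTree.exists_retraction {T : List ℕ} (hT : K.IsMaximalTree T)
    (hK : K.WellFormed) {v : ℕ} (hv : v < K.numVertices) : Nonempty (TreeRetraction K T v) := by
  classical
  have h1 : ∀ u, ∃ w : List (ℕ × Bool), u < K.numVertices → K.IsWalk v w u ∧ ∀ l ∈ w, l.1 ∈ T := by
    intro u
    by_cases hu : u < K.numVertices
    · obtain ⟨w, hw⟩ := hT.connected v hv u hu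
      exact ⟨w, fun _ => hw⟩
    · exact ⟨[], fun h => absurd h hu⟩
  choose t ht using h1
  have hmem : ∀ u < K.numVertices, FreeGroup.mk (t u) ∈ K.paths v u :=
    fun u hu => ⟨t u, (ht u hu).1, rfl⟩
  have hedge : ∀ e, ∃ γ : K.loopGroup v, (∀ p, K.edges[e]? = some p →
      (γ : FreeGroup ℕ) = FreeGroup.mk (t p.1) * FreeGroup.of e * (FreeGroup.mk (t p.2))⁻¹) ∧
      (K.edges[e]? = none → γ = 1) := by
    intro e
    rcases he : K.edges[e]? with _ | ⟨a, b⟩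
    · exact ⟨1, by simp, by simp⟩
    · have hab := hK.edges_lt _ (List.mem_of_getElem? he)
      refine ⟨⟨FreeGroup.mk (t a) * FreeGroup.of e * (FreeGroup.mk (t b))⁻¹, ?_⟩, ?_, by simp⟩
      · exact mul_mem_paths (mul_mem_paths (hmem a hab.1) (of_mem_paths he))
          (inv_mem_paths (hmem b hab.2))
      · rintro p hp
        rw [Option.some.injEq] at hp
        subst hp
        rfl
  choose r hr hr' using hedge
  have hwalk : ∀ u w x, u < K.numVertices → K.IsWalk u w x →
      (FreeGroup.lift r (FreeGroup.mk w) : FreeGroup ℕ) =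
        FreeGroup.mk (t u) * FreeGroup.mk w * (FreeGroup.mk (t x))⁻¹ := by
    intro u w x hu hw
    induction hw with
    | nil u => rw [← FreeGroup.one_eq_mk, map_one, mul_one, mul_inv_cancel, Subgroup.coe_one]
    | @fwd e u u' x w he _ ih =>
      have hab := hK.edges_lt _ (List.mem_of_getElem? he)
      have h2 : FreeGroup.mk [(e, true)] = FreeGroup.of e := rfl
      rw [FreeGroup.mk_cons, map_mul, Subgroup.coe_mul, ih hab.2, h2, FreeGroup.lift_apply_of,
        hr e _ he]
      group
    | @bwd e u u' x w he _ ih =>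
      have hab := hK.edges_lt _ (List.mem_of_getElem? he)
      have h2 : FreeGroup.mk [(e, false)] = (FreeGroup.of e)⁻¹ := rfl
      rw [FreeGroup.mk_cons, map_mul, Subgroup.coe_mul, ih hab.1, h2, map_inv,
        FreeGroup.lift_apply_of, Subgroup.coe_inv, hr e _ he]
      group
  -- The chosen tree path from `v` to itself need not be empty, but acyclicity makes it freely
  -- trivial; this is why loops at `v` are fixed.
  have htv : FreeGroup.mk (t v) = 1 := hT.acyclic v _ (ht v hv).1 (ht v hv).2
  refine ⟨⟨fun u => FreeGroup.mk (t u), FreeGroup.lift r, hmem,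
    fun u hu => ⟨t u, (ht u hu).2, rfl⟩, hwalk, ?_, ?_⟩⟩
  · rintro ⟨γ, w, hw, rfl⟩
    ext1
    rw [hwalk v w v hv hw, htv]
    simp
  · intro e he
    rw [FreeGroup.lift_apply_of]
    rcases hee : K.edges[e]? with _ | ⟨x, y⟩
    · exact hr' e hee
    · have heT : e ∈ T := by
        by_contra h
        apply he
        rw [outside, List.mem_filter, List.mem_range]
        exact ⟨(List.getElem?_eq_some_iff.mp hee).1, by simpa using h⟩
      have hab := hK.edges_lt _ (List.mem_of_getElem? hee)
      ext1
      rw [hr e _ hee]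
      -- For an edge of the tree, the loop that runs out along the tree, over the edge and back lies
      -- entirely in the tree.
      have h3 := hT.acyclic v (t x ++ ([(e, true)] ++ FreeGroup.invRev (t y)))
        ((ht x hab.1).1.append ((IsWalk.fwd hee (IsWalk.nil _)).append (ht y hab.2).1.invRev)) (by
          intro l hl
          simp only [List.mem_append, List.mem_singleton] at hl
          rcases hl with hl | hl | hl
          · exact (ht x hab.1).2 l hl
          · subst hl; exact heT
          · simp only [FreeGroup.invRev, List.mem_reverse, List.mem_map] at hl
            obtain ⟨l', hl', rfl⟩ := hl
            exact (ht y hab.2).2 l' hl')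
      rw [← FreeGroup.mul_mk, ← FreeGroup.mul_mk, ← FreeGroup.inv_mk] at h3
      rw [Subgroup.coe_one, ← h3]
      simp only [FreeGroup.of, mul_assoc]

/-- A homomorphism that kills the tree kills the tree paths. -/
theorem TreeRetraction.lift_path {T : List ℕ} {v : ℕ} (ρ : TreeRetraction K T v) {H : Type*}
    [Group H] {f : ℕ → H} (hf : ∀ t ∈ T, f t = 1) {u : ℕ} (hu : u < K.numVertices) :
    FreeGroup.lift f (ρ.path u) = 1 := by
  obtain ⟨w, hw, h⟩ := ρ.path_tree u hu
  rw [h]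
  exact FreeGroup.lift_mk_eq_one fun l hl => hf _ (hw l hl)

/-! ### The boundary homomorphism -/

section boundary

variable (hK : K.WellFormed) (v : ℕ)

theorem WellFormed.boundary_mem (hK : K.WellFormed) {v : ℕ} (x : K.BasedFace v) :
    x.boundary ∈ K.loopGroup v := by
  have h := (hK.faces_closed _ (List.getElem_mem x.idx.2)).2
  exact mul_mem_paths (mul_mem_paths x.path_mem ⟨_, h, rfl⟩) (inv_mem_paths x.path_mem)

/-- The boundary homomorphism, with values in the loops. -/
def WellFormed.boundaryLoop : FreeGroup (K.BasedFace v) →* K.loopGroup v :=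
  FreeGroup.lift fun x => ⟨x.boundary, hK.boundary_mem x⟩

theorem WellFormed.coe_boundaryLoop (h : FreeGroup (K.BasedFace v)) :
    (hK.boundaryLoop v h : FreeGroup ℕ) = K.boundaryHom v h := by
  have : (K.loopGroup v).subtype.comp (hK.boundaryLoop v) = K.boundaryHom v := by
    ext x
    simp [boundaryLoop, boundaryHom]
  exact DFunLike.congr_fun this h

/-- The action of loops on based 2-cells. -/
def BasedFace.act {v : ℕ} (γ : K.loopGroup v) (x : K.BasedFace v) : K.BasedFace v :=
  ⟨x.idx, γ * x.path, mul_mem_paths γ.2 x.path_mem⟩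

theorem WellFormed.boundaryLoop_act (γ : K.loopGroup v) (h : FreeGroup (K.BasedFace v)) :
    hK.boundaryLoop v (FreeGroup.map (BasedFace.act γ) h) = γ * hK.boundaryLoop v h * γ⁻¹ := by
  have : (hK.boundaryLoop v).comp (FreeGroup.map (BasedFace.act γ)) =
      (MulAut.conj γ).toMonoidHom.comp (hK.boundaryLoop v) := by
    ext x
    simp [boundaryLoop, BasedFace.boundary, BasedFace.act, mul_assoc]
  exact DFunLike.congr_fun this h

/-- The based 2-cells carry all possible paths, so loops act on them and `∂` turns this action into
conjugation. The image of `∂` is thus already normal. -/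
theorem WellFormed.range_boundaryLoop :
    (hK.boundaryLoop v).range = Subgroup.normalClosure (K.faceLoops v) := by
  apply le_antisymm
  · rintro _ ⟨h, rfl⟩
    induction h using FreeGroup.induction_on with
    | C1 => rw [map_one]; exact one_mem _
    | of x =>
      apply Subgroup.subset_normalClosure
      exact ⟨_, List.getElem_mem x.idx.2, x.path, x.path_mem, by
        simp [boundaryLoop, BasedFace.boundary]⟩
    | inv_of x hx => rw [map_inv]; exact inv_mem hx
    | mul x y hx hy => rw [map_mul]; exact mul_mem hx hy
  · have : (hK.boundaryLoop v).range.Normal := ⟨by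
      rintro _ ⟨h, rfl⟩ γ
      exact ⟨_, hK.boundaryLoop_act v γ h⟩⟩
    apply Subgroup.normalClosure_le_normal
    rintro γ ⟨f, hf, p, hp, hγ⟩
    obtain ⟨j, hj, rfl⟩ := List.getElem_of_mem hf
    refine ⟨FreeGroup.of ⟨⟨j, hj⟩, p, hp⟩, ?_⟩
    ext1
    simp [boundaryLoop, BasedFace.boundary, hγ]

end boundary

/-- The homomorphism on based 2-cells given by a 2-cochain. -/
def cochainHom (K : CellComplex3) (v : ℕ) {A : Type*} [Group A] (σ : ℕ → A) :
    FreeGroup (K.BasedFace v) →* A :=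
  FreeGroup.lift fun x => σ x.idx

theorem cochainHom_act {v : ℕ} {A : Type*} [Group A] (σ : ℕ → A) (γ : K.loopGroup v)
    (h : FreeGroup (K.BasedFace v)) :
    K.cochainHom v σ (FreeGroup.map (BasedFace.act γ) h) = K.cochainHom v σ h := by
  have : (K.cochainHom v σ).comp (FreeGroup.map (BasedFace.act γ)) = K.cochainHom v σ := by
    ext x
    simp [cochainHom, BasedFace.act]
  exact DFunLike.congr_fun this h

/-- If `π₂ = 0`, then a 2-cocycle vanishes on all spheres in the 2-skeleton. -/
theorem IsCocycle.cochainHom_eq_one {v : ℕ} {A : Type*} [CommGroup A] {σ : ℕ → A}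
    (hσ : K.IsCocycle σ) (hpi : K.Pi2Trivial v) {h : FreeGroup (K.BasedFace v)}
    (hh : K.boundaryHom v h = 1) : K.cochainHom v σ h = 1 := by
  have hle : Subgroup.normalClosure (K.peiffer v ∪ K.solidSpheres v) ≤
      (K.cochainHom v σ).ker := by
    apply Subgroup.normalClosure_le_normal
    -- On a Peiffer element the four values cancel, because `A` is commutative and `y`, `z` are the
    -- same 2-cell with different paths. On a 3-cell the value is the sum that the cocycle condition
    -- kills, the transport along `p` being invisible.
    rintro h (⟨x, y, z, hi, -, rfl⟩ | ⟨s, hs, p, -, L, hL, rfl⟩)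
    · simp [cochainHom, hi]
    · rw [SetLike.mem_coe, MonoidHom.mem_ker, cochainHom, FreeGroup.lift_mk, ← hσ s hs]
      have := congrArg (List.map fun y : FreeGroup ℕ × ℕ × Bool =>
        cond y.2.2 (σ y.2.1) (σ y.2.1)⁻¹) hL
      simp only [List.map_map] at this
      exact congrArg List.prod this
  exact hle (hpi hh)

end CellComplex3

/-! ### Exactness and the universal property of the standard extension -/

namespace CellComplex3

variable {K : CellComplex3} {T : List ℕ} {P : FinPresentation ℕ} {v : ℕ} {G A : Type*} [Group G]
  [CommGroup A] {φ : K.Pi1 v ≃* G} {ψ : P.Presented ≃* A} {a : List (List (ℕ × Bool))}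

theorem presented_comm (ψ : P.Presented ≃* A) (x y : P.Presented) : x * y = y * x :=
  ψ.injective (by rw [map_mul, map_mul, mul_comm])

theorem IsCocycle.map {A B : Type*} [Group A] [Group B] {σ : ℕ → A} (hσ : K.IsCocycle σ)
    (f : A →* B) : K.IsCocycle (fun j => f (σ j)) := by
  intro s hs
  have := congrArg f (hσ s hs)
  rw [map_one, map_list_prod, List.map_map] at this
  rw [← this]
  congr 2
  funext y
  rcases y with ⟨q, j, _ | _⟩ <;> simp

theorem TreeRetraction.hom_face (ρ : TreeRetraction K T v) (hK : K.WellFormed) {j : ℕ}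
    {f : ℕ × List (ℕ × Bool)} (hj : K.faces[j]? = some f) :
    ∃ x : K.BasedFace v, (x.idx : ℕ) = j ∧
      ρ.hom (FreeGroup.mk f.2) = hK.boundaryLoop v (FreeGroup.of x) := by
  obtain ⟨hlt, rfl⟩ := List.getElem?_eq_some_iff.mp hj
  have hf := hK.faces_closed _ (List.getElem_mem hlt)
  refine ⟨⟨⟨j, hlt⟩, ρ.path K.faces[j].1, ρ.path_mem _ hf.1⟩, rfl, ?_⟩
  ext1
  rw [ρ.hom_walk _ _ _ hf.1 hf.2]
  simp [WellFormed.boundaryLoop, BasedFace.boundary]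

theorem lift_hom (ρ : TreeRetraction K T v) {H : Type*} [Group H] (F : K.loopGroup v →* H)
    (w : FreeGroup ℕ) :
    FreeGroup.lift (fun e => F (ρ.hom (FreeGroup.of e))) w = F (ρ.hom w) := by
  have : FreeGroup.lift (fun e => F (ρ.hom (FreeGroup.of e))) = F.comp ρ.hom := by
    ext x; simp
  rw [this]
  rfl

/-- The retraction only inserts tree paths at the ends of an edge, and these have value `1`.
Arbitrary edge words can thus be replaced by loops at `v`. -/
theorem edgeHom_hom (hK : K.WellFormed) (ρ : TreeRetraction K T v) (w : FreeGroup ℕ) :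
    K.edgeHom T P a (ρ.hom w : FreeGroup ℕ) = K.edgeHom T P a w := by
  have : ((K.edgeHom T P a).comp (K.loopGroup v).subtype).comp ρ.hom = K.edgeHom T P a := by
    ext e
    simp only [MonoidHom.comp_apply]
    by_cases he : e ∈ K.outside T
    · have hlt := List.mem_range.mp (List.mem_filter.mp he).1
      have hee := List.getElem?_eq_getElem hlt
      obtain ⟨p, hpe⟩ : ∃ p, p = K.edges[e] := ⟨_, rfl⟩
      rw [← hpe] at hee
      have hp := hK.edges_lt _ (List.mem_of_getElem? hee)
      have h1 : ∀ u < K.numVertices, K.edgeHom T P a (ρ.path u) = 1 := by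
        intro u hu
        obtain ⟨w, hw, h⟩ := ρ.path_tree u hu
        rw [h, ← K.edgeHom_mk_filter T P a (fun t => K.notMem_outside_of_mem T)]
        rw [List.filter_eq_nil_iff.mpr (by simpa using fun x y h => hw (x, y) h)]
        exact map_one _
      have h2 := ρ.hom_walk p.1 _ p.2 hp.1 (IsWalk.fwd hee (IsWalk.nil _))
      rw [Subgroup.subtype_apply, FreeGroup.of, h2, map_mul, map_mul, map_inv, h1 _ hp.1,
        h1 _ hp.2, one_mul, inv_one, mul_one]
    · rw [ρ.hom_of e he, map_one, map_one, K.edgeHom_of_eq_one T P a he]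
  exact DFunLike.congr_fun this w

/-- The pairs that have to be divided out of the product of the loops and the coefficients. -/
def relationHom (hK : K.WellFormed) (v : ℕ) (σ : ℕ → A) :
    FreeGroup (K.BasedFace v) →* K.loopGroup v × A :=
  (hK.boundaryLoop v).prod (K.cochainHom v σ)⁻¹

/-- Conjugation by `(γ, c)` is induced by the action of `γ` on the based 2-cells: `c` is central,
and the cochain does not see the paths. -/
theorem normal_range_relationHom (hK : K.WellFormed) (σ : ℕ → A) :
    (relationHom hK v σ).range.Normal := by
  refine ⟨?_⟩
  rintro _ ⟨h, rfl⟩ ⟨γ, c⟩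
  refine ⟨FreeGroup.map (BasedFace.act γ) h, ?_⟩
  simp [relationHom, hK.boundaryLoop_act, cochainHom_act]

/-- The coefficients inject into the group given by the central presentation. -/
theorem coeffHom_injective (hK : K.IsThreeSkeleton) (ρ : TreeRetraction K T v)
    (hv : v < K.numVertices) (ψ : P.Presented ≃* A) (ha : K.CocycleWords P a) :
    Function.Injective (K.coeffHom T P a) := by
  set σ : ℕ → A := fun j => ψ (P.cochain a j) with hσ
  have hc : K.IsCocycle σ := ha.cocycle.map ψ.toMonoidHom
  have := normal_range_relationHom (v := v) hK.wellFormed σ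
  -- The quotient by `N` is a model of the extension in which equality with `1` can be decided by
  -- inspecting pairs.
  set N := (relationHom hK.wellFormed v σ).range with hN
  set q := QuotientGroup.mk' N with hq
  set F : K.loopGroup v →* (K.loopGroup v × A) ⧸ N := q.comp (MonoidHom.inl _ _) with hF
  set g : P.Presented →* (K.loopGroup v × A) ⧸ N :=
    (q.comp (MonoidHom.inr _ _)).comp ψ.toMonoidHom with hg
  obtain ⟨h, -, h2⟩ := K.exists_central_hom T P a (fun e => F (ρ.hom (FreeGroup.of e))) g
    (fun e he => by rw [ρ.hom_of e he, map_one]) (by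
      intro j r hj
      rw [lift_hom]
      obtain ⟨x, hx, hr⟩ := ρ.hom_face hK.wellFormed hj
      rw [hr]
      simp only [hF, hg, hq, MonoidHom.comp_apply, QuotientGroup.mk'_apply]
      rw [QuotientGroup.eq]
      -- Membership in `N` is required of `(∂x, 1)⁻¹ (1, σ x) = (∂x⁻¹, σ x)`, which is the pair of
      -- `x⁻¹`.
      refine ⟨(FreeGroup.of x)⁻¹, ?_⟩
      simp [relationHom, cochainHom, hσ, hx]) (by
      intro e x
      simp only [hF, hg, MonoidHom.comp_apply]
      apply Commute.map
      rw [commute_iff_eq]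
      simp)
  rw [injective_iff_map_eq_one]
  intro x hx
  have h3 := h2 x
  rw [hx, map_one] at h3
  -- A coefficient that dies in the model is `σ(y)⁻¹` for some `y` with trivial boundary. Such a `y`
  -- is a sphere, on which the cocycle vanishes; this is the point where `π₂ = 0` enters.
  have h4 : ((1 : K.loopGroup v), ψ x) ∈ N := by
    rw [← QuotientGroup.eq_one_iff]
    exact h3.symm
  obtain ⟨y, hy⟩ := h4
  rw [relationHom, MonoidHom.prod_apply, Prod.mk.injEq] at hy
  have h5 : K.boundaryHom v y = 1 := by
    rw [← hK.wellFormed.coe_boundaryLoop, hy.1, Subgroup.coe_one]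
  have h6 := hc.cochainHom_eq_one (hK.pi2 v hv) h5
  rw [MonoidHom.inv_apply, h6, inv_one] at hy
  exact ψ.injective (by rw [← hy.2, map_one])

/-- The attaching path `r_j` equals the central element `a_j`, so conjugating it by a path has no
effect. -/
theorem edgeHom_boundaryLoop (hK : K.WellFormed)
    (hP : ∀ x y : P.Presented, x * y = y * x)
    (ha : a.length = K.faces.length) (h : FreeGroup (K.BasedFace v)) :
    ∃ x, K.edgeHom T P a (hK.boundaryLoop v h) = K.coeffHom T P a x := by
  induction h using FreeGroup.induction_on with
  | C1 => exact ⟨1, by simp⟩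
  | of x =>
    refine ⟨P.cochain a x.idx, ?_⟩
    have hf := K.edgeHom_face T P a ha (j := x.idx) (f := K.faces[x.idx])
      (List.getElem?_eq_getElem x.idx.2)
    simp only [WellFormed.boundaryLoop, FreeGroup.lift_apply_of, BasedFace.boundary, map_mul,
      map_inv]
    rw [hf]
    have := K.coeffHom_mem_center T P a hP (P.cochain a x.idx)
    rw [Subgroup.mem_center_iff] at this
    rw [this, mul_inv_cancel_right]
  | inv_of x hx =>
    obtain ⟨y, hy⟩ := hx
    exact ⟨y⁻¹, by simp [hy]⟩
  | mul x y hx hy =>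
    obtain ⟨x', hx⟩ := hx
    obtain ⟨y', hy⟩ := hy
    exact ⟨x' * y', by simp [hx, hy]⟩

/-- Central coefficients can be collected on the right of any product. -/
theorem exists_edgeHom_mul_coeffHom (hP : ∀ x y : P.Presented, x * y = y * x)
    (g : (K.centralPresentation T P a).Presented) :
    ∃ w x, g = K.edgeHom T P a w * K.coeffHom T P a x := by
  have hcen := fun x g => Subgroup.mem_center_iff.mp (K.coeffHom_mem_center T P a hP x) g
  have := K.central_closure_eq_top T P a
    { carrier := {g | ∃ w x, g = K.edgeHom T P a w * K.coeffHom T P a x}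
      one_mem' := ⟨1, 1, by simp⟩
      mul_mem' := by
        rintro _ _ ⟨w, x, rfl⟩ ⟨w', x', rfl⟩
        refine ⟨w * w', x * x', ?_⟩
        rw [map_mul, map_mul, mul_assoc, ← mul_assoc (K.coeffHom T P a x), ← hcen x]
        simp only [mul_assoc]
      inv_mem' := by
        rintro _ ⟨w, x, rfl⟩
        refine ⟨w⁻¹, x⁻¹, ?_⟩
        rw [mul_inv_rev, ← map_inv, ← map_inv, ← hcen] }
    (fun e _ => ⟨FreeGroup.of e, 1, by simp⟩) (fun x => ⟨1, x, by simp⟩)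
  exact (this ▸ Subgroup.mem_top g : g ∈ _)

theorem exists_standardExtension (hK : K.IsThreeSkeleton) (hT : K.IsMaximalTree T)
    (hv : v < K.numVertices) (φ : K.Pi1 v ≃* G) (ψ : P.Presented ≃* A)
    (ha : K.CocycleWords P a) :
    ∃ S : GroupExtension A (K.centralPresentation T P a).Presented G,
      S.IsCentral ∧ K.IsStandardExtension T P a φ ψ S := by
  obtain ⟨ρ⟩ := hT.exists_retraction hK.wellFormed hv
  have hP := presented_comm ψ
  set F : K.loopGroup v →* G := φ.toMonoidHom.comp (QuotientGroup.mk' _) with hF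
  have hFb : ∀ h, F (hK.wellFormed.boundaryLoop v h) = 1 := by
    intro h
    have : (hK.wellFormed.boundaryLoop v h) ∈ Subgroup.normalClosure (K.faceLoops v) := by
      rw [← hK.wellFormed.range_boundaryLoop]
      exact ⟨h, rfl⟩
    rw [hF, MonoidHom.comp_apply, QuotientGroup.mk'_apply, (QuotientGroup.eq_one_iff _).mpr this,
      map_one]
  obtain ⟨p, hp1, hp2⟩ := K.exists_central_hom T P a (fun e => F (ρ.hom (FreeGroup.of e))) 1
    (fun e he => by rw [ρ.hom_of e he, map_one]) (by
      intro j r hj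
      rw [lift_hom]
      obtain ⟨x, hx, hr⟩ := ρ.hom_face hK.wellFormed hj
      rw [hr, hFb, MonoidHom.one_apply]) (fun e x => by simp)
  have hp : ∀ γ : K.loopGroup v, p (K.edgeHom T P a γ) = φ (QuotientGroup.mk γ) := by
    intro γ
    rw [hp1, lift_hom, ρ.hom_loop]
    rfl
  refine ⟨⟨(K.coeffHom T P a).comp ψ.symm.toMonoidHom, p, ?_, ?_, ?_⟩, ?_, ⟨?_, hp⟩⟩
  · exact (coeffHom_injective hK ρ hv ψ ha).comp ψ.symm.injective
  · apply le_antisymm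
    · rintro _ ⟨x, rfl⟩
      rw [MonoidHom.mem_ker, MonoidHom.comp_apply, hp2, MonoidHom.one_apply]
    · intro g hg
      -- If `g` dies in `G`, its edge part, moved to a loop at `v`, is a boundary and hence a
      -- coefficient itself.
      obtain ⟨w, x, rfl⟩ := exists_edgeHom_mul_coeffHom hP g
      rw [MonoidHom.mem_ker, map_mul, hp2, MonoidHom.one_apply, mul_one,
        ← edgeHom_hom hK.wellFormed ρ, hp] at hg
      rw [EmbeddingLike.map_eq_one_iff, QuotientGroup.eq_one_iff,
        ← hK.wellFormed.range_boundaryLoop] at hg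
      obtain ⟨h, hh⟩ := hg
      obtain ⟨y, hy⟩ := edgeHom_boundaryLoop (T := T) hK.wellFormed hP ha.length_eq h
      rw [hh, edgeHom_hom hK.wellFormed] at hy
      refine ⟨ψ (y * x), ?_⟩
      rw [hy, ← map_mul]
      simp
  · intro g
    obtain ⟨γ, hγ⟩ := QuotientGroup.mk_surjective (φ.symm g)
    exact ⟨_, (hp γ).trans (by rw [hγ, MulEquiv.apply_symm_apply])⟩
  · rintro _ ⟨x, rfl⟩
    exact K.coeffHom_mem_center T P a hP _
  · intro g
    simp [coeffHom_eval]

namespace IsStandardExtension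

variable {S : GroupExtension A (K.centralPresentation T P a).Presented G}

theorem inl_apply (hS : K.IsStandardExtension T P a φ ψ S) (x : P.Presented) :
    S.inl (ψ x) = K.coeffHom T P a x := by
  obtain ⟨w, rfl⟩ := P.eval_surjective x
  rw [hS.inl_eval, coeffHom_eval]

theorem isCentral (hS : K.IsStandardExtension T P a φ ψ S) : S.IsCentral := by
  rintro _ ⟨x, rfl⟩
  obtain ⟨y, rfl⟩ := ψ.surjective x
  rw [hS.inl_apply]
  exact K.coeffHom_mem_center T P a (presented_comm ψ) y

theorem rightHom_edgeHom (hS : K.IsStandardExtension T P a φ ψ S) (hK : K.WellFormed)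
    (ρ : TreeRetraction K T v) (w : FreeGroup ℕ) :
    S.rightHom (K.edgeHom T P a w) = φ (QuotientGroup.mk (ρ.hom w)) := by
  rw [← edgeHom_hom hK ρ]
  exact hS.rightHom_eval _

/-- A central extension with lifts that satisfy the relations is equivalent to the standard
extension. -/
theorem nonempty_equiv {E : Type*} [Group E] {R : GroupExtension A E G}
    (hS : K.IsStandardExtension T P a φ ψ S) (hR : R.IsCentral) (hT : K.IsMaximalTree T)
    (hK : K.WellFormed) (hv : v < K.numVertices) {τ : ℕ → E} (hτ : K.IsLift T φ R τ)
    (h : ∀ j f, K.faces[j]? = some f →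
      R.inl (ψ (P.cochain a j)) = FreeGroup.lift τ (FreeGroup.mk f.2)) :
    Nonempty (S.Equiv R) := by
  classical
  obtain ⟨ρ⟩ := hT.exists_retraction hK hv
  -- The universal property needs the value `1` on every name outside `S`, while `τ` is unrestricted
  -- on numbers that are not edges. Edge paths contain no such numbers, so nothing changes on them.
  set τ' : ℕ → E := fun e => if e ∈ K.outside T then τ e else 1 with hτ'
  have hw : ∀ w : List (ℕ × Bool), (∀ l ∈ w, l.1 < K.edges.length) →
      FreeGroup.lift τ' (FreeGroup.mk w) = FreeGroup.lift τ (FreeGroup.mk w) := by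
    intro w hw
    rw [FreeGroup.lift_mk, FreeGroup.lift_mk]
    congr 1
    apply List.map_congr_left
    intro l hl
    have : τ' l.1 = τ l.1 := by
      by_cases he : l.1 ∈ K.outside T
      · simp [hτ', he]
      · simp only [hτ', he, if_false]
        rw [hτ.tree]
        simpa [outside, hw l hl] using he
    rw [this]
  have hlt : ∀ u w x, K.IsWalk u w x → ∀ l ∈ w, l.1 < K.edges.length := by
    intro u w x h
    induction h with
    | nil u => simp
    | fwd he _ ih =>
      rw [List.forall_mem_cons]
      exact ⟨(List.getElem?_eq_some_iff.mp he).1, ih⟩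
    | bwd he _ ih =>
      rw [List.forall_mem_cons]
      exact ⟨(List.getElem?_eq_some_iff.mp he).1, ih⟩
  obtain ⟨p, hp1, hp2⟩ := K.exists_central_hom T P a τ' (R.inl.comp ψ.toMonoidHom)
    (fun e he => by simp [hτ', he]) (fun j f hj => by
      rw [hw _ (hlt _ _ _ (hK.faces_closed f (List.mem_of_getElem? hj)).2), ← h j f hj]
      rfl)
    (fun e x => ((Subgroup.mem_center_iff.mp (hR ⟨ψ x, rfl⟩)) _).symm)
  -- A homomorphism that is the identity on `A` and on `G` is an isomorphism (short five lemma).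
  refine ⟨GroupExtension.Equiv.ofMonoidHom p ?_ ?_⟩
  · ext x
    obtain ⟨y, rfl⟩ := ψ.surjective x
    rw [MonoidHom.comp_apply, hS.inl_apply, hp2]
    rfl
  · refine MonoidHom.ext fun g => ?_
    obtain ⟨w, x, rfl⟩ := exists_edgeHom_mul_coeffHom (presented_comm ψ) g
    have h1 : R.rightHom (p (K.coeffHom T P a x)) = 1 := by
      rw [hp2]
      exact R.rightHom_inl _
    rw [MonoidHom.comp_apply, map_mul, map_mul, map_mul, h1, ← hS.inl_apply, S.rightHom_inl,
      hS.rightHom_edgeHom hK ρ, mul_one, mul_one, ← edgeHom_hom hK ρ, hp1]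
    obtain ⟨w', hw', hm⟩ := (ρ.hom w).2
    rw [← hτ.lifts, ← hm, hw w' (hlt _ _ _ hw')]

end IsStandardExtension

end CellComplex3

/-! ### Cohomologous cocycles, lifts, and the classification -/

namespace CellComplex3

variable {K : CellComplex3} {T : List ℕ} {P : FinPresentation ℕ} {v : ℕ} {G A : Type*} [Group G]
  [CommGroup A] {φ : K.Pi1 v ≃* G} {ψ : P.Presented ≃* A} {a b : List (List (ℕ × Bool))}

/-- The lifts of the generators multiplied by coefficients. -/
theorem lift_mul_of_commute {E : Type*} [Group E] (f : ℕ → E) (τ : ℕ → A) (i : A →* E)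
    (hi : i.range ≤ Subgroup.center E) (w : FreeGroup ℕ) :
    FreeGroup.lift (fun e => f e * i (τ e)) w =
      FreeGroup.lift f w * i (FreeGroup.lift τ w) := by
  have hc : ∀ x y, Commute x (i y) := fun x y => Subgroup.mem_center_iff.mp (hi ⟨y, rfl⟩) x
  have : FreeGroup.lift (fun e => f e * i (τ e)) =
      { toFun := fun w => FreeGroup.lift f w * i (FreeGroup.lift τ w)
        map_one' := by simp
        map_mul' := fun x y => by
          simp only [map_mul]
          exact (hc _ _).mul_mul_mul_comm _ _ } := by
    ext x; simp
  rw [this]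
  rfl

theorem Cohomologous.map {A B : Type*} [Group A] [Group B] {σ σ' : ℕ → A}
    (h : K.Cohomologous σ σ') (f : A →* B) :
    K.Cohomologous (fun j => f (σ j)) (fun j => f (σ' j)) := by
  obtain ⟨τ, hτ⟩ := h
  refine ⟨fun e => f (τ e), fun j r hj => ?_⟩
  simp only [hτ j r hj, map_mul]
  congr 1
  have : f.comp (FreeGroup.lift τ) = FreeGroup.lift (fun e => f (τ e)) := by
    ext x; simp
  rw [← this]
  rfl

/-- A cochain on the loops at `v` extends over all edges. -/
theorem TreeRetraction.lift_hom_face (ρ : TreeRetraction K T v) (hK : K.WellFormed) (τ : ℕ → A)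
    {j : ℕ} {f : ℕ × List (ℕ × Bool)} (hj : K.faces[j]? = some f) :
    FreeGroup.lift τ (ρ.hom (FreeGroup.mk f.2) : FreeGroup ℕ) =
      FreeGroup.lift τ (FreeGroup.mk f.2) := by
  have hf := hK.faces_closed f (List.mem_of_getElem? hj)
  rw [ρ.hom_walk _ _ _ hf.1 hf.2, map_mul, map_mul, map_inv, mul_comm, ← mul_assoc,
    inv_mul_cancel, one_mul]

/-- Standard extensions of cohomologous cocycles are equivalent. -/
theorem IsStandardExtension.nonempty_equiv_of_cohomologous (hK : K.WellFormed)
    (hT : K.IsMaximalTree T) (hv : v < K.numVertices)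
    {S : GroupExtension A (K.centralPresentation T P a).Presented G}
    {S' : GroupExtension A (K.centralPresentation T P b).Presented G}
    (hb : b.length = K.faces.length)
    (hS : K.IsStandardExtension T P a φ ψ S) (hS' : K.IsStandardExtension T P b φ ψ S')
    (h : K.Cohomologous (P.cochain a) (P.cochain b)) : Nonempty (S.Equiv S') := by
  obtain ⟨ρ⟩ := hT.exists_retraction hK hv
  obtain ⟨τ, hτ⟩ := h.map ψ.toMonoidHom
  -- The cochain is normalized to vanish on the tree by evaluating it on the retracted loops. Its
  -- coboundary is unchanged, since the inserted tree path cancels in the commutative group `A`.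
  set τ' : ℕ → A := fun e => FreeGroup.lift τ (ρ.hom (FreeGroup.of e) : FreeGroup ℕ) with hτ'
  have h1 : ∀ w, FreeGroup.lift τ' w = FreeGroup.lift τ (ρ.hom w : FreeGroup ℕ) :=
    lift_hom ρ ((FreeGroup.lift τ).comp (K.loopGroup v).subtype)
  have h2 : ∀ w, FreeGroup.lift (fun e => K.edgeHom T P b (FreeGroup.of e)) w =
      K.edgeHom T P b w := by
    intro w
    have : FreeGroup.lift (fun e => K.edgeHom T P b (FreeGroup.of e)) = K.edgeHom T P b := by
      ext x; simp
    rw [this]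
  refine hS.nonempty_equiv (τ := fun e => K.edgeHom T P b (FreeGroup.of e) * S'.inl (τ' e))
    hS'.isCentral hT hK hv ⟨fun t ht => ?_, fun γ => ?_⟩ fun j f hj => ?_
  · have ht' := K.notMem_outside_of_mem T ht
    rw [K.edgeHom_of_eq_one T P b ht', hτ', one_mul]
    simp only
    rw [ρ.hom_of t ht', Subgroup.coe_one, map_one, map_one]
  · rw [lift_mul_of_commute _ _ _ hS'.isCentral, h2, map_mul, S'.rightHom_inl, mul_one]
    exact hS'.rightHom_eval γ
  · rw [lift_mul_of_commute _ _ _ hS'.isCentral, h2, h1, ρ.lift_hom_face hK τ hj,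
      K.edgeHom_face T P b hb hj, ← hS'.inl_apply, ← map_mul]
    exact congrArg _ (hτ j f hj)

/-- If the standard extensions are equivalent, then the cocycles are cohomologous. -/
theorem IsStandardExtension.cohomologous_of_equiv (hK : K.WellFormed)
    (hT : K.IsMaximalTree T) (hv : v < K.numVertices)
    {S : GroupExtension A (K.centralPresentation T P a).Presented G}
    {S' : GroupExtension A (K.centralPresentation T P b).Presented G}
    (ha : a.length = K.faces.length) (hb : b.length = K.faces.length)
    (hS : K.IsStandardExtension T P a φ ψ S) (hS' : K.IsStandardExtension T P b φ ψ S')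
    (h : S.Equiv S') : K.Cohomologous (P.cochain a) (P.cochain b) := by
  obtain ⟨ρ⟩ := hT.exists_retraction hK hv
  -- The two images of an edge lie over the same element of `G`; their differences in `A` form the
  -- required 1-cochain.
  have h1 : ∀ e, ∃ c : A, h (K.edgeHom T P a (FreeGroup.of e)) =
      K.edgeHom T P b (FreeGroup.of e) * S'.inl c := by
    intro e
    have : (K.edgeHom T P b (FreeGroup.of e))⁻¹ * h (K.edgeHom T P a (FreeGroup.of e)) ∈
        S'.inl.range := by
      rw [S'.range_inl_eq_ker_rightHom, MonoidHom.mem_ker, map_mul, map_inv, h.rightHom_map,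
        hS.rightHom_edgeHom hK ρ, hS'.rightHom_edgeHom hK ρ, inv_mul_cancel]
    obtain ⟨c, hc⟩ := this
    exact ⟨c, by rw [hc, mul_inv_cancel_left]⟩
  choose τ hτ using h1
  have h2 : ∀ w, h (K.edgeHom T P a w) =
      K.edgeHom T P b w * S'.inl (FreeGroup.lift τ w) := by
    intro w
    have e1 : (h : _ ≃* _).toMonoidHom.comp (K.edgeHom T P a) =
        FreeGroup.lift (fun e => K.edgeHom T P b (FreeGroup.of e) * S'.inl (τ e)) := by
      ext e
      simpa using hτ e
    have e2 : FreeGroup.lift (fun e => K.edgeHom T P b (FreeGroup.of e)) =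
        K.edgeHom T P b := by
      ext x; simp
    have e3 := lift_mul_of_commute (fun e => K.edgeHom T P b (FreeGroup.of e)) τ S'.inl
      hS'.isCentral w
    rw [e2, ← e1] at e3
    exact e3
  have h3 : K.Cohomologous (fun j => ψ (P.cochain a j)) (fun j => ψ (P.cochain b j)) := by
    refine ⟨τ, fun j f hj => S'.inl_injective ?_⟩
    simp only [map_mul]
    rw [hS'.inl_apply, hS'.inl_apply, ← K.edgeHom_face T P b hb hj, ← h2,
      K.edgeHom_face T P a ha hj, ← hS.inl_apply, h.map_inl, hS'.inl_apply]
  simpa using h3.map ψ.symm.toMonoidHom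

/-- Lifts of the generators exist. -/
theorem exists_isLift (hK : K.WellFormed) (hT : K.IsMaximalTree T) (hv : v < K.numVertices)
    (φ : K.Pi1 v ≃* G) {E : Type*} [Group E] (R : GroupExtension A E G) :
    ∃ τ, K.IsLift T φ R τ := by
  classical
  obtain ⟨ρ⟩ := hT.exists_retraction hK hv
  obtain ⟨s, hs⟩ := R.rightHom_surjective.hasRightInverse
  set F : K.loopGroup v →* G := φ.toMonoidHom.comp (QuotientGroup.mk' _) with hF
  refine ⟨fun e => if e ∈ T then 1 else s (F (ρ.hom (FreeGroup.of e))),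
    fun t ht => if_pos ht, fun γ => ?_⟩
  have : R.rightHom.comp (FreeGroup.lift fun e => if e ∈ T then 1 else
      s (F (ρ.hom (FreeGroup.of e)))) = F.comp ρ.hom := by
    ext e
    by_cases he : e ∈ T
    · simp [he, ρ.hom_of e (K.notMem_outside_of_mem T he)]
    · simp [he, hs _]
  have h2 := DFunLike.congr_fun this (γ : FreeGroup ℕ)
  rw [MonoidHom.comp_apply, MonoidHom.comp_apply, ρ.hom_loop] at h2
  exact h2

/-- The relations, evaluated at lifts of the generators, form a cocycle. -/
theorem IsLift.exists_cocycleWords (hK : K.WellFormed) (hT : K.IsMaximalTree T)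
    (hv : v < K.numVertices) (ψ : P.Presented ≃* A) {E : Type*} [Group E]
    {R : GroupExtension A E G} (hR : R.IsCentral) {τ : ℕ → E} (hτ : K.IsLift T φ R τ) :
    ∃ a, K.CocycleWords P a ∧ ∀ j f, K.faces[j]? = some f →
      R.inl (ψ (P.cochain a j)) = FreeGroup.lift τ (FreeGroup.mk f.2) := by
  obtain ⟨ρ⟩ := hT.exists_retraction hK hv
  have h1 : ∀ f ∈ K.faces, ∃ w : List (ℕ × Bool), (∀ l ∈ w, l.1 ∈ P.gens) ∧
      R.inl (ψ (P.eval (FreeGroup.mk w))) = FreeGroup.lift τ (FreeGroup.mk f.2) := by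
    intro f hf
    obtain ⟨j, hj⟩ := List.mem_iff_getElem?.mp hf
    have hf' := hK.faces_closed f hf
    -- The attaching path starts at its own corner, not at `v`. Since the lifts are `1` on the tree,
    -- it has the value of the based loop, to which the lifting property applies.
    have h2 : FreeGroup.lift τ (FreeGroup.mk f.2) =
        FreeGroup.lift τ (ρ.hom (FreeGroup.mk f.2) : FreeGroup ℕ) := by
      rw [ρ.hom_walk _ _ _ hf'.1 hf'.2, map_mul, map_mul, map_inv, ρ.lift_path hτ.tree hf'.1]
      simp
    have h3 : FreeGroup.lift τ (FreeGroup.mk f.2) ∈ R.inl.range := by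
      rw [R.range_inl_eq_ker_rightHom, MonoidHom.mem_ker, h2, hτ.lifts,
        EmbeddingLike.map_eq_one_iff, QuotientGroup.eq_one_iff, ← hK.range_boundaryLoop]
      obtain ⟨x, -, hx⟩ := ρ.hom_face hK hj
      exact ⟨_, hx.symm⟩
    obtain ⟨c, hc⟩ := h3
    obtain ⟨w, hw, hw'⟩ := P.exists_word (ψ.symm c)
    exact ⟨w, hw, by rw [hw', MulEquiv.apply_symm_apply, hc]⟩
  -- The word is chosen from the face data and not from the index; faces with the same attaching
  -- data get the same word.
  choose! w hw hw' using h1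
  have hval : ∀ j f, K.faces[j]? = some f →
      R.inl (ψ (P.cochain (K.faces.map w) j)) = FreeGroup.lift τ (FreeGroup.mk f.2) := by
    intro j f hj
    rw [← hw' f (List.mem_of_getElem? hj), FinPresentation.cochain, List.getD_eq_getElem?_getD,
      List.getElem?_map, hj]
    rfl
  refine ⟨K.faces.map w, ⟨by simp, ?_, ?_⟩, hval⟩
  · simp only [List.mem_map]
    rintro _ ⟨f, hf, rfl⟩
    exact hw f hf
  · have : K.IsCocycle (fun j => ψ (P.cochain (K.faces.map w) j)) := by
      intro s hs
      apply R.inl_injective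
      -- The freely trivial product of a spherical diagram is evaluated at the lifts. Each factor `q
      -- r_j^{±1} q⁻¹` gives `σ(j)^{±1}` because this value is central.
      rw [map_one, map_list_prod, ← map_one (FreeGroup.lift τ), ← hK.solids_spherical s hs,
        map_list_prod, List.map_map, List.map_map]
      congr 1
      apply List.map_congr_left
      intro y hy
      obtain ⟨f, hf, -⟩ := hK.solids_walk s hs y hy
      have e1 := hval _ f hf
      have hc : ∀ x, Commute x (R.inl (ψ (P.cochain (K.faces.map w) y.2.1))) :=
        fun x => Subgroup.mem_center_iff.mp (hR ⟨_, rfl⟩) x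
      have e2 : (K.faces.getD y.2.1 (0, [])) = f := by
        rw [List.getD_eq_getElem?_getD, hf]; rfl
      simp only [Function.comp_apply, tripleLoop, e2, map_mul, map_inv]
      rcases hy2 : y.2.2 with _ | _
      · simp only [cond_false, map_inv, ← e1, (hc _).inv_right.eq, mul_inv_cancel_right]
      · simp only [cond_true, ← e1, (hc _).eq, mul_inv_cancel_right]
    simpa [IsCocycle] using this.map ψ.symm.toMonoidHom

/-- The classification of central extensions by cellular 2-cocycles. -/
theorem classification (hK : K.IsThreeSkeleton) (hT : K.IsMaximalTree T)
    (hv : v < K.numVertices) (φ : K.Pi1 v ≃* G) (ψ : P.Presented ≃* A) :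
    (∀ a, K.CocycleWords P a →
      ∃ S : GroupExtension A (K.centralPresentation T P a).Presented G,
        S.IsCentral ∧ K.IsStandardExtension T P a φ ψ S) ∧
    (∀ a b, K.CocycleWords P a → K.CocycleWords P b →
      ∀ (S : GroupExtension A (K.centralPresentation T P a).Presented G)
        (S' : GroupExtension A (K.centralPresentation T P b).Presented G),
        K.IsStandardExtension T P a φ ψ S → K.IsStandardExtension T P b φ ψ S' →
        (Nonempty (S.Equiv S') ↔ K.Cohomologous (P.cochain a) (P.cochain b))) ∧
    (∀ (E : Type*) [Group E] (R : GroupExtension A E G), R.IsCentral →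
      (∃ τ, K.IsLift T φ R τ) ∧
      ∀ τ, K.IsLift T φ R τ → ∃ a, K.CocycleWords P a ∧
        (∀ j f, K.faces[j]? = some f →
          R.inl (ψ (P.cochain a j)) = FreeGroup.lift τ (FreeGroup.mk f.2)) ∧
        ∃ S : GroupExtension A (K.centralPresentation T P a).Presented G,
          K.IsStandardExtension T P a φ ψ S ∧ Nonempty (S.Equiv R)) := by
  refine ⟨fun a ha => exists_standardExtension hK hT hv φ ψ ha,
    fun a b ha hb S S' hS hS' => ⟨fun ⟨h⟩ => ?_, fun h => ?_⟩, fun E _ R hR =>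
    ⟨exists_isLift hK.wellFormed hT hv φ R, fun τ hτ => ?_⟩⟩
  · exact hS.cohomologous_of_equiv hK.wellFormed hT hv ha.length_eq hb.length_eq hS' h
  · exact hS.nonempty_equiv_of_cohomologous hK.wellFormed hT hv hb.length_eq hS' h
  · obtain ⟨a, ha, h⟩ := hτ.exists_cocycleWords hK.wellFormed hT hv ψ hR
    obtain ⟨S, -, hS⟩ := exists_standardExtension hK hT hv φ ψ ha
    exact ⟨a, ha, h, S, hS, hS.nonempty_equiv hR hT hK.wellFormed hv hτ h⟩

end CellComplex3

/-! ## Certificates for implications between linear equations over the integers -/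

/-- A homomorphism on a subgroup of a lattice extends to the lattice after multiplication by a
nonzero integer. -/
theorem Submodule.exists_extend_smul {κ M : Type*} [Finite κ] [AddCommGroup M]
    (W : Submodule ℤ (κ → ℤ)) (φ : W →ₗ[ℤ] M) :
    ∃ N : ℤ, N ≠ 0 ∧ ∃ Y : (κ → ℤ) →ₗ[ℤ] M, ∀ w : W, Y w = N • φ w := by
  obtain ⟨n, snf⟩ := W.smithNormalForm (Pi.basisFun ℤ κ)
  have ha : ∀ i, snf.a i ≠ 0 := by
    intro i h
    have h1 := snf.snf i
    rw [h, zero_smul] at h1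
    exact snf.bN.ne_zero i (Subtype.ext h1)
  refine ⟨∏ i, snf.a i, Finset.prod_ne_zero_iff.mpr fun i _ => ha i, ?_⟩
  classical
  -- In Smith normal form the basis of `W` consists of the multiples `a i` of part of a basis of the
  -- lattice. Dividing `∏ a` by `a i` leaves the product of the other factors; the remaining basis
  -- vectors go to `0`.
  set c : κ → M := fun k =>
    if h : ∃ i, snf.f i = k then
      (∏ i ∈ Finset.univ.erase h.choose, snf.a i) • φ (snf.bN h.choose) else 0 with hc
  refine ⟨snf.bM.constr ℤ c, ?_⟩
  have h2 : ∀ i, c (snf.f i) = (∏ i' ∈ Finset.univ.erase i, snf.a i') • φ (snf.bN i) := by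
    intro i
    have h : ∃ i', snf.f i' = snf.f i := ⟨i, rfl⟩
    have h' : h.choose = i := snf.f.injective h.choose_spec
    simp only [hc, h, dif_pos]
    rw [h']
  have h3 : (snf.bM.constr ℤ c).comp W.subtype = (∏ i, snf.a i) • φ := by
    refine snf.bN.ext fun i => ?_
    rw [LinearMap.comp_apply, Submodule.subtype_apply, snf.snf i, map_smul,
      Module.Basis.constr_basis, h2, smul_smul, Finset.mul_prod_erase _ _ (Finset.mem_univ i)]
    rfl
  intro w
  exact DFunLike.congr_fun h3 w

/-- If all solutions of `g x = 0` have `f x` in the image of `h`, then there is a proof of this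
by a linear identity. -/
theorem exists_linear_certificate {ι κ ρ ν : Type*} [Finite ι] [Finite κ]
    (g : (ι → ℤ) →ₗ[ℤ] (κ → ℤ)) (f : (ι → ℤ) →ₗ[ℤ] (ρ → ℤ)) (h : (ν → ℤ) →ₗ[ℤ] (ρ → ℤ))
    (H : ∀ x, g x = 0 → ∃ y, f x = h y) :
    ∃ N : ℤ, N ≠ 0 ∧ ∃ (μ : (ι → ℤ) →ₗ[ℤ] (ν → ℤ)) (Y : (κ → ℤ) →ₗ[ℤ] (ρ → ℤ)),
      ∀ x, N • (f x - h (μ x)) = Y (g x) := by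
  -- The image of `g` is a subgroup of a lattice, hence free, so `g` splits over its image and `π =
  -- 1 - s g` projects onto the kernel.
  obtain ⟨s, hs⟩ := Module.projective_lifting_property g.rangeRestrict LinearMap.id
    g.surjective_rangeRestrict
  have hs' : ∀ w : LinearMap.range g, g (s w) = w := fun w =>
    congrArg Subtype.val (DFunLike.congr_fun hs w)
  set π : (ι → ℤ) →ₗ[ℤ] LinearMap.ker g :=
    (LinearMap.id - s.comp g.rangeRestrict).codRestrict _ (by
      intro x
      rw [LinearMap.mem_ker, LinearMap.sub_apply, map_sub, LinearMap.comp_apply, hs']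
      simp) with hπ
  -- The kernel of `g` is free too, so preimages under `h` can be chosen linearly there.
  obtain ⟨μ, hμ⟩ := Module.projective_lifting_property h.rangeRestrict
    ((f.comp (LinearMap.ker g).subtype).codRestrict (LinearMap.range h) (by
      rintro ⟨x, hx⟩
      obtain ⟨y, hy⟩ := H x hx
      exact ⟨y, hy.symm⟩)) h.surjective_rangeRestrict
  have hμ' : ∀ w : LinearMap.ker g, h (μ w) = f w := fun w =>
    congrArg Subtype.val (DFunLike.congr_fun hμ w)
  -- Since `f x = f (π x) + f (s (g x))`, what remains is `f s` applied to `g x`. It is defined only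
  -- on the image of `g`; the factor `N` is the price of extending it to the whole lattice.
  obtain ⟨N, hN, Y, hY⟩ := (LinearMap.range g).exists_extend_smul (f.comp s)
  refine ⟨N, hN, μ.comp π, Y, fun x => ?_⟩
  have h1 : Y (g x) = N • f (s (g.rangeRestrict x)) := hY (g.rangeRestrict x)
  rw [h1, LinearMap.comp_apply, hμ', ← map_sub]
  congr 2
  simp [hπ]

/-- Indices of the unknowns and the equations: a tag and two numbers. -/
abbrev LinIndex : Type := ℕ × ℕ × ℕ

/-- The indices with a given tag and bounded numbers. -/
def linBlock (tag n k : ℕ) : List LinIndex :=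
  (List.range n).flatMap fun a => (List.range k).map fun b => (tag, a, b)

theorem mem_linBlock {tag n k : ℕ} {c : LinIndex} :
    c ∈ linBlock tag n k ↔ c.1 = tag ∧ c.2.1 < n ∧ c.2.2 < k := by
  obtain ⟨t, a, b⟩ := c
  simp only [linBlock, List.mem_flatMap, List.mem_range, List.mem_map, Prod.mk.injEq]
  constructor
  · rintro ⟨a', ha, b', hb, rfl, rfl, rfl⟩
    exact ⟨rfl, ha, hb⟩
  · rintro ⟨rfl, ha, hb⟩
    exact ⟨a, ha, b, hb, rfl, rfl, rfl⟩

theorem nodup_linBlock (tag n k : ℕ) : (linBlock tag n k).Nodup := by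
  rw [linBlock, List.nodup_flatMap]
  refine ⟨fun a _ => List.Nodup.map (fun b b' h => by simpa using h) List.nodup_range,
    List.nodup_range.imp ?_⟩
  intro a b hab x hx hy
  simp only [List.mem_map] at hx hy
  obtain ⟨_, _, rfl⟩ := hx
  obtain ⟨_, _, h⟩ := hy
  simp only [Prod.mk.injEq] at h
  exact hab h.2.1.symm

theorem sum_linBlock (tag n k : ℕ) (F : LinIndex → ℤ) :
    ((linBlock tag n k).map F).sum =
      ∑ a ∈ Finset.range n, ∑ b ∈ Finset.range k, F (tag, a, b) := by
  have h : ∀ l : List ℕ, ((l.flatMap fun a => (List.range k).map fun b => (tag, a, b)).map F).sum =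
      (l.map fun a => ∑ b ∈ Finset.range k, F (tag, a, b)).sum := by
    intro l
    induction l with
    | nil => rfl
    | cons a l ih =>
      rw [List.flatMap_cons, List.map_append, List.sum_append, ih, List.map_cons, List.sum_cons,
        List.map_map]
      rfl
  exact h (List.range n)

/-- A system of linear equations `g x = 0`, with unknowns `unknowns` and equations `eqs`, and the
conclusion, with rows `rows`, that `f x` is in the image of the matrix `h` with columns `cols`. -/
structure LinSystem where
  unknowns : List LinIndex
  eqs : List LinIndex
  rows : List LinIndex
  cols : List LinIndex
  g : LinIndex → LinIndex → ℤ
  f : LinIndex → LinIndex → ℤ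
  h : LinIndex → LinIndex → ℤ

/-- The value of a table at an argument. -/
def tableAt {α : Type*} [Encodable α] (L : List ℤ) (x : α) : ℤ := L.getD (Encodable.encode x) 0

/-- Finitely many arguments have bounded codes, so a finite list of integers can store the values
needed. This is what makes functions part of a searchable certificate. -/
theorem exists_table {α : Type*} [Encodable α] (F : α → ℤ) (l : List α) :
    ∃ L : List ℤ, ∀ x ∈ l, tableAt L x = F x := by
  obtain ⟨n, hn⟩ : ∃ n, ∀ x ∈ l, Encodable.encode x < n := by
    refine ⟨(l.map Encodable.encode).sum + 1, fun x hx => ?_⟩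
    have := List.single_le_sum (l := l.map Encodable.encode) (by simp) _
      (List.mem_map_of_mem hx)
    omega
  refine ⟨(List.range n).map fun k => ((Encodable.decode k : Option α).map F).getD 0,
    fun x hx => ?_⟩
  simp [tableAt, List.getD_eq_getElem?_getD, hn x hx]

namespace LinSystem

variable (s : LinSystem)

/-- All solutions of the equations satisfy the conclusion. -/
def Holds : Prop :=
  ∀ x : LinIndex → ℤ, (∀ k ∈ s.eqs, (s.unknowns.map fun c => s.g k c * x c).sum = 0) →
    ∃ y : LinIndex → ℤ, ∀ r ∈ s.rows,
      (s.unknowns.map fun c => s.f r c * x c).sum = (s.cols.map fun k => s.h r k * y k).sum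

/-- The certificate `(N, μ, Y)` proves the conclusion by the identity `N (f - h μ) = Y g`. -/
def Check (c : ℤ × List ℤ × List ℤ) : Prop :=
  c.1 ≠ 0 ∧ ∀ r ∈ s.rows, ∀ u ∈ s.unknowns,
    c.1 * (s.f r u - (s.cols.map fun k => s.h r k * tableAt c.2.1 (k, u)).sum) =
      (s.eqs.map fun k => tableAt c.2.2 (r, k) * s.g k u).sum

theorem _root_.List.sum_map_sum_map_comm {α β : Type*} (l : List α) (l' : List β)
    (F : α → β → ℤ) :
    (l.map fun a => (l'.map fun b => F a b).sum).sum =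
      (l'.map fun b => (l.map fun a => F a b).sum).sum := by
  induction l with
  | nil => simp
  | cons a l ih => simp [ih, List.sum_map_add]

/-- Applied to a solution `x`, the identity reads `N (f x - h (μ x)) = Y (g x) = 0`, and the nonzero
integer `N` can be cancelled. -/
theorem Check.holds {s : LinSystem} {c : ℤ × List ℤ × List ℤ} (hc : s.Check c) : s.Holds := by
  obtain ⟨hN, hc⟩ := hc
  intro x hx
  refine ⟨fun k => (s.unknowns.map fun u => tableAt c.2.1 (k, u) * x u).sum, fun r hr => ?_⟩
  have h1 : (s.unknowns.map fun u => c.1 * (s.f r u -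
      (s.cols.map fun k => s.h r k * tableAt c.2.1 (k, u)).sum) * x u).sum = 0 := by
    have : (s.unknowns.map fun u => c.1 * (s.f r u -
        (s.cols.map fun k => s.h r k * tableAt c.2.1 (k, u)).sum) * x u) =
        s.unknowns.map fun u => (s.eqs.map fun k =>
          tableAt c.2.2 (r, k) * (s.g k u * x u)).sum := by
      apply List.map_congr_left
      intro u hu
      rw [hc r hr u hu, ← List.sum_map_mul_right]
      simp only [mul_assoc]
    rw [this, List.sum_map_sum_map_comm]
    apply List.sum_eq_zero
    simp only [List.mem_map]
    rintro _ ⟨k, hk, rfl⟩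
    rw [List.sum_map_mul_left, hx k hk, mul_zero]
  have h2 : (s.cols.map fun k => s.h r k *
      (s.unknowns.map fun u => tableAt c.2.1 (k, u) * x u).sum).sum =
      (s.unknowns.map fun u => (s.cols.map fun k => s.h r k * tableAt c.2.1 (k, u)).sum *
        x u).sum := by
    simp only [← List.sum_map_mul_left, ← List.sum_map_mul_right]
    rw [List.sum_map_sum_map_comm]
    simp only [mul_assoc]
  rw [h2]
  simp only [mul_assoc] at h1
  rw [List.sum_map_mul_left] at h1
  have h3 := (mul_eq_zero.mp h1).resolve_left hN
  have h4 : ∀ (l : List LinIndex) (p q : LinIndex → ℤ),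
      (l.map fun u => (p u - q u) * x u).sum =
        (l.map fun u => p u * x u).sum - (l.map fun u => q u * x u).sum := by
    intro l p q
    induction l with
    | nil => simp
    | cons a l ih =>
      simp only [List.map_cons, List.sum_cons, ih]
      ring
  rw [h4] at h3
  exact sub_eq_zero.mp h3

theorem _root_.List.Nodup.sum_map_eq_sum_subtype {α : Type*} [DecidableEq α] {l : List α}
    (hl : l.Nodup) (F : α → ℤ) : (l.map F).sum = ∑ a : {a // a ∈ l}, F a := by
  rw [← List.sum_toFinset F hl]
  exact Finset.sum_subtype _ (fun x => List.mem_toFinset) F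

/-- Sums over lists without repetition are matrix products over the subtypes of list members. The
linear maps of `exists_linear_certificate` are then read as matrices and stored in tables. -/
theorem Holds.exists_check {s : LinSystem} (h₁ : s.unknowns.Nodup) (h₂ : s.eqs.Nodup)
    (h₃ : s.cols.Nodup) (hs : s.Holds) : ∃ c, s.Check c := by
  classical
  set g : Matrix {k // k ∈ s.eqs} {u // u ∈ s.unknowns} ℤ := Matrix.of fun k u => s.g k u with hg
  set f : Matrix {r // r ∈ s.rows} {u // u ∈ s.unknowns} ℤ := Matrix.of fun r u => s.f r u with hf
  set h : Matrix {r // r ∈ s.rows} {k // k ∈ s.cols} ℤ := Matrix.of fun r k => s.h r k with hh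
  obtain ⟨N, hN, μ, Y, hc⟩ := exists_linear_certificate g.mulVecLin f.mulVecLin h.mulVecLin (by
    intro x hx
    -- A vector on the listed unknowns is extended by zero to all indices.
    obtain ⟨x', hx'⟩ : ∃ x' : LinIndex → ℤ, ∀ u : {u // u ∈ s.unknowns}, x' u = x u :=
      ⟨fun u => if hu : u ∈ s.unknowns then x ⟨u, hu⟩ else 0, fun u => dif_pos u.2⟩
    obtain ⟨y, hy⟩ := hs x' (by
      intro k hk
      rw [h₁.sum_map_eq_sum_subtype]
      simp only [hx']
      exact congrFun hx ⟨k, hk⟩)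
    refine ⟨fun k => y k, ?_⟩
    ext ⟨r, hr⟩
    have := hy r hr
    rw [h₁.sum_map_eq_sum_subtype, h₃.sum_map_eq_sum_subtype] at this
    simp only [hx'] at this
    exact this)
  obtain ⟨M, hM⟩ := exists_table (fun p : LinIndex × LinIndex =>
    if hp : p.1 ∈ s.cols ∧ p.2 ∈ s.unknowns then
      LinearMap.toMatrix' μ ⟨p.1, hp.1⟩ ⟨p.2, hp.2⟩ else 0) (s.cols.product s.unknowns)
  obtain ⟨Z, hZ⟩ := exists_table (fun p : LinIndex × LinIndex =>
    if hp : p.1 ∈ s.rows ∧ p.2 ∈ s.eqs then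
      LinearMap.toMatrix' Y ⟨p.1, hp.1⟩ ⟨p.2, hp.2⟩ else 0) (s.rows.product s.eqs)
  refine ⟨(N, M, Z), hN, fun r hr u hu => ?_⟩
  rw [h₃.sum_map_eq_sum_subtype, h₂.sum_map_eq_sum_subtype]
  have hm : N • (f - h * LinearMap.toMatrix' μ) = LinearMap.toMatrix' Y * g := by
    apply Matrix.toLin'.injective
    refine LinearMap.ext fun x => ?_
    have := hc x
    simpa [Matrix.toLin'_apply, Matrix.sub_mulVec, Matrix.smul_mulVec, ← Matrix.mulVec_mulVec,
      LinearMap.toMatrix'_mulVec] using this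
  have h5 := congrFun (congrFun hm ⟨r, hr⟩) ⟨u, hu⟩
  rw [Matrix.smul_apply, Matrix.sub_apply, Matrix.mul_apply, Matrix.mul_apply, smul_eq_mul] at h5
  have e1 : ∀ k : {k // k ∈ s.cols}, tableAt M (k.1, u) = LinearMap.toMatrix' μ k ⟨u, hu⟩ := by
    intro k
    rw [hM (k.1, u) (List.mem_product.mpr ⟨k.2, hu⟩), dif_pos ⟨k.2, hu⟩]
  have e2 : ∀ k : {k // k ∈ s.eqs}, tableAt Z (r, k.1) = LinearMap.toMatrix' Y ⟨r, hr⟩ k := by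
    intro k
    rw [hZ (r, k.1) (List.mem_product.mpr ⟨hr, k.2⟩), dif_pos ⟨hr, k.2⟩]
  simp only [e1, e2]
  exact h5

end LinSystem

/-! ## Exponent vectors -/

/-- The signed number of occurrences of a letter. -/
def signedCount (x : ℕ) (w : List (ℕ × Bool)) : ℤ :=
  (w.map fun l => if l.1 = x then cond l.2 1 (-1) else 0).sum

/-- In an abelian group, the value of a word is determined by its exponents. -/
theorem FreeGroup.map_mk_eq_sum {B : Type*} [CommGroup B] (h : FreeGroup ℕ →* B) {n : ℕ}
    {w : List (ℕ × Bool)} (hw : ∀ l ∈ w, l.1 < n ∨ h (FreeGroup.of l.1) = 1) :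
    Additive.ofMul (h (FreeGroup.mk w)) =
      ∑ j ∈ Finset.range n, signedCount j w • Additive.ofMul (h (FreeGroup.of j)) := by
  induction w with
  | nil => simp [signedCount, ← FreeGroup.one_eq_mk]
  | cons l w ih =>
    rw [FreeGroup.mk_cons, MonoidHom.map_mul, ofMul_mul,
      ih fun l' hl' => hw l' (List.mem_cons_of_mem _ hl')]
    have h1 : Additive.ofMul (h (FreeGroup.mk [l])) =
        (cond l.2 1 (-1) : ℤ) • Additive.ofMul (h (FreeGroup.of l.1)) := by
      obtain ⟨e, b⟩ := l
      cases b
      · have : FreeGroup.mk [(e, false)] = (FreeGroup.of e)⁻¹ := rfl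
        simp [this]
      · simp [FreeGroup.of]
    have h2 : ∀ j, signedCount j (l :: w) =
        (if l.1 = j then (cond l.2 1 (-1) : ℤ) else 0) + signedCount j w := fun j => by
      simp [signedCount]
    simp only [h2, add_smul, Finset.sum_add_distrib, ite_smul, zero_smul, Finset.sum_ite_eq,
      Finset.mem_range]
    congr 1
    rw [h1]
    rcases hw l (by simp) with h3 | h3
    · rw [if_pos h3]
    · simp [h3]

namespace FinPresentation

variable (P : FinPresentation ℕ)

/-- A bound for the names of the generators. -/
def genBound : ℕ := P.gens.sum + 1

theorem lt_genBound {x : ℕ} (hx : x ∈ P.gens) : x < P.genBound := by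
  have := List.single_le_sum (l := P.gens) (by simp) _ hx
  rw [genBound]
  omega

/-- The relators, together with the names that are not generators. -/
def allRels : List (List (ℕ × Bool)) :=
  P.rels ++ (List.range P.genBound).flatMap fun x => if x ∈ P.gens then [] else [[(x, true)]]

/-- The exponent of the generator `x` in the relator `i`. -/
def relCoeff (x i : ℕ) : ℤ := signedCount x (P.allRels.getD i [])

/-- The vector `c` is a combination of exponent vectors of relators. -/
def InRels (c : ℕ → ℤ) : Prop :=
  ∃ y : ℕ → ℤ, ∀ x < P.genBound, c x = ∑ i ∈ Finset.range P.allRels.length, P.relCoeff x i * y i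

theorem eval_mk_allRels {r : List (ℕ × Bool)} (hr : r ∈ P.allRels) :
    P.eval (FreeGroup.mk r) = 1 := by
  simp only [allRels, List.mem_append, List.mem_flatMap] at hr
  rcases hr with hr | ⟨x, -, hx⟩
  · exact P.eval_mk_eq_one hr
  · split_ifs at hx with h
    · simp at hx
    · rw [List.mem_singleton.mp hx]
      exact P.eval_of_eq_one h

theorem eval_of_eq_one_of_le {x : ℕ} (hx : P.genBound ≤ x) : P.eval (FreeGroup.of x) = 1 :=
  P.eval_of_eq_one fun h => absurd (P.lt_genBound h) (by omega)

variable {P} {A : Type*} [CommGroup A] (ψ : P.Presented ≃* A)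

/-- The element of an abelian group with a given exponent vector. -/
def vecEval : (ℕ → ℤ) →+ Additive A where
  toFun c := ∑ x ∈ Finset.range P.genBound,
    c x • Additive.ofMul (ψ (P.eval (FreeGroup.of x)))
  map_zero' := by simp
  map_add' c c' := by simp [add_smul, Finset.sum_add_distrib]

theorem vecEval_apply (c : ℕ → ℤ) : vecEval ψ c = ∑ x ∈ Finset.range P.genBound,
    c x • Additive.ofMul (ψ (P.eval (FreeGroup.of x))) := rfl

theorem vecEval_congr {c c' : ℕ → ℤ} (h : ∀ x < P.genBound, c x = c' x) :
    vecEval ψ c = vecEval ψ c' := by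
  rw [vecEval_apply, vecEval_apply]
  exact Finset.sum_congr rfl fun x hx => by rw [h x (Finset.mem_range.mp hx)]

theorem ofMul_eval_mk (w : List (ℕ × Bool)) :
    Additive.ofMul (ψ (P.eval (FreeGroup.mk w))) = vecEval ψ fun x => signedCount x w := by
  refine FreeGroup.map_mk_eq_sum (ψ.toMonoidHom.comp P.eval) fun l _ => ?_
  rcases lt_or_ge l.1 P.genBound with h | h
  · exact Or.inl h
  · exact Or.inr (by simp [P.eval_of_eq_one_of_le h])

theorem exists_word_signedCount (c : ℕ → ℤ) (n : ℕ) :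
    ∃ w : List (ℕ × Bool), ∀ x < n, signedCount x w = c x := by
  have hrep : ∀ (x z k : ℕ) (b : Bool), signedCount x (List.replicate k (z, b)) =
      if z = x then (k : ℤ) * (cond b 1 (-1) : ℤ) else 0 := by
    intro x z k b
    simp only [signedCount, List.map_replicate, List.sum_replicate]
    split_ifs <;> simp
  refine ⟨(List.range n).flatMap fun z =>
    List.replicate (c z).natAbs (z, decide (0 ≤ c z)), fun x hx => ?_⟩
  have : ∀ n, signedCount x ((List.range n).flatMap fun z =>
      List.replicate (c z).natAbs (z, decide (0 ≤ c z))) = if x < n then c x else 0 := by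
    intro n
    induction n with
    | zero => simp [signedCount]
    | succ n ih =>
      rw [List.range_succ, List.flatMap_append]
      have happ : ∀ u v, signedCount x (u ++ v) = signedCount x u + signedCount x v := by
        intro u v
        simp [signedCount]
      rw [happ, ih, List.flatMap_singleton, hrep]
      rcases lt_trichotomy x n with h | h | h
      · rw [if_pos h, if_neg (by omega), if_pos (by omega), add_zero]
      · subst h
        rw [if_neg (by omega), if_pos rfl, if_pos (by omega), zero_add]
        by_cases hc : 0 ≤ c x
        · simp [hc, abs_of_nonneg hc]
        · simp [hc, abs_of_neg (not_le.mp hc)]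
      · rw [if_neg (by omega), if_neg (by omega), if_neg (by omega), add_zero]
  rw [this, if_pos hx]

/-- Integer vectors modulo the relations form an abelian group in which all relators hold, so
`P.Presented` maps to it. A vector whose element of `A` is trivial is therefore trivial there. The
other direction only evaluates relators. -/
theorem vecEval_eq_zero_iff (c : ℕ → ℤ) : vecEval ψ c = 0 ↔ P.InRels c := by
  constructor
  · intro hc
    set N : AddSubgroup (ℕ → ℤ) :=
      { carrier := {c | P.InRels c}
        zero_mem' := ⟨0, by simp⟩
        add_mem' := by
          rintro c c' ⟨y, hy⟩ ⟨y', hy'⟩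
          exact ⟨y + y', fun x hx => by
            simp [hy x hx, hy' x hx, mul_add, Finset.sum_add_distrib]⟩
        neg_mem' := by
          rintro c ⟨y, hy⟩
          exact ⟨-y, fun x hx => by simp [hy x hx]⟩ } with hN
    set h : FreeGroup ℕ →* Multiplicative ((ℕ → ℤ) ⧸ N) := FreeGroup.lift fun x =>
      Multiplicative.ofAdd (QuotientAddGroup.mk' N (Pi.single x 1)) with hh
    have hmk : ∀ w, h (FreeGroup.mk w) =
        Multiplicative.ofAdd (QuotientAddGroup.mk' N fun x => signedCount x w) := by
      intro w
      induction w with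
      | nil =>
        rw [← FreeGroup.one_eq_mk, map_one, eq_comm, ofAdd_eq_one]
        exact map_zero _
      | cons l w ih =>
        rw [FreeGroup.mk_cons, map_mul, ih]
        have h1 : h (FreeGroup.mk [l]) = Multiplicative.ofAdd (QuotientAddGroup.mk' N
            fun x => if l.1 = x then (cond l.2 1 (-1) : ℤ) else 0) := by
          obtain ⟨e, b⟩ := l
          cases b
          · have : FreeGroup.mk [(e, false)] = (FreeGroup.of e)⁻¹ := rfl
            rw [this, map_inv, hh, FreeGroup.lift_apply_of, ← ofAdd_neg, ← map_neg]
            congr 2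
            ext x
            by_cases hx : e = x <;> simp [hx, eq_comm]
          · have : FreeGroup.mk [(e, true)] = FreeGroup.of e := rfl
            rw [this, hh, FreeGroup.lift_apply_of]
            congr 2
            ext x
            simp [Pi.single_apply, eq_comm]
        rw [h1, ← ofAdd_add, ← map_add]
        congr 2
    have hrel : ∀ r ∈ P.allRels, h (FreeGroup.mk r) = 1 := by
      intro r hr
      obtain ⟨i, hi, rfl⟩ := List.getElem_of_mem hr
      rw [hmk, ofAdd_eq_one, QuotientAddGroup.mk'_apply, QuotientAddGroup.eq_zero_iff]
      refine ⟨Pi.single i 1, fun x _ => ?_⟩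
      rw [Finset.sum_eq_single i]
      · simp [relCoeff, List.getD_eq_getElem?_getD, hi]
      · intro j _ hj
        simp [hj]
      · simp [hi]
    -- Names that are not generators must go to `1`. Below the bound they are relators in `allRels`;
    -- from the bound on, `InRels` ignores their coordinate.
    obtain ⟨u, hu⟩ := P.exists_hom (fun x => h (FreeGroup.of x)) (by
      intro x hx
      by_cases hxm : x < P.genBound
      · refine hrel [(x, true)] ?_
        simp only [allRels, List.mem_append, List.mem_flatMap, List.mem_range]
        exact Or.inr ⟨x, hxm, by simp [hx]⟩
      · rw [hh, FreeGroup.lift_apply_of, ofAdd_eq_one, QuotientAddGroup.mk'_apply,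
          QuotientAddGroup.eq_zero_iff]
        refine ⟨0, fun z hz => ?_⟩
        have : z ≠ x := by omega
        simp [this]) (by
      intro r hr
      have : (FreeGroup.lift fun x => h (FreeGroup.of x)) = h := by ext x; simp
      rw [this]
      exact hrel r (List.mem_append_left _ hr))
    have hlift : (FreeGroup.lift fun x => h (FreeGroup.of x)) = h := by ext x; simp
    rw [hlift] at hu
    obtain ⟨w, hw⟩ := exists_word_signedCount c P.genBound
    have h2 : P.eval (FreeGroup.mk w) = 1 := by
      apply ψ.injective
      rw [map_one]
      apply Additive.ofMul.injective
      rw [ofMul_eval_mk, vecEval_congr ψ hw, hc]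
      rfl
    have h3 := hu (FreeGroup.mk w)
    rw [h2, map_one, hmk, eq_comm, ofAdd_eq_one, QuotientAddGroup.mk'_apply,
      QuotientAddGroup.eq_zero_iff] at h3
    obtain ⟨y, hy⟩ := h3
    exact ⟨y, fun x hx => by rw [← hy x hx]; exact (hw x hx).symm⟩
  · rintro ⟨y, hy⟩
    have : vecEval ψ c = vecEval ψ
        (∑ i ∈ Finset.range P.allRels.length, y i • fun x => P.relCoeff x i) :=
      vecEval_congr ψ fun x hx => by
        rw [hy x hx, Finset.sum_apply]
        exact Finset.sum_congr rfl fun i _ => by simp [mul_comm]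
    rw [this, map_sum]
    refine Finset.sum_eq_zero fun i hi => ?_
    rw [map_zsmul]
    have h1 := ofMul_eval_mk ψ (P.allRels.getD i [])
    have h2 : P.allRels.getD i [] ∈ P.allRels := by
      rw [List.getD_eq_getElem?_getD, List.getElem?_eq_getElem (Finset.mem_range.mp hi)]
      exact List.getElem_mem _
    rw [P.eval_mk_allRels h2, map_one, ofMul_one] at h1
    have h3 : (vecEval ψ fun x => P.relCoeff x i) = 0 := h1.symm
    rw [h3, smul_zero]

theorem vecEval_surjective : Function.Surjective (vecEval ψ) := by
  intro x
  obtain ⟨y, hy⟩ := ψ.surjective x.toMul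
  obtain ⟨w, -, hw⟩ := P.exists_word y
  refine ⟨fun x => signedCount x w, ?_⟩
  rw [← ofMul_eval_mk, hw, hy]
  rfl

variable (P) in
/-- A word in the generators with a given exponent vector. -/
def wordOf (c : ℕ → ℤ) : List (ℕ × Bool) :=
  (List.range P.genBound).flatMap fun x =>
    if x ∈ P.gens then (List.range (c x).natAbs).map fun _ => (x, decide (0 ≤ c x)) else []

theorem mem_gens_of_mem_wordOf (c : ℕ → ℤ) {l : ℕ × Bool} (hl : l ∈ P.wordOf c) :
    l.1 ∈ P.gens := by
  simp only [wordOf, List.mem_flatMap] at hl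
  obtain ⟨x, -, hx⟩ := hl
  split_ifs at hx with h
  · simp only [List.mem_map] at hx
    obtain ⟨_, _, rfl⟩ := hx
    exact h
  · simp at hx

theorem ofMul_eval_wordOf (c : ℕ → ℤ) :
    Additive.ofMul (ψ (P.eval (FreeGroup.mk (P.wordOf c)))) = vecEval ψ c := by
  have h : ∀ n, Additive.ofMul (ψ (P.eval (FreeGroup.mk ((List.range n).flatMap fun x =>
      if x ∈ P.gens then (List.range (c x).natAbs).map fun _ => (x, decide (0 ≤ c x)) else [])))) =
      ∑ x ∈ Finset.range n, c x • Additive.ofMul (ψ (P.eval (FreeGroup.of x))) := by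
    intro n
    induction n with
    | zero => simp [← FreeGroup.one_eq_mk]
    | succ n ih =>
      rw [List.range_succ, List.flatMap_append, ← FreeGroup.mul_mk, map_mul, map_mul, ofMul_mul, ih,
        Finset.sum_range_succ, List.flatMap_singleton]
      congr 1
      split_ifs with hn
      · rw [List.map_const', List.length_range]
        have h1 : ∀ (k : ℕ) (b : Bool), FreeGroup.mk (List.replicate k (n, b)) =
            FreeGroup.of n ^ ((k : ℤ) * cond b 1 (-1)) := by
          intro k b
          induction k with
          | zero => simp [← FreeGroup.one_eq_mk]
          | succ k ih =>
            rw [List.replicate_succ, FreeGroup.mk_cons, ih]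
            cases b
            · have : FreeGroup.mk [(n, false)] = (FreeGroup.of n)⁻¹ := rfl
              rw [this, ← zpow_neg_one, ← zpow_add]
              congr 1
              simp
            · have : FreeGroup.mk [(n, true)] = FreeGroup.of n := rfl
              rw [this, ← zpow_one_add]
              congr 1
              simp [add_comm]
        rw [h1, map_zpow, map_zpow, ofMul_zpow]
        congr 1
        by_cases hc : 0 ≤ c n
        · simp [hc, abs_of_nonneg hc]
        · simp [hc, abs_of_neg (not_le.mp hc)]
      · rw [P.eval_of_eq_one hn]
        simp [← FreeGroup.one_eq_mk]
  exact h P.genBound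

end FinPresentation

/-! ## Cellular cochains as integer vectors -/

namespace CellComplex3

variable (K : CellComplex3) (P : FinPresentation ℕ)

/-- The coefficient of the 2-cell `j` in the boundary of the 3-cell `s`. -/
def solidCoeff (s j : ℕ) : ℤ := signedCount j ((K.solids.getD s (0, [])).2.map Prod.snd)

/-- The coefficient of the edge `e` in the boundary of the 2-cell `j`. -/
def faceCoeff (j e : ℕ) : ℤ := signedCount e (K.faces.getD j (0, [])).2

/-- The integer cochain represents a cocycle. -/
def VecCocycle (σ : ℕ → ℕ → ℤ) : Prop :=
  ∀ s < K.solids.length,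
    P.InRels fun x => ∑ j ∈ Finset.range K.faces.length, K.solidCoeff s j * σ j x

/-- The integer cochain represents a coboundary. -/
def VecCoboundary (σ : ℕ → ℕ → ℤ) : Prop :=
  ∃ t : ℕ → ℕ → ℤ, ∀ j < K.faces.length,
    P.InRels fun x => σ j x - ∑ e ∈ Finset.range K.edges.length, K.faceCoeff j e * t e x

variable {K P} {A : Type*} [CommGroup A] {ψ : P.Presented ≃* A} {a b : List (List (ℕ × Bool))}
  {σ σ' : ℕ → ℕ → ℤ}

/-- The words represent the integer cochain. -/
def Represents (K : CellComplex3) (ψ : P.Presented ≃* A) (a : List (List (ℕ × Bool)))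
    (σ : ℕ → ℕ → ℤ) : Prop :=
  a.length = K.faces.length ∧ ∀ j < K.faces.length,
    Additive.ofMul (ψ (P.cochain a j)) = FinPresentation.vecEval ψ (σ j)

theorem represents_signedCount (ha : a.length = K.faces.length) :
    K.Represents ψ a fun j x => signedCount x (a.getD j []) :=
  ⟨ha, fun _ _ => FinPresentation.ofMul_eval_mk ψ _⟩

/-- The boundary of a 3-cell, with its paths forgotten, is a word in the names of 2-cells. Its value
in `A` depends only on the exponents `solidCoeff`. -/
theorem Represents.isCocycle_iff (h : K.Represents ψ a σ) :
    K.IsCocycle (P.cochain a) ↔ K.VecCocycle P σ := by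
  have key : ∀ s : ℕ × List (List (ℕ × Bool) × ℕ × Bool),
      Additive.ofMul (ψ (s.2.map fun y =>
        cond y.2.2 (P.cochain a y.2.1) (P.cochain a y.2.1)⁻¹).prod) =
      FinPresentation.vecEval ψ fun x => ∑ j ∈ Finset.range K.faces.length,
        signedCount j (s.2.map Prod.snd) * σ j x := by
    intro s
    have h1 := FreeGroup.map_mk_eq_sum (ψ.toMonoidHom.comp (FreeGroup.lift (P.cochain a)))
      (n := K.faces.length) (w := s.2.map Prod.snd) (by
        intro l _
        rcases lt_or_ge l.1 K.faces.length with h' | h'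
        · exact Or.inl h'
        -- Beyond the last 2-cell, `getD` yields the empty word, so the cochain is trivial there.
        · refine Or.inr ?_
          rw [MonoidHom.comp_apply, FreeGroup.lift_apply_of, FinPresentation.cochain,
            List.getD_eq_getElem?_getD, List.getElem?_eq_none (by rw [h.1]; exact h'),
            Option.getD_none, ← FreeGroup.one_eq_mk, map_one, map_one])
    rw [MonoidHom.comp_apply, FreeGroup.lift_mk, List.map_map] at h1
    refine h1.trans ?_
    have h2 : (fun x => ∑ j ∈ Finset.range K.faces.length,
        signedCount j (s.2.map Prod.snd) * σ j x) = ∑ j ∈ Finset.range K.faces.length,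
        signedCount j (s.2.map Prod.snd) • σ j := by
      ext x
      simp
    rw [h2, map_sum]
    refine Finset.sum_congr rfl fun j hj => ?_
    rw [map_zsmul, ← h.2 j (Finset.mem_range.mp hj), MonoidHom.comp_apply,
      FreeGroup.lift_apply_of]
    rfl
  have key' : ∀ s : ℕ × List (List (ℕ × Bool) × ℕ × Bool),
      (s.2.map fun y => cond y.2.2 (P.cochain a y.2.1) (P.cochain a y.2.1)⁻¹).prod = 1 ↔
      P.InRels fun x => ∑ j ∈ Finset.range K.faces.length,
        signedCount j (s.2.map Prod.snd) * σ j x := by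
    intro s
    rw [← FinPresentation.vecEval_eq_zero_iff ψ, ← key, ofMul_eq_zero,
      EmbeddingLike.map_eq_one_iff]
  constructor
  · intro hc s hs
    have := (key' _).mp (hc _ (List.getElem_mem hs))
    simpa [solidCoeff, List.getD_eq_getElem?_getD, hs] using this
  · intro hc s hs
    obtain ⟨i, hi, rfl⟩ := List.getElem_of_mem hs
    rw [key']
    simpa [solidCoeff, List.getD_eq_getElem?_getD, hi] using hc i hi

theorem IsWalk.lt_length {u v : ℕ} {w : List (ℕ × Bool)} (h : K.IsWalk u w v) :
    ∀ l ∈ w, l.1 < K.edges.length := by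
  induction h with
  | nil u => simp
  | fwd he _ ih =>
    rw [List.forall_mem_cons]
    exact ⟨(List.getElem?_eq_some_iff.mp he).1, ih⟩
  | bwd he _ ih =>
    rw [List.forall_mem_cons]
    exact ⟨(List.getElem?_eq_some_iff.mp he).1, ih⟩

/-- A 1-cochain with values in `A` and one with values in integer vectors determine the same
coboundary as soon as the second represents the first. Every `A`-valued one is represented, by
`vecEval_surjective`. -/
theorem Represents.cohomologous_iff (hK : K.WellFormed) (ha : K.Represents ψ a σ)
    (hb : K.Represents ψ b σ') :
    K.Cohomologous (P.cochain a) (P.cochain b) ↔ K.VecCoboundary P (σ - σ') := by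
  have key : ∀ (τ : ℕ → P.Presented) (t : ℕ → ℕ → ℤ),
      (∀ e, FinPresentation.vecEval ψ (t e) = Additive.ofMul (ψ (τ e))) →
      ∀ j (hj : j < K.faces.length), (P.cochain a j = P.cochain b j *
        FreeGroup.lift τ (FreeGroup.mk K.faces[j].2) ↔
        P.InRels fun x => (σ - σ') j x -
          ∑ e ∈ Finset.range K.edges.length, K.faceCoeff j e * t e x) := by
    intro τ t ht j hj
    have hf := (hK.faces_closed _ (List.getElem_mem hj)).2
    have h1 := FreeGroup.map_mk_eq_sum (ψ.toMonoidHom.comp (FreeGroup.lift τ))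
      (n := K.edges.length) (w := K.faces[j].2) (fun l hl => Or.inl (hf.lt_length l hl))
    have h2 : (fun x => (σ - σ') j x - ∑ e ∈ Finset.range K.edges.length,
        K.faceCoeff j e * t e x) = σ j - (σ' j + ∑ e ∈ Finset.range K.edges.length,
        K.faceCoeff j e • t e) := by
      ext x
      simp [sub_sub]
    have h3 : FinPresentation.vecEval ψ (∑ e ∈ Finset.range K.edges.length,
        K.faceCoeff j e • t e) = Additive.ofMul
          (ψ (FreeGroup.lift τ (FreeGroup.mk K.faces[j].2))) := by
      refine Eq.trans ?_ h1.symm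
      rw [map_sum]
      refine Finset.sum_congr rfl fun e _ => ?_
      rw [map_zsmul, ht, MonoidHom.comp_apply, FreeGroup.lift_apply_of, faceCoeff,
        List.getD_eq_getElem?_getD, List.getElem?_eq_getElem hj]
      rfl
    rw [h2, ← FinPresentation.vecEval_eq_zero_iff ψ, map_sub, map_add, h3, ← ha.2 j hj,
      ← hb.2 j hj, sub_eq_zero, ← ofMul_mul, ← map_mul]
    rw [Additive.ofMul.injective.eq_iff, ψ.injective.eq_iff]
  constructor
  · rintro ⟨τ, hτ⟩
    choose t ht using fun e => FinPresentation.vecEval_surjective ψ (Additive.ofMul (ψ (τ e)))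
    exact ⟨t, fun j hj => (key τ t ht j hj).mp (hτ j _ (List.getElem?_eq_getElem hj))⟩
  · rintro ⟨t, ht⟩
    refine ⟨fun e => ψ.symm (FinPresentation.vecEval ψ (t e)).toMul, fun j f hj => ?_⟩
    obtain ⟨hj', rfl⟩ := List.getElem?_eq_some_iff.mp hj
    exact (key _ t (fun e => by simp) j hj').mpr (ht j hj')

/-- Words for an integer cochain. -/
def cochainWords (K : CellComplex3) (P : FinPresentation ℕ) (σ : ℕ → ℕ → ℤ) :
    List (List (ℕ × Bool)) :=
  (List.range K.faces.length).map fun j => P.wordOf (σ j)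

theorem represents_cochainWords (ψ : P.Presented ≃* A) (σ : ℕ → ℕ → ℤ) :
    K.Represents ψ (K.cochainWords P σ) σ := by
  refine ⟨by simp [cochainWords], fun j hj => ?_⟩
  rw [← FinPresentation.ofMul_eval_wordOf]
  simp [FinPresentation.cochain, cochainWords, List.getD_eq_getElem?_getD, hj]

theorem cocycleWords_cochainWords (ψ : P.Presented ≃* A) (hσ : K.VecCocycle P σ) :
    K.CocycleWords P (K.cochainWords P σ) where
  length_eq := (represents_cochainWords ψ σ).1
  letters w hw l hl := by
    simp only [cochainWords, List.mem_map] at hw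
    obtain ⟨j, -, rfl⟩ := hw
    exact FinPresentation.mem_gens_of_mem_wordOf _ hl
  cocycle := (represents_cochainWords ψ σ).isCocycle_iff.mpr hσ

end CellComplex3

/-! ### The groups of integer cocycles and coboundaries -/

namespace FinPresentation

variable {P : FinPresentation ℕ}

theorem InRels.zero : P.InRels 0 := ⟨0, by simp⟩

theorem InRels.add {c c' : ℕ → ℤ} (h : P.InRels c) (h' : P.InRels c') :
    P.InRels (c + c') := by
  obtain ⟨y, hy⟩ := h
  obtain ⟨y', hy'⟩ := h'
  exact ⟨y + y', fun x hx => by simp [hy x hx, hy' x hx, mul_add, Finset.sum_add_distrib]⟩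

theorem InRels.neg {c : ℕ → ℤ} (h : P.InRels c) : P.InRels (-c) := by
  obtain ⟨y, hy⟩ := h
  exact ⟨-y, fun x hx => by simp [hy x hx]⟩

end FinPresentation

namespace CellComplex3

variable (K : CellComplex3) (P : FinPresentation ℕ)

/-- The integer cochains that represent cocycles. -/
def vecCocycles : AddSubgroup (ℕ → ℕ → ℤ) where
  carrier := {σ | K.VecCocycle P σ}
  zero_mem' := fun s _ => by
    simpa using! FinPresentation.InRels.zero
  add_mem' := fun {σ σ'} h h' s hs => by
    have := (h s hs).add (h' s hs)
    convert this using 1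
    ext x
    simp [mul_add, Finset.sum_add_distrib]
  neg_mem' := fun {σ} h s hs => by
    have := (h s hs).neg
    convert this using 1
    ext x
    simp

/-- The integer cochains that represent coboundaries. -/
def vecCoboundaries : AddSubgroup (ℕ → ℕ → ℤ) where
  carrier := {σ | K.VecCoboundary P σ}
  zero_mem' := ⟨0, fun s _ => by simpa using! FinPresentation.InRels.zero⟩
  add_mem' := by
    rintro σ σ' ⟨t, h⟩ ⟨t', h'⟩
    refine ⟨t + t', fun j hj => ?_⟩
    have := (h j hj).add (h' j hj)
    convert this using 1
    ext x
    simp only [Pi.add_apply, mul_add, Finset.sum_add_distrib]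
    ring
  neg_mem' := by
    rintro σ ⟨t, h⟩
    refine ⟨-t, fun j hj => ?_⟩
    have := (h j hj).neg
    convert this using 1
    ext x
    simp only [Pi.neg_apply, mul_neg, Finset.sum_neg_distrib]
    ring

end CellComplex3

/-! ## Independent generators of the second cohomology -/

/-- A finitely generated abelian group is a direct sum of cyclic groups, and we can arrange that
the first summand is infinite if there is an infinite summand. -/
theorem AddCommGroup.exists_cyclic_generators (H : Type*) [AddCommGroup H] [AddGroup.FG H] :
    ∃ (d : List ℕ) (z : ℕ → H),
      (∀ i < d.length, ((d.getD i 0 : ℕ) : ℤ) • z i = 0) ∧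
      (∀ h, ∃ n : ℕ → ℤ, h = ∑ i ∈ Finset.range d.length, n i • z i) ∧
      (∀ n : ℕ → ℤ, ∑ i ∈ Finset.range d.length, n i • z i = 0 →
        ∀ i < d.length, ((d.getD i 0 : ℕ) : ℤ) ∣ n i) ∧
      ((∀ x ∈ d, x ≠ 0) ∨ d.head? = some 0) := by
  classical
  obtain ⟨n, ι, _, q, hq, ⟨E⟩⟩ : ∃ (n : ℕ) (ι : Type) (_ : Fintype ι) (q : ι → ℕ)
      (_ : ∀ i, q i ≠ 0), Nonempty (H ≃+ (Fin n → ℤ) × ∀ i, ZMod (q i)) := by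
    obtain ⟨n, ι, _, p, hp, e, ⟨E⟩⟩ := AddCommGroup.equiv_free_prod_directSum_zmod H
    exact ⟨n, ι, inferInstance, fun i => p i ^ e i, fun i => pow_ne_zero _ (hp i).ne_zero,
      ⟨E.trans (AddEquiv.prodCongr (Finsupp.linearEquivFunOnFinite ℤ ℤ (Fin n)).toAddEquiv
        (DirectSum.addEquivProd _))⟩⟩
  set c := Fintype.card ι with hc
  set ε : Fin c ≃ ι := (Fintype.equivFin ι).symm with hε
  -- The free summands, with order `0`, are placed before the finite ones; the enumeration later
  -- relies on this order.
  set d : Fin (n + c) → ℕ := Fin.append (fun _ => 0) (fun i => q (ε i)) with hd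
  set z : Fin (n + c) → H := Fin.append
    (fun k => E.symm (Pi.single k 1, 0))
    (fun i => E.symm (0, Pi.single (ε i) 1)) with hz
  have hsum : ∀ m : Fin (n + c) → ℤ, E (∑ i, m i • z i) =
      (∑ k, m (Fin.castAdd c k) • Pi.single k 1,
        ∑ i, m (Fin.natAdd n i) • Pi.single (ε i) 1) := by
    intro m
    rw [Fin.sum_univ_add, map_add, map_sum, map_sum]
    simp only [hz, Fin.append_left, Fin.append_right, map_zsmul, AddEquiv.apply_symm_apply]
    ext1
    · simp [Prod.fst_sum]
    · simp [Prod.snd_sum]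
  have hfst : ∀ (m : Fin n → ℤ) (k : Fin n),
      (∑ k, m k • (Pi.single k 1 : Fin n → ℤ)) k = m k := by
    intro m k
    rw [Finset.sum_apply, Finset.sum_eq_single k] <;> simp +contextual [eq_comm]
  have hsnd : ∀ (m : Fin c → ℤ) (i : Fin c),
      (∑ i, m i • (Pi.single (ε i) 1 : ∀ i, ZMod (q i))) (ε i) = m i := by
    intro m i
    rw [Finset.sum_apply, Finset.sum_eq_single i]
    · simp
    · intro j _ hj
      rw [Pi.smul_apply, Pi.single_eq_of_ne (fun h => hj (ε.injective h.symm)), smul_zero]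
    · simp
  have h1 : ∀ i, (d i : ℤ) • z i = 0 := by
    intro i
    refine Fin.addCases (fun k => ?_) (fun i => ?_) i
    · simp [hd]
    · simp only [hd, hz, Fin.append_right]
      rw [← map_zsmul, map_eq_zero_iff _ E.symm.injective, Prod.smul_mk, smul_zero,
        ← Pi.single_smul]
      simp
  have h2 : ∀ h, ∃ m : Fin (n + c) → ℤ, h = ∑ i, m i • z i := by
    intro h
    obtain ⟨y, rfl⟩ := E.symm.surjective h
    refine ⟨Fin.append (fun k => y.1 k) (fun i => ((y.2 (ε i)).cast : ℤ)), ?_⟩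
    rw [E.symm_apply_eq, hsum]
    simp only [Fin.append_left, Fin.append_right]
    refine Prod.ext (funext fun k => (hfst _ k).symm) (funext fun i => ?_)
    obtain ⟨i, rfl⟩ := ε.surjective i
    exact ((hsnd (fun i => ((y.2 (ε i)).cast : ℤ)) i).trans (by simp)).symm
  have h3 : ∀ m : Fin (n + c) → ℤ, ∑ i, m i • z i = 0 → ∀ i, (d i : ℤ) ∣ m i := by
    intro m hm
    have h := hsum m
    rw [hm, map_zero, eq_comm, Prod.mk_eq_zero] at h
    intro i
    refine Fin.addCases (fun k => ?_) (fun i => ?_) i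
    · have := hfst (fun k => m (Fin.castAdd c k)) k
      rw [h.1, Pi.zero_apply] at this
      simp [hd, ← this]
    · have := hsnd (fun i => m (Fin.natAdd n i)) i
      rw [h.2, Pi.zero_apply, eq_comm, ZMod.intCast_zmod_eq_zero_iff_dvd] at this
      simpa [hd] using this
  have hrange : ∀ (m : ℕ → ℤ), ∑ i ∈ Finset.range (n + c),
      m i • (if hi : i < n + c then z ⟨i, hi⟩ else 0) = ∑ i : Fin (n + c), m i • z i := by
    intro m
    rw [Finset.sum_range]
    exact Finset.sum_congr rfl fun i _ => by simp
  have hget : ∀ i (hi : i < n + c), (List.ofFn d).getD i 0 = d ⟨i, hi⟩ := by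
    intro i hi
    simp [List.getD_eq_getElem?_getD, hi]
  refine ⟨List.ofFn d, fun i => if hi : i < n + c then z ⟨i, hi⟩ else 0, ?_, ?_, ?_, ?_⟩
  · intro i hi
    rw [List.length_ofFn] at hi
    simp only [hget i hi, dif_pos hi, h1]
  · intro h
    obtain ⟨m, hm⟩ := h2 h
    refine ⟨fun i => if hi : i < n + c then m ⟨i, hi⟩ else 0, ?_⟩
    rw [List.length_ofFn, hrange, hm]
    simp
  · intro m hm i hi
    rw [List.length_ofFn] at hi hm
    rw [hrange] at hm
    rw [hget i hi]
    exact h3 _ hm ⟨i, hi⟩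
  -- `n` is the free rank. In rank zero all orders are nonzero; otherwise the list begins with a
  -- free summand.
  · rcases n with _ | n
    · left
      intro x hx
      rw [List.mem_ofFn] at hx
      obtain ⟨i, rfl⟩ := hx
      refine Fin.addCases (fun k => k.elim0) (fun i => ?_) i
      simp only [hd, Fin.append_right]
      exact hq _
    · right
      rw [List.head?_eq_getElem?, List.getElem?_ofFn, dif_pos (by omega)]
      have h4 : (⟨0, by omega⟩ : Fin (n + 1 + c)) = Fin.castAdd c 0 := rfl
      rw [h4, hd, Fin.append_left]

namespace CellComplex3

variable (K : CellComplex3) (P : FinPresentation ℕ)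

/-- The cochains `z i` represent independent generators, of orders `d i`, of the second
cohomology. -/
structure IsCohomologyBasis (d : List ℕ) (z : ℕ → ℕ → ℕ → ℤ) : Prop where
  cocycle : ∀ i < d.length, z i ∈ K.vecCocycles P
  order : ∀ i < d.length, ((d.getD i 0 : ℕ) : ℤ) • z i ∈ K.vecCoboundaries P
  span : ∀ σ ∈ K.vecCocycles P, ∃ n : ℕ → ℤ,
    σ - ∑ i ∈ Finset.range d.length, n i • z i ∈ K.vecCoboundaries P
  indep : ∀ n : ℕ → ℤ, ∑ i ∈ Finset.range d.length, n i • z i ∈ K.vecCoboundaries P →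
    ∀ i < d.length, ((d.getD i 0 : ℕ) : ℤ) ∣ n i

/-- The cocycles modulo the coboundaries. -/
abbrev VecCohomology : Type :=
  K.vecCocycles P ⧸ (K.vecCoboundaries P).addSubgroupOf (K.vecCocycles P)

variable {K P}

theorem _root_.FinPresentation.InRels.congr {P : FinPresentation ℕ} {c c' : ℕ → ℤ} (h : P.InRels c)
    (hc : ∀ x < P.genBound, c' x = c x) : P.InRels c' := by
  obtain ⟨y, hy⟩ := h
  exact ⟨y, fun x hx => by rw [hc x hx, hy x hx]⟩

/-- Cochains are functions on all pairs of numbers, but only the entries of existing 2-cells and of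
names below the bound matter: a cochain that vanishes there is a coboundary. The cohomology is thus
a quotient of a subgroup of a finite-rank lattice. -/
instance : AddGroup.FG (K.VecCohomology P) := by
  set V := Fin K.faces.length → Fin P.genBound → ℤ
  set ext : V →+ (ℕ → ℕ → ℤ) :=
    { toFun := fun s j x => if h : j < K.faces.length ∧ x < P.genBound then
        s ⟨j, h.1⟩ ⟨x, h.2⟩ else 0
      map_zero' := by
        ext j x
        exact dite_eq_right_iff.mpr fun _ => rfl
      map_add' := by
        intro s s'
        ext j x
        by_cases h : j < K.faces.length ∧ x < P.genBound
        · simp only [h, and_self, dite_true, Pi.add_apply]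
          rfl
        · simp [h] } with hext
  set W : AddSubgroup V := (K.vecCocycles P).comap ext
  have hW : AddGroup.FG W := by
    have : Module.Finite ℤ (AddSubgroup.toIntSubmodule W) := inferInstance
    exact Module.Finite.iff_addGroup_fg.mp this
  set q : W →+ K.VecCohomology P := (QuotientAddGroup.mk' _).comp
    ((ext.comp W.subtype).codRestrict (K.vecCocycles P) (fun w => w.2)) with hq
  refine AddGroup.fg_of_surjective (f := q) ?_
  intro h
  obtain ⟨⟨σ, hσ⟩, rfl⟩ := QuotientAddGroup.mk_surjective h
  set s : V := fun j x => σ j x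
  have hs : ∀ j < K.faces.length, ∀ x < P.genBound, ext s j x = σ j x := by
    intro j hj x hx
    simp [hext, hj, hx, s]
  have hsW : s ∈ W := by
    intro k hk
    refine FinPresentation.InRels.congr (hσ k hk) fun x hx => ?_
    exact Finset.sum_congr rfl fun j hj => by rw [hs j (Finset.mem_range.mp hj) x hx]
  refine ⟨⟨s, hsW⟩, ?_⟩
  rw [hq, AddMonoidHom.comp_apply, QuotientAddGroup.mk'_apply, QuotientAddGroup.eq]
  rw [AddSubgroup.mem_addSubgroupOf]
  refine ⟨0, fun j hj => ?_⟩
  refine FinPresentation.InRels.zero.congr fun x hx => ?_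
  have h1 : (((ext.comp W.subtype).codRestrict (K.vecCocycles P) (fun w => w.2)) ⟨s, hsW⟩ :
      ℕ → ℕ → ℤ) j x = σ j x := hs j hj x hx
  simp [h1]

/-- The structure theorem provides only the existence of a basis; the algorithm will find one by
searching. -/
theorem exists_isCohomologyBasis (K : CellComplex3) (P : FinPresentation ℕ) :
    ∃ d z, K.IsCohomologyBasis P d z ∧ ((∀ x ∈ d, x ≠ 0) ∨ d.head? = some 0) := by
  obtain ⟨d, y, h1, h2, h3, h4⟩ := AddCommGroup.exists_cyclic_generators (K.VecCohomology P)
  choose z hz using fun i => QuotientAddGroup.mk_surjective (y i)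
  have key : ∀ w : K.vecCocycles P, (QuotientAddGroup.mk w : K.VecCohomology P) = 0 ↔
      (w : ℕ → ℕ → ℤ) ∈ K.vecCoboundaries P := fun w => by
    rw [QuotientAddGroup.eq_zero_iff, AddSubgroup.mem_addSubgroupOf]
  have hsum : ∀ n : ℕ → ℤ, (QuotientAddGroup.mk (∑ i ∈ Finset.range d.length, n i • z i) :
      K.VecCohomology P) = ∑ i ∈ Finset.range d.length, n i • y i := by
    intro n
    rw [← QuotientAddGroup.mk'_apply, map_sum]
    exact Finset.sum_congr rfl fun i _ => by rw [map_zsmul, QuotientAddGroup.mk'_apply, hz]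
  have hcoe : ∀ n : ℕ → ℤ, ((∑ i ∈ Finset.range d.length, n i • z i : K.vecCocycles P) :
      ℕ → ℕ → ℤ) = ∑ i ∈ Finset.range d.length, n i • (z i : ℕ → ℕ → ℤ) := by
    intro n
    simp
  refine ⟨d, fun i => z i, ⟨fun i _ => (z i).2, fun i hi => ?_, fun σ hσ => ?_, fun n hn => ?_⟩, h4⟩
  · have := (key (((d.getD i 0 : ℕ) : ℤ) • z i)).mp (by
      rw [← QuotientAddGroup.mk'_apply, map_zsmul, QuotientAddGroup.mk'_apply, hz, h1 i hi])
    simpa using this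
  · obtain ⟨n, hn⟩ := h2 (QuotientAddGroup.mk ⟨σ, hσ⟩)
    refine ⟨n, ?_⟩
    have := (key (⟨σ, hσ⟩ - ∑ i ∈ Finset.range d.length, n i • z i)).mp (by
      rw [QuotientAddGroup.mk_sub, hsum, hn, sub_self])
    rwa [AddSubgroup.coe_sub, hcoe] at this
  · apply h3
    rw [← hsum, key, hcoe]
    exact hn

end CellComplex3

/-! ## The linear systems that characterize a basis of the second cohomology -/

namespace CellComplex3

variable (K : CellComplex3) (P : FinPresentation ℕ) (d : List ℕ) (z : ℕ → ℕ → ℕ → ℤ)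

/-- The matrix of the relations of the coefficients, in all cells. -/
def _root_.FinPresentation.relMatrix (r c : LinIndex) : ℤ :=
  if c.2.1 = r.2.1 then P.relCoeff r.2.2 c.2.2 else 0

/-- The matrix with columns the given cochains, the relations of the coefficients, and the
coboundaries. -/
def genMatrix (r c : LinIndex) : ℤ :=
  if c.1 = 0 then z c.2.1 r.2.1 r.2.2 else
  if c.1 = 1 then P.relMatrix r c else
  if c.2.2 = r.2.2 then K.faceCoeff r.2.1 c.2.1 else 0

/-- The columns of `genMatrix` that give coboundaries. -/
def coboundaryCols : List LinIndex :=
  linBlock 1 K.faces.length P.allRels.length ++ linBlock 2 K.edges.length P.genBound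

/-- The system which says that the given cochains are cocycles. -/
def cocycleSystem : LinSystem where
  unknowns := linBlock 0 d.length 1
  eqs := []
  rows := linBlock 0 K.solids.length P.genBound
  cols := linBlock 0 K.solids.length P.allRels.length
  g _ _ := 0
  f r c := ((List.range K.faces.length).map fun j =>
    K.solidCoeff r.2.1 j * z c.2.1 j r.2.2).sum
  h := P.relMatrix

/-- The system which says that the given multiples of the given cochains are coboundaries. -/
def orderSystem : LinSystem where
  unknowns := linBlock 0 d.length 1
  eqs := []
  rows := linBlock 0 K.faces.length P.genBound
  cols := K.coboundaryCols P
  g _ _ := 0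
  f r c := (d.getD c.2.1 0 : ℕ) * z c.2.1 r.2.1 r.2.2
  h := K.genMatrix P z

/-- The system which says that the given cochains generate the cohomology. -/
def spanSystem : LinSystem where
  unknowns := linBlock 0 K.faces.length P.genBound ++
    linBlock 1 K.solids.length P.allRels.length
  eqs := linBlock 0 K.solids.length P.genBound
  rows := linBlock 0 K.faces.length P.genBound
  cols := linBlock 0 d.length 1 ++ K.coboundaryCols P
  g r c := if c.1 = 0 then (if c.2.2 = r.2.2 then K.solidCoeff r.2.1 c.2.1 else 0) else
    -1 * P.relMatrix r c
  f r c := if c = r then 1 else 0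
  h := K.genMatrix P z

/-- The system which says that the given cochains are independent in the cohomology. -/
def indepSystem : LinSystem where
  unknowns := linBlock 0 d.length 1 ++ K.coboundaryCols P
  eqs := linBlock 0 K.faces.length P.genBound
  rows := linBlock 0 d.length 1
  cols := linBlock 0 d.length 1
  g := K.genMatrix P z
  f r c := if c = r then 1 else 0
  h r c := if c = r then (d.getD r.2.1 0 : ℕ) else 0

/-- The relation matrix is block diagonal, with one copy of the relations of `A` for each cell, and
it ignores the tags of the indices. -/
theorem sum_relMatrix {n i : ℕ} (hi : i < n) (x : ℕ) (y : LinIndex → ℤ) (t s : ℕ) :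
    ((linBlock t n P.allRels.length).map fun k => P.relMatrix (s, i, x) k * y k).sum =
      ∑ b ∈ Finset.range P.allRels.length, P.relCoeff x b * y (t, i, b) := by
  rw [sum_linBlock, Finset.sum_eq_single i]
  · exact Finset.sum_congr rfl fun b _ => by simp [FinPresentation.relMatrix]
  · intro a _ ha
    exact Finset.sum_eq_zero fun b _ => by simp [FinPresentation.relMatrix, ha]
  · intro h
    exact absurd (Finset.mem_range.mpr hi) h

theorem sum_coboundaryCols {j x : ℕ} (hj : j < K.faces.length) (hx : x < P.genBound)
    (y : LinIndex → ℤ) (s : ℕ) :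
    ((K.coboundaryCols P).map fun k => K.genMatrix P z (s, j, x) k * y k).sum =
      ∑ b ∈ Finset.range P.allRels.length, P.relCoeff x b * y (1, j, b) +
      ∑ e ∈ Finset.range K.edges.length, K.faceCoeff j e * y (2, e, x) := by
  rw [coboundaryCols, List.map_append, List.sum_append]
  congr 1
  · rw [← sum_relMatrix P hj x y 1 s, sum_linBlock, sum_linBlock]
    simp [genMatrix]
  · rw [sum_linBlock]
    refine Finset.sum_congr rfl fun e _ => ?_
    rw [Finset.sum_eq_single x]
    · simp [genMatrix]
    · intro b _ hb
      simp [genMatrix, hb]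
    · intro h
      exact absurd (Finset.mem_range.mpr hx) h

theorem sum_genMatrix_zero (j x : ℕ) (y : LinIndex → ℤ) (s : ℕ) :
    ((linBlock 0 d.length 1).map fun k => K.genMatrix P z (s, j, x) k * y k).sum =
      (∑ i ∈ Finset.range d.length, y (0, i, 0) • z i) j x := by
  rw [sum_linBlock, Finset.sum_apply, Finset.sum_apply]
  refine Finset.sum_congr rfl fun i _ => ?_
  simp [genMatrix, mul_comm]

variable {K P d z}

/-- A single vector `y` holds both witnesses: the multiples of relators under tag `1` and the
1-cochain under tag `2`. -/
theorem vecCoboundary_iff (σ : ℕ → ℕ → ℤ) : σ ∈ K.vecCoboundaries P ↔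
    ∃ y : LinIndex → ℤ, ∀ r ∈ linBlock 0 K.faces.length P.genBound,
      σ r.2.1 r.2.2 = ((K.coboundaryCols P).map fun k => K.genMatrix P z r k * y k).sum := by
  constructor
  · rintro ⟨t, ht⟩
    choose! y hy using ht
    refine ⟨fun c => if c.1 = 1 then y c.2.1 c.2.2 else t c.2.1 c.2.2, ?_⟩
    rintro ⟨s, j, x⟩ hr
    obtain ⟨-, hj, hx⟩ := mem_linBlock.mp hr
    rw [sum_coboundaryCols K P z hj hx]
    have := hy j hj x hx
    simpa [sub_eq_iff_eq_add] using this
  · rintro ⟨y, hy⟩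
    refine ⟨fun e x => y (2, e, x), fun j hj => ⟨fun i => y (1, j, i), fun x hx => ?_⟩⟩
    have := hy (0, j, x) (mem_linBlock.mpr ⟨rfl, hj, hx⟩)
    rw [sum_coboundaryCols K P z hj hx] at this
    rw [sub_eq_iff_eq_add]
    exact this

/-- The tag `t` of the witnesses is left free: `cocycleSystem` uses `0`, while in `spanSystem` the
tag `0` is taken by the cochain itself and the witnesses have tag `1`. -/
theorem vecCocycle_iff (σ : ℕ → ℕ → ℤ) (t : ℕ) : σ ∈ K.vecCocycles P ↔
    ∃ y : LinIndex → ℤ, ∀ r ∈ linBlock 0 K.solids.length P.genBound,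
      ∑ j ∈ Finset.range K.faces.length, K.solidCoeff r.2.1 j * σ j r.2.2 =
        ((linBlock t K.solids.length P.allRels.length).map fun k =>
          P.relMatrix r k * y k).sum := by
  constructor
  · intro h
    choose! y hy using h
    refine ⟨fun c => y c.2.1 c.2.2, ?_⟩
    rintro ⟨u, s, x⟩ hr
    obtain ⟨-, hs, hx⟩ := mem_linBlock.mp hr
    rw [sum_relMatrix P hs]
    exact hy s hs x hx
  · rintro ⟨y, hy⟩ s hs
    refine ⟨fun i => y (t, s, i), fun x hx => ?_⟩
    have := hy (0, s, x) (mem_linBlock.mpr ⟨rfl, hs, hx⟩)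
    rw [sum_relMatrix P hs] at this
    exact this

/-- A condition on each `z i` becomes a condition linear in arbitrary coefficients, that is, a
`LinSystem` without equations. -/
theorem forall_mem_iff_forall_sum_mem {V : Type*} [AddCommGroup V] (H : AddSubgroup V) (n : ℕ)
    (u : ℕ → V) :
    (∀ i < n, u i ∈ H) ↔ ∀ m : ℕ → ℤ, ∑ i ∈ Finset.range n, m i • u i ∈ H := by
  constructor
  · intro h m
    exact sum_mem fun i hi => H.zsmul_mem (h i (Finset.mem_range.mp hi)) _
  · intro h i hi
    have := h (Pi.single i 1)
    rw [Finset.sum_eq_single i] at this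
    · simpa using this
    · intro j _ hj
      simp [hj]
    · simp [hi]

theorem cocycleSystem_holds_iff : (K.cocycleSystem P d z).Holds ↔
    ∀ i < d.length, z i ∈ K.vecCocycles P := by
  rw [forall_mem_iff_forall_sum_mem]
  have key : ∀ (x : LinIndex → ℤ) (r : LinIndex),
      (((K.cocycleSystem P d z).unknowns).map fun c =>
        (K.cocycleSystem P d z).f r c * x c).sum =
      ∑ j ∈ Finset.range K.faces.length, K.solidCoeff r.2.1 j *
        (∑ i ∈ Finset.range d.length, x (0, i, 0) • z i) j r.2.2 := by
    intro x r
    have hl : ∀ F : ℕ → ℤ, ((List.range K.faces.length).map F).sum =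
      ∑ j ∈ Finset.range K.faces.length, F j := fun F => rfl
    simp only [cocycleSystem, sum_linBlock, Finset.sum_range_one, hl, Finset.sum_apply,
      Finset.sum_mul, Finset.mul_sum]
    rw [Finset.sum_comm]
    refine Finset.sum_congr rfl fun j _ => Finset.sum_congr rfl fun i _ => ?_
    simp only [Pi.smul_apply, smul_eq_mul]
    ring
  constructor
  · intro h m
    rw [vecCocycle_iff _ 0]
    obtain ⟨y, hy⟩ := h (fun c => m c.2.1) (by simp [cocycleSystem])
    exact ⟨y, fun r hr => (key (fun c => m c.2.1) r).symm.trans (hy r hr)⟩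
  · intro h x _
    obtain ⟨y, hy⟩ := (vecCocycle_iff _ 0).mp (h fun i => x (0, i, 0))
    exact ⟨y, fun r hr => by rw [key, hy r hr]; rfl⟩

theorem orderSystem_holds_iff : (K.orderSystem P d z).Holds ↔
    ∀ i < d.length, ((d.getD i 0 : ℕ) : ℤ) • z i ∈ K.vecCoboundaries P := by
  rw [forall_mem_iff_forall_sum_mem]
  have key : ∀ (x : LinIndex → ℤ) (r : LinIndex),
      (((K.orderSystem P d z).unknowns).map fun c =>
        (K.orderSystem P d z).f r c * x c).sum =
      (∑ i ∈ Finset.range d.length, x (0, i, 0) • ((d.getD i 0 : ℕ) : ℤ) • z i) r.2.1 r.2.2 := by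
    intro x r
    simp only [orderSystem, sum_linBlock, Finset.sum_range_one, Finset.sum_apply]
    refine Finset.sum_congr rfl fun i _ => ?_
    simp only [Pi.smul_apply, smul_eq_mul]
    ring
  constructor
  · intro h m
    rw [vecCoboundary_iff (z := z)]
    obtain ⟨y, hy⟩ := h (fun c => m c.2.1) (by simp [orderSystem])
    exact ⟨y, fun r hr => by rw [← key (fun c => m c.2.1), hy r hr]; rfl⟩
  · intro h x _
    obtain ⟨y, hy⟩ := (vecCoboundary_iff (z := z) _).mp (h fun i => x (0, i, 0))
    exact ⟨y, fun r hr => by rw [key, hy r hr]; rfl⟩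

theorem sum_ite_eq_linBlock {l : List LinIndex} (hl : l.Nodup) {r : LinIndex} (hr : r ∈ l)
    (x : LinIndex → ℤ) (u : ℤ) :
    (l.map fun c => (if c = r then u else 0) * x c).sum = u * x r := by
  classical
  rw [← List.sum_toFinset _ hl, Finset.sum_eq_single r]
  · simp
  · intro b _ hb
    simp [hb]
  · intro h
    exact absurd (List.mem_toFinset.mpr hr) h

theorem sum_ite_eq_zero_linBlock {l : List LinIndex} {r : LinIndex} (hr : r ∉ l)
    (x : LinIndex → ℤ) (u : ℤ) :
    (l.map fun c => (if c = r then u else 0) * x c).sum = 0 := by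
  apply List.sum_eq_zero
  simp only [List.mem_map]
  rintro _ ⟨c, hc, rfl⟩
  rw [if_neg (fun h => hr (by rw [← h]; exact hc)), zero_mul]

theorem spanSystem_holds_iff : (K.spanSystem P d z).Holds ↔
    ∀ σ ∈ K.vecCocycles P, ∃ n : ℕ → ℤ,
      σ - ∑ i ∈ Finset.range d.length, n i • z i ∈ K.vecCoboundaries P := by
  have hf : ∀ (x : LinIndex → ℤ), ∀ r ∈ (K.spanSystem P d z).rows,
      ((K.spanSystem P d z).unknowns.map fun c => (K.spanSystem P d z).f r c * x c).sum =
        x (0, r.2.1, r.2.2) := by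
    rintro x ⟨u, j, i⟩ hr
    obtain ⟨h0, -, -⟩ := mem_linBlock.mp hr
    simp only at h0
    subst h0
    simp only [spanSystem]
    rw [List.map_append, List.sum_append, sum_ite_eq_linBlock (nodup_linBlock _ _ _) hr,
      sum_ite_eq_zero_linBlock, one_mul, add_zero]
    rw [mem_linBlock]
    simp
  have hg : ∀ (x : LinIndex → ℤ), ∀ r ∈ (K.spanSystem P d z).eqs,
      (((K.spanSystem P d z).unknowns.map fun c => (K.spanSystem P d z).g r c * x c).sum = 0 ↔
      ∑ j ∈ Finset.range K.faces.length, K.solidCoeff r.2.1 j * x (0, j, r.2.2) =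
        ((linBlock 1 K.solids.length P.allRels.length).map fun k =>
          P.relMatrix r k * x k).sum) := by
    rintro x r hr
    obtain ⟨h0, -, hx⟩ := mem_linBlock.mp hr
    simp only [spanSystem]
    rw [List.map_append, List.sum_append, sum_linBlock, sum_linBlock, sum_linBlock]
    simp [← sub_eq_add_neg, sub_eq_zero, show r.2.2 < P.genBound from hx]
  have hh : ∀ (y : LinIndex → ℤ), ∀ r ∈ (K.spanSystem P d z).rows,
      ((K.spanSystem P d z).cols.map fun k => (K.spanSystem P d z).h r k * y k).sum =
      (∑ i ∈ Finset.range d.length, y (0, i, 0) • z i) r.2.1 r.2.2 +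
        ((K.coboundaryCols P).map fun k => K.genMatrix P z r k * y k).sum := by
    rintro y ⟨u, j, i⟩ hr
    simp only [spanSystem]
    rw [List.map_append, List.sum_append, sum_genMatrix_zero]
  constructor
  · intro h σ hσ
    obtain ⟨y, hy⟩ := (vecCocycle_iff σ 1).mp hσ
    -- The vector of unknowns glues the cochain, under tag `0`, to the witnesses that it is a
    -- cocycle, under tag `1`.
    obtain ⟨n, hn⟩ := h (fun c => if c.1 = 0 then σ c.2.1 c.2.2 else y c) (by
      intro r hr
      rw [hg _ r hr]
      refine (Eq.trans ?_ (hy r hr)).trans ?_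
      · simp
      · rw [sum_linBlock, sum_linBlock]
        simp)
    refine ⟨fun i => n (0, i, 0), (vecCoboundary_iff (z := z) _).mpr ⟨n, fun r hr => ?_⟩⟩
    have := hn r hr
    rw [hf _ r hr, hh _ r hr] at this
    simp only [if_true] at this
    rw [Pi.sub_apply, Pi.sub_apply, this]
    ring
  · intro h x hx
    obtain ⟨n, hn⟩ := h (fun j i => x (0, j, i)) ((vecCocycle_iff _ 1).mpr
      ⟨x, fun r hr => (hg x r hr).mp (hx r hr)⟩)
    obtain ⟨y, hy⟩ := (vecCoboundary_iff (z := z) _).mp hn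
    refine ⟨fun c => if c.1 = 0 then n c.2.1 else y c, fun r hr => ?_⟩
    rw [hf _ r hr, hh _ r hr]
    have h1 := hy r hr
    rw [Pi.sub_apply, Pi.sub_apply] at h1
    have h2 : ((K.coboundaryCols P).map fun k => K.genMatrix P z r k *
        (if k.1 = 0 then n k.2.1 else y k)).sum =
        ((K.coboundaryCols P).map fun k => K.genMatrix P z r k * y k).sum := by
      congr 1
      apply List.map_congr_left
      intro k hk
      rw [if_neg]
      rw [coboundaryCols, List.mem_append, mem_linBlock, mem_linBlock] at hk
      omega
    simp only at h2 ⊢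
    rw [h2, ← h1]
    simp

theorem indepSystem_holds_iff : (K.indepSystem P d z).Holds ↔
    ∀ n : ℕ → ℤ, ∑ i ∈ Finset.range d.length, n i • z i ∈ K.vecCoboundaries P →
      ∀ i < d.length, ((d.getD i 0 : ℕ) : ℤ) ∣ n i := by
  have hcols : ∀ k ∈ K.coboundaryCols P, k.1 ≠ 0 := by
    intro k hk
    rw [coboundaryCols, List.mem_append, mem_linBlock, mem_linBlock] at hk
    omega
  have hf : ∀ (x : LinIndex → ℤ), ∀ r ∈ (K.indepSystem P d z).rows,
      ((K.indepSystem P d z).unknowns.map fun c => (K.indepSystem P d z).f r c * x c).sum =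
        x r := by
    rintro x r hr
    simp only [indepSystem]
    rw [List.map_append, List.sum_append, sum_ite_eq_linBlock (nodup_linBlock _ _ _) hr,
      sum_ite_eq_zero_linBlock, one_mul, add_zero]
    exact fun h => hcols _ h (mem_linBlock.mp hr).1
  have hh : ∀ (x : LinIndex → ℤ), ∀ r ∈ (K.indepSystem P d z).rows,
      ((K.indepSystem P d z).cols.map fun c => (K.indepSystem P d z).h r c * x c).sum =
        (d.getD r.2.1 0 : ℕ) * x r := by
    rintro x r hr
    exact sum_ite_eq_linBlock (nodup_linBlock _ _ _) hr _ _
  have hg : ∀ (x : LinIndex → ℤ), ∀ r ∈ (K.indepSystem P d z).eqs,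
      ((K.indepSystem P d z).unknowns.map fun k => (K.indepSystem P d z).g r k * x k).sum =
      (∑ i ∈ Finset.range d.length, x (0, i, 0) • z i) r.2.1 r.2.2 +
        ((K.coboundaryCols P).map fun k => K.genMatrix P z r k * x k).sum := by
    rintro y ⟨u, j, i⟩ hr
    simp only [indepSystem]
    rw [List.map_append, List.sum_append, sum_genMatrix_zero]
  have hneg : ∀ (x : LinIndex → ℤ) (r : LinIndex),
      ((K.coboundaryCols P).map fun k => K.genMatrix P z r k * -x k).sum =
        -((K.coboundaryCols P).map fun k => K.genMatrix P z r k * x k).sum := by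
    intro x r
    induction K.coboundaryCols P with
    | nil => simp
    | cons k l ih =>
      simp only [List.map_cons, List.sum_cons, ih]
      ring
  constructor
  · intro h n hn i hi
    obtain ⟨y, hy⟩ := (vecCoboundary_iff (z := z) _).mp hn
    -- The system says that combination plus coboundary is zero, whereas the hypothesis equates the
    -- two; hence the sign of `y`.
    obtain ⟨t, ht⟩ := h (fun c => if c.1 = 0 then n c.2.1 else -y c) (by
      intro r hr
      rw [hg _ r hr]
      have h2 : ((K.coboundaryCols P).map fun k => K.genMatrix P z r k *
          (if k.1 = 0 then n k.2.1 else -y k)).sum =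
          ((K.coboundaryCols P).map fun k => K.genMatrix P z r k * -y k).sum := by
        congr 1
        apply List.map_congr_left
        intro k hk
        rw [if_neg (hcols k hk)]
      simp only at h2 ⊢
      rw [h2, hneg, ← hy r hr]
      simp)
    have hr : (0, i, 0) ∈ linBlock 0 d.length 1 := mem_linBlock.mpr ⟨rfl, hi, zero_lt_one⟩
    have := ht _ hr
    rw [hf _ _ hr, hh _ _ hr] at this
    exact ⟨_, this⟩
  · intro h x hx
    have h1 := h (fun i => x (0, i, 0)) ((vecCoboundary_iff (z := z) _).mpr
      ⟨fun k => -x k, fun r hr => by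
        have := hx r hr
        rw [hg _ r hr] at this
        rw [hneg]
        linarith⟩)
    choose! t ht using h1
    refine ⟨fun c => t c.2.1, ?_⟩
    rintro ⟨u, i, o⟩ hr
    rw [hf _ _ hr, hh _ _ hr]
    obtain ⟨h0, hi, ho⟩ := mem_linBlock.mp hr
    simp only at h0 hi ho
    obtain rfl : o = 0 := by omega
    subst h0
    exact ht i hi

/-- A basis of the cohomology can be certified. -/
theorem isCohomologyBasis_iff : K.IsCohomologyBasis P d z ↔
    (∃ c, (K.cocycleSystem P d z).Check c) ∧ (∃ c, (K.orderSystem P d z).Check c) ∧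
    (∃ c, (K.spanSystem P d z).Check c) ∧ ∃ c, (K.indepSystem P d z).Check c := by
  have hb : (K.coboundaryCols P).Nodup := by
    refine List.Nodup.append (nodup_linBlock _ _ _) (nodup_linBlock _ _ _) ?_
    intro x hx hy
    rw [mem_linBlock] at hx hy
    omega
  have hb' : (linBlock 0 d.length 1 ++ K.coboundaryCols P).Nodup := by
    refine List.Nodup.append (nodup_linBlock _ _ _) hb ?_
    intro x hx hy
    rw [coboundaryCols, List.mem_append, mem_linBlock, mem_linBlock] at hy
    rw [mem_linBlock] at hx
    omega
  have hs : (K.spanSystem P d z).unknowns.Nodup := by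
    refine List.Nodup.append (nodup_linBlock _ _ _) (nodup_linBlock _ _ _) ?_
    intro x hx hy
    rw [mem_linBlock] at hx hy
    omega
  constructor
  · rintro ⟨h1, h2, h3, h4⟩
    exact ⟨(cocycleSystem_holds_iff.mpr h1).exists_check (nodup_linBlock _ _ _) List.nodup_nil
        (nodup_linBlock _ _ _),
      (orderSystem_holds_iff.mpr h2).exists_check (nodup_linBlock _ _ _) List.nodup_nil hb,
      (spanSystem_holds_iff.mpr h3).exists_check hs (nodup_linBlock _ _ _) hb',
      (indepSystem_holds_iff.mpr h4).exists_check hb' (nodup_linBlock _ _ _)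
        (nodup_linBlock _ _ _)⟩
  · rintro ⟨⟨_, h1⟩, ⟨_, h2⟩, ⟨_, h3⟩, ⟨_, h4⟩⟩
    exact ⟨cocycleSystem_holds_iff.mp h1.holds, orderSystem_holds_iff.mp h2.holds,
      spanSystem_holds_iff.mp h3.holds, indepSystem_holds_iff.mp h4.holds⟩

end CellComplex3

/-! ## Enumeration of the coefficient vectors -/

/-- Splits off a digit for the modulus `k`, where the modulus `0` stands for all integers. -/
def digitStep (k : ℕ) (s : ℕ × List ℤ) : ℕ × List ℤ :=
  if k = 0 then (s.1.unpair.2, Denumerable.ofNat ℤ s.1.unpair.1 :: s.2)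
  else (s.1 / k, ((s.1 % k : ℕ) : ℤ) :: s.2)

/-- The digits of a number for a list of moduli, together with the rest. -/
def radixDigits (d : List ℕ) (n : ℕ) : ℕ × List ℤ := d.foldr digitStep (n, [])

/-- Digits that are reduced with respect to a list of moduli. -/
def IsReducedDigits (d : List ℕ) (v : List ℤ) : Prop :=
  List.Forall₂ (fun (k : ℕ) (x : ℤ) => k ≠ 0 → 0 ≤ x ∧ x < k) d v

/-- The `n`-th reduced list of digits. If there is an infinite modulus, then the first one has to
be infinite. -/
def unrank (d : List ℕ) (n : ℕ) : Option (List ℤ) :=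
  if d.head? = some 0 then
    some (Denumerable.ofNat ℤ (radixDigits d.tail n).1 :: (radixDigits d.tail n).2)
  else if (radixDigits d n).1 = 0 then some (radixDigits d n).2 else none

theorem radixDigits_cons (k : ℕ) (d : List ℕ) (n : ℕ) :
    radixDigits (k :: d) n = digitStep k (radixDigits d n) := rfl

theorem isReducedDigits_radixDigits (d : List ℕ) (n : ℕ) : IsReducedDigits d (radixDigits d n).2 := by
  induction d with
  | nil => exact List.Forall₂.nil
  | cons k d ih =>
    rw [radixDigits_cons, digitStep]
    split_ifs with h
    · exact List.Forall₂.cons (fun h' => absurd h h') ih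
    · exact List.Forall₂.cons (fun _ => ⟨by positivity,
        by exact_mod_cast Nat.mod_lt _ (Nat.pos_of_ne_zero h)⟩) ih

/-- No step loses information: a number is recovered from its unpaired components, or from quotient
and remainder. -/
theorem radixDigits_injective (d : List ℕ) : Function.Injective (radixDigits d) := by
  induction d with
  | nil =>
    intro n n' h
    exact congrArg Prod.fst h
  | cons k d ih =>
    intro n n' h
    apply ih
    rw [radixDigits_cons, radixDigits_cons, digitStep, digitStep] at h
    split_ifs at h with hk
    · rw [Prod.mk.injEq, List.cons.injEq] at h
      obtain ⟨h1, h2, h3⟩ := h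
      have h2 := congrArg Encodable.encode h2
      rw [Denumerable.encode_ofNat, Denumerable.encode_ofNat] at h2
      refine Prod.ext ?_ h3
      rw [← Nat.pair_unpair (radixDigits d n).1, ← Nat.pair_unpair (radixDigits d n').1, h1, h2]
    · rw [Prod.mk.injEq, List.cons.injEq] at h
      obtain ⟨h1, h2, h3⟩ := h
      refine Prod.ext ?_ h3
      rw [← Nat.div_add_mod (radixDigits d n).1 k, ← Nat.div_add_mod (radixDigits d n').1 k, h1,
        Int.natCast_inj.mp h2]

/-- The induction needs an arbitrary rest `r`, because the digit of the head is split off last, from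
the rest that the tail leaves over. -/
theorem exists_radixDigits_eq {d : List ℕ} {v : List ℤ} (h : IsReducedDigits d v) (r : ℕ) :
    ∃ n, radixDigits d n = (r, v) := by
  induction h generalizing r with
  | nil => exact ⟨r, rfl⟩
  | @cons k x d v hx _ ih =>
    by_cases hk : k = 0
    · obtain ⟨n, hn⟩ := ih (Nat.pair (Encodable.encode x) r)
      exact ⟨n, by rw [radixDigits_cons, hn, digitStep, if_pos hk, Nat.unpair_pair,
        Denumerable.ofNat_encode]⟩
    · obtain ⟨h0, hlt⟩ := hx hk
      obtain ⟨y, rfl⟩ := Int.eq_ofNat_of_zero_le h0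
      have hy : y < k := by exact_mod_cast hlt
      obtain ⟨n, hn⟩ := ih (k * r + y)
      refine ⟨n, ?_⟩
      rw [radixDigits_cons, hn, digitStep, if_neg hk, Nat.mul_add_mod, Nat.mod_eq_of_lt hy,
        Nat.mul_add_div (Nat.pos_of_ne_zero hk), Nat.div_eq_of_lt hy, add_zero]

/-- With finite moduli only, the rest is an iterated quotient of `n`. Once it is nonzero it stays
nonzero, so the list ends for good. -/
theorem radixDigits_fst_mono {d : List ℕ} (h : ∀ k ∈ d, k ≠ 0) {n n' : ℕ} (hn : n ≤ n') :
    (radixDigits d n).1 ≤ (radixDigits d n').1 := by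
  induction d with
  | nil => exact hn
  | cons k d ih =>
    rw [radixDigits_cons, radixDigits_cons, digitStep, digitStep, if_neg (h k (by simp)),
      if_neg (h k (by simp))]
    exact Nat.div_le_div_right (ih fun k hk => h k (by simp [hk]))

theorem isReducedDigits_of_unrank {d : List ℕ} {n : ℕ} {v : List ℤ} (h : unrank d n = some v) :
    IsReducedDigits d v := by
  rw [unrank] at h
  split_ifs at h with h1 h2
  · obtain ⟨d', rfl⟩ : ∃ d', d = 0 :: d' := by
      cases d with
      | nil => simp at h1
      | cons k d' => exact ⟨d', by simpa using h1⟩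
    rw [Option.some.injEq] at h
    subst h
    exact List.Forall₂.cons (fun h => absurd rfl h) (isReducedDigits_radixDigits _ _)
  · rw [Option.some.injEq] at h
    subst h
    exact isReducedDigits_radixDigits _ _

theorem unrank_injective {d : List ℕ} {n n' : ℕ} {v : List ℤ} (h : unrank d n = some v)
    (h' : unrank d n' = some v) : n = n' := by
  rw [← h'] at h
  simp only [unrank] at h h'
  split_ifs at h h' with h1 h2 h3
  · rw [Option.some.injEq, List.cons.injEq] at h
    have h4 := congrArg Encodable.encode h.1
    rw [Denumerable.encode_ofNat, Denumerable.encode_ofNat] at h4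
    exact radixDigits_injective _ (Prod.ext h4 h.2)
  · rw [Option.some.injEq] at h
    exact radixDigits_injective _ (Prod.ext (h2.trans h3.symm) h)

theorem exists_unrank_eq {d : List ℕ} {v : List ℤ} (h : IsReducedDigits d v) :
    ∃ n, unrank d n = some v := by
  by_cases h1 : d.head? = some 0
  -- An infinite first modulus absorbs the rest: its digit is decoded from the rest, so no number is
  -- wasted and the list never ends.
  · cases h with
    | nil => simp at h1
    | @cons k x d v hx hv =>
      obtain ⟨n, hn⟩ := exists_radixDigits_eq hv (Encodable.encode x)
      exact ⟨n, by rw [unrank, if_pos h1, List.tail_cons, hn, Denumerable.ofNat_encode]⟩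
  · obtain ⟨n, hn⟩ := exists_radixDigits_eq h 0
    exact ⟨n, by simp [unrank, h1, hn]⟩

theorem unrank_succ_eq_none {d : List ℕ} (hd : (∀ k ∈ d, k ≠ 0) ∨ d.head? = some 0) {n : ℕ}
    (h : unrank d n = none) : unrank d (n + 1) = none := by
  rw [unrank] at h ⊢
  split_ifs at h with h1 h2
  have : (radixDigits d n).1 ≤ (radixDigits d (n + 1)).1 :=
    radixDigits_fst_mono (hd.resolve_right h1) (Nat.le_succ n)
  rw [if_neg h1, if_neg (by omega)]

/-! ## The list of cocycles -/

namespace CellComplex3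

variable {K : CellComplex3} {P : FinPresentation ℕ} {d : List ℕ} {z : ℕ → ℕ → ℕ → ℤ}

/-- The combination of cochains with given coefficients. -/
def combination (r : ℕ) (z : ℕ → ℕ → ℕ → ℤ) (v : List ℤ) (j x : ℕ) : ℤ :=
  ((List.range r).map fun i => v.getD i 0 * z i j x).sum

theorem combination_eq (r : ℕ) (z : ℕ → ℕ → ℕ → ℤ) (v : List ℤ) :
    combination r z v = ∑ i ∈ Finset.range r, v.getD i 0 • z i := by
  ext j x
  rw [Finset.sum_apply, Finset.sum_apply]
  rfl

/-- The `n`-th cocycle in the list of representatives of the cohomology classes. -/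
def cocycleList (K : CellComplex3) (P : FinPresentation ℕ) (d : List ℕ) (z : ℕ → ℕ → ℕ → ℤ)
    (n : ℕ) : Option (List (List (ℕ × Bool))) :=
  (unrank d n).map fun v => K.cochainWords P (combination d.length z v)

theorem _root_.IsReducedDigits.getD {d : List ℕ} {v : List ℤ} (h : IsReducedDigits d v)
    {i : ℕ} (hi : i < d.length)
    (h0 : d.getD i 0 ≠ 0) : 0 ≤ v.getD i 0 ∧ v.getD i 0 < (d.getD i 0 : ℕ) := by
  have hi' : i < v.length := by rwa [← List.Forall₂.length_eq h]
  have := (List.forall₂_iff_get.mp h).2 i hi hi'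
  simp only [List.getD_eq_getElem?_getD, List.getElem?_eq_getElem hi,
    List.getElem?_eq_getElem hi', Option.getD_some] at h0 ⊢
  exact this h0

namespace IsCohomologyBasis

variable {A : Type*} [CommGroup A] (ψ : P.Presented ≃* A)

theorem cocycleWords (h : K.IsCohomologyBasis P d z) (ψ : P.Presented ≃* A) (v : List ℤ) :
    K.CocycleWords P (K.cochainWords P (combination d.length z v)) := by
  refine cocycleWords_cochainWords ψ ?_
  rw [combination_eq]
  exact (K.vecCocycles P).sum_mem fun i hi =>
    (K.vecCocycles P).zsmul_mem (h.cocycle i (Finset.mem_range.mp hi)) _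

/-- Every integer cocycle is cohomologous to a reduced combination. -/
theorem exists_reduced (h : K.IsCohomologyBasis P d z) {σ : ℕ → ℕ → ℤ}
    (hσ : σ ∈ K.vecCocycles P) :
    ∃ v, IsReducedDigits d v ∧ σ - combination d.length z v ∈ K.vecCoboundaries P := by
  obtain ⟨n, hn⟩ := h.span σ hσ
  -- For infinite order the modulus is `0`, and `n i % 0 = n i` leaves the coefficient as it is.
  set v : List ℤ := (List.range d.length).map fun i => n i % (d.getD i 0 : ℕ) with hv
  have hget : ∀ i < d.length, v.getD i 0 = n i % (d.getD i 0 : ℕ) := by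
    intro i hi
    simp [hv, List.getD_eq_getElem?_getD, hi]
  refine ⟨v, ?_, ?_⟩
  · rw [IsReducedDigits, List.forall₂_iff_get]
    refine ⟨by simp [hv], fun i hi hi' h0 => ?_⟩
    have : v.get ⟨i, hi'⟩ = n i % (d.get ⟨i, hi⟩ : ℕ) := by
      simp [hv, hi]
    rw [this]
    exact ⟨Int.emod_nonneg _ (by exact_mod_cast h0),
      Int.emod_lt_of_pos _ (by exact_mod_cast Nat.pos_of_ne_zero h0)⟩
  · rw [combination_eq]
    -- Division with remainder: the discarded part is a combination of the coboundaries `d i • z i`.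
    have h1 : σ - ∑ i ∈ Finset.range d.length, v.getD i 0 • z i =
        (σ - ∑ i ∈ Finset.range d.length, n i • z i) +
        ∑ i ∈ Finset.range d.length, (n i / (d.getD i 0 : ℕ)) • ((d.getD i 0 : ℕ) : ℤ) • z i := by
      rw [sub_add, ← Finset.sum_sub_distrib]
      congr 1
      refine Finset.sum_congr rfl fun i hi => ?_
      rw [hget i (Finset.mem_range.mp hi), smul_smul, ← sub_smul, Int.emod_def, mul_comm]
    rw [h1]
    exact add_mem hn ((K.vecCoboundaries P).sum_mem fun i hi =>
      (K.vecCoboundaries P).zsmul_mem (h.order i (Finset.mem_range.mp hi)) _)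

/-- Cohomologous reduced combinations are equal. -/
theorem reduced_unique (h : K.IsCohomologyBasis P d z) {v v' : List ℤ} (hv : IsReducedDigits d v)
    (hv' : IsReducedDigits d v')
    (hc : combination d.length z v - combination d.length z v' ∈ K.vecCoboundaries P) :
    v = v' := by
  rw [combination_eq, combination_eq, ← Finset.sum_sub_distrib] at hc
  simp only [← sub_smul] at hc
  have h1 := h.indep (fun i => v.getD i 0 - v'.getD i 0) hc
  have hl := List.Forall₂.length_eq hv
  have hl' := List.Forall₂.length_eq hv'
  apply List.ext_getElem (hl.symm.trans hl')
  intro i hi hi'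
  have hid : i < d.length := by omega
  have h2 := h1 i hid
  have e1 : v.getD i 0 = v[i] := by simp [List.getD_eq_getElem?_getD, hi]
  have e2 : v'.getD i 0 = v'[i] := by simp [List.getD_eq_getElem?_getD, hi']
  by_cases h0 : d.getD i 0 = 0
  · rw [h0, Nat.cast_zero, zero_dvd_iff, sub_eq_zero] at h2
    rw [← e1, ← e2, h2]
  · have b1 := hv.getD hid h0
    have b2 := hv'.getD hid h0
    -- Two residues in `[0, d i)` differ by less than `d i`, and `d i` divides the difference.
    have := Int.eq_zero_of_abs_lt_dvd h2 (by rw [abs_lt]; constructor <;> linarith)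
    rw [← e1, ← e2]
    linarith

/-- Every cocycle is cohomologous to exactly one cocycle on the list. -/
theorem existsUnique_cocycleList (h : K.IsCohomologyBasis P d z) (ψ : P.Presented ≃* A)
    (hK : K.WellFormed) {a : List (List (ℕ × Bool))} (ha : K.CocycleWords P a) :
    ∃! n, ∃ c, K.cocycleList P d z n = some c ∧
      K.Cohomologous (P.cochain a) (P.cochain c) := by
  have hra := represents_signedCount (P := P) (ψ := ψ) ha.length_eq
  obtain ⟨v, hv, hc⟩ := h.exists_reduced (hra.isCocycle_iff.mp ha.cocycle)
  obtain ⟨n, hn⟩ := exists_unrank_eq hv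
  refine ⟨n, ⟨_, by rw [cocycleList, hn, Option.map_some],
    (hra.cohomologous_iff hK (represents_cochainWords ψ _)).mpr hc⟩, ?_⟩
  rintro n' ⟨c, hc', hcc⟩
  rw [cocycleList, Option.map_eq_some_iff] at hc'
  obtain ⟨v', hv', rfl⟩ := hc'
  have h1 := (hra.cohomologous_iff hK (represents_cochainWords ψ _)).mp hcc
  have h2 := (K.vecCoboundaries P).sub_mem h1 hc
  rw [sub_sub_sub_cancel_left] at h2
  have h3 := h.reduced_unique hv (isReducedDigits_of_unrank hv') h2
  subst h3
  exact unrank_injective hv' hn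

end IsCohomologyBasis

end CellComplex3

/-! ## Certificates for maximal trees -/

namespace CellComplex3

variable (K : CellComplex3) (T : List ℕ) (t : ℕ → List (ℕ × Bool))

/-- The edge `e` extends the path `t` to one of its ends to the path to the other end. -/
def ExtendsFwd (e : ℕ) : Prop :=
  t (K.edges.getD e (0, 0)).2 = t (K.edges.getD e (0, 0)).1 ++ [(e, true)]

/-- The inverse edge of `e` extends the path `t` to one of its ends to the path to the other
end. -/
def ExtendsBwd (e : ℕ) : Prop :=
  t (K.edges.getD e (0, 0)).1 = t (K.edges.getD e (0, 0)).2 ++ [(e, false)]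

/-- The paths `t` certify that `T` is a maximal tree. -/
def TreeCertificate : Prop :=
  (∀ u < K.numVertices, (u = 0 ∧ t u = []) ∨ ∃ e ∈ T,
    ((K.edges.getD e (0, 0)).2 = u ∧ K.ExtendsFwd t e) ∨
    ((K.edges.getD e (0, 0)).1 = u ∧ K.ExtendsBwd t e)) ∧
  ∀ e ∈ T, e < K.edges.length ∧ (K.ExtendsFwd t e ∨ K.ExtendsBwd t e)

variable {K T t}

/-- Induction on the length of the path: each step to a parent shortens it by one edge, so following
parents cannot cycle and ends at the vertex `0`. -/
theorem TreeCertificate.isWalk (h : K.TreeCertificate T t) (hK : K.WellFormed) (n : ℕ) :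
    ∀ u < K.numVertices, (t u).length ≤ n →
      K.IsWalk 0 (t u) u ∧ ∀ l ∈ t u, l.1 ∈ T := by
  induction n with
  | zero =>
    intro u hu hn
    rcases h.1 u hu with ⟨rfl, h0⟩ | ⟨e, he, ⟨rfl, h1⟩ | ⟨rfl, h1⟩⟩
    · rw [h0]
      exact ⟨IsWalk.nil _, by simp⟩
    · rw [h1] at hn
      simp at hn
    · rw [h1] at hn
      simp at hn
  | succ n ih =>
    intro u hu hn
    rcases h.1 u hu with ⟨rfl, h0⟩ | ⟨e, he, h1⟩
    · rw [h0]
      exact ⟨IsWalk.nil _, by simp⟩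
    · have hlt := (h.2 e he).1
      have hget := List.getElem?_eq_getElem hlt
      have hab := hK.edges_lt _ (List.getElem_mem hlt)
      simp only [ExtendsFwd, ExtendsBwd, List.getD_eq_getElem?_getD, hget,
        Option.getD_some] at h1
      rcases h1 with ⟨rfl, h1⟩ | ⟨rfl, h1⟩
      · rw [h1] at hn ⊢
        obtain ⟨h2, h3⟩ := ih _ hab.1 (by simpa using hn)
        refine ⟨h2.append (IsWalk.fwd hget (IsWalk.nil _)), ?_⟩
        simp only [List.mem_append, List.mem_singleton]
        rintro l (hl | rfl)
        · exact h3 l hl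
        · exact he
      · rw [h1] at hn ⊢
        obtain ⟨h2, h3⟩ := ih _ hab.2 (by simpa using hn)
        refine ⟨h2.append (IsWalk.bwd hget (IsWalk.nil _)), ?_⟩
        simp only [List.mem_append, List.mem_singleton]
        rintro l (hl | rfl)
        · exact h3 l hl
        · exact he

/-- The paths `t` form a potential with values in the free group, whose change along a tree edge is
that edge. A closed path in the tree is therefore freely trivial. -/
theorem TreeCertificate.mk_mul (h : K.TreeCertificate T t) {u v : ℕ} {w : List (ℕ × Bool)}
    (hw : K.IsWalk u w v) (hT : ∀ l ∈ w, l.1 ∈ T) :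
    FreeGroup.mk (t u) * FreeGroup.mk w = FreeGroup.mk (t v) := by
  have hedge : ∀ e a b, K.edges[e]? = some (a, b) → e ∈ T →
      FreeGroup.mk (t a) * FreeGroup.of e = FreeGroup.mk (t b) := by
    intro e a b hab he
    have h1 := (h.2 e he).2
    simp only [ExtendsFwd, ExtendsBwd, List.getD_eq_getElem?_getD, hab, Option.getD_some] at h1
    rcases h1 with h1 | h1
    · rw [h1, ← FreeGroup.mul_mk]
      rfl
    · rw [h1, ← FreeGroup.mul_mk]
      have : FreeGroup.mk [(e, false)] = (FreeGroup.of e)⁻¹ := rfl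
      rw [this, inv_mul_cancel_right]
  induction hw with
  | nil u => rw [← FreeGroup.one_eq_mk, mul_one]
  | @fwd e u u' x w he _ ih =>
    rw [List.forall_mem_cons] at hT
    have : FreeGroup.mk [(e, true)] = FreeGroup.of e := rfl
    rw [FreeGroup.mk_cons, ← mul_assoc, this, hedge _ _ _ he hT.1, ih hT.2]
  | @bwd e u u' x w he _ ih =>
    rw [List.forall_mem_cons] at hT
    have : FreeGroup.mk [(e, false)] = (FreeGroup.of e)⁻¹ := rfl
    rw [FreeGroup.mk_cons, ← mul_assoc, this, ← hedge _ _ _ he hT.1, mul_inv_cancel_right,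
      ih hT.2]

theorem TreeCertificate.isMaximalTree (h : K.TreeCertificate T t) (hK : K.WellFormed) :
    K.IsMaximalTree T where
  lt e he := (h.2 e he).1
  connected u hu v hv := by
    obtain ⟨h1, h2⟩ := h.isWalk hK _ u hu le_rfl
    obtain ⟨h3, h4⟩ := h.isWalk hK _ v hv le_rfl
    refine ⟨_, h1.invRev.append h3, ?_⟩
    simp only [List.mem_append]
    rintro l (hl | hl)
    · simp only [FreeGroup.invRev, List.mem_reverse, List.mem_map] at hl
      obtain ⟨l', hl', rfl⟩ := hl
      exact h2 l' hl'
    · exact h4 l hl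
  acyclic v w hw hT := by
    have := h.mk_mul hw hT
    simpa only [mul_eq_left] using this

/-- A path that leaves a set of vertices contains an edge that leaves the set. -/
theorem IsWalk.exists_edge_leaving {u v : ℕ} {w : List (ℕ × Bool)} (h : K.IsWalk u w v)
    {U : Finset ℕ} (hu : u ∈ U) (hv : v ∉ U) :
    ∃ e a b : ℕ, K.edges[e]? = some (a, b) ∧ (a ∈ U ∧ b ∉ U ∨ b ∈ U ∧ a ∉ U) := by
  induction h with
  | nil u => exact absurd hu hv
  | @fwd e u u' x w he _ ih =>
    by_cases h' : u' ∈ U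
    · exact ih h' hv
    · exact ⟨e, u, u', he, Or.inl ⟨hu, h'⟩⟩
  | @bwd e u u' x w he _ ih =>
    by_cases h' : u' ∈ U
    · exact ih h' hv
    · exact ⟨e, u', u, he, Or.inr ⟨hu, h'⟩⟩

/-- The tree grows from the vertex `0`: while a vertex is missing, connectedness gives an edge that
leaves the part reached so far. -/
theorem exists_treeCertificate (hK : K.WellFormed) (hc : K.Connected) :
    ∃ (T : List ℕ) (t : List (List (ℕ × Bool))), K.TreeCertificate T fun u => t.getD u [] := by
  have key : ∀ n < K.numVertices, ∃ (U : Finset ℕ) (T : List ℕ) (t : ℕ → List (ℕ × Bool)),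
      0 ∈ U ∧ U.card = n + 1 ∧ U ⊆ Finset.range K.numVertices ∧
      (∀ u ∈ U, (u = 0 ∧ t u = []) ∨ ∃ e ∈ T,
        ((K.edges.getD e (0, 0)).2 = u ∧ K.ExtendsFwd t e) ∨
        ((K.edges.getD e (0, 0)).1 = u ∧ K.ExtendsBwd t e)) ∧
      ∀ e ∈ T, ∃ a b, K.edges[e]? = some (a, b) ∧ a ∈ U ∧ b ∈ U ∧
        (K.ExtendsFwd t e ∨ K.ExtendsBwd t e) := by
    intro n
    induction n with
    | zero =>
      intro h
      exact ⟨{0}, [], fun _ => [], by simp, by simp, by simpa using h, by simp, by simp⟩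
    | succ n ih =>
      intro hn
      obtain ⟨U, T, t, h0, hcard, hsub, h1, h2⟩ := ih (by omega)
      obtain ⟨v, hv, hvU⟩ : ∃ v ∈ Finset.range K.numVertices, v ∉ U := by
        by_contra hcon
        push Not at hcon
        have := Finset.card_le_card (show Finset.range K.numVertices ⊆ U from hcon)
        rw [Finset.card_range] at this
        omega
      obtain ⟨w, hw⟩ := hc.2 0 hc.1 v (Finset.mem_range.mp hv)
      obtain ⟨e, a, b, he, hab⟩ := hw.exists_edge_leaving h0 hvU
      have hlt := hK.edges_lt _ (List.mem_of_getElem? he)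
      -- `x` is the end already reached and `y` the new one, in either orientation of the edge.
      -- Since `y` is new, changing its path affects no earlier tree edge.
      obtain ⟨x, y, hx, hy, hylt, word, hword⟩ : ∃ x y, x ∈ U ∧ y ∉ U ∧ y < K.numVertices ∧
          ∃ word : List (ℕ × Bool), (x = a ∧ y = b ∧ word = t a ++ [(e, true)]) ∨
            (x = b ∧ y = a ∧ word = t b ++ [(e, false)]) := by
        rcases hab with ⟨ha, hb⟩ | ⟨hb, ha⟩
        · exact ⟨a, b, ha, hb, hlt.2, _, Or.inl ⟨rfl, rfl, rfl⟩⟩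
        · exact ⟨b, a, hb, ha, hlt.1, _, Or.inr ⟨rfl, rfl, rfl⟩⟩
      set t' := Function.update t y word with ht'
      have htU : ∀ u ∈ U, t' u = t u := fun u hu =>
        Function.update_of_ne (fun h : u = y => hy (h ▸ hu)) _ _
      have hty : t' y = word := Function.update_self _ _ _
      have hkeep : ∀ e' ∈ T, (K.ExtendsFwd t' e' ↔ K.ExtendsFwd t e') ∧
          (K.ExtendsBwd t' e' ↔ K.ExtendsBwd t e') := by
        intro e' he'
        obtain ⟨a', b', hab', ha', hb', -⟩ := h2 e' he'
        simp only [ExtendsFwd, ExtendsBwd, List.getD_eq_getElem?_getD, hab', Option.getD_some,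
          htU a' ha', htU b' hb', and_self]
      have hnew : (y = b ∧ K.ExtendsFwd t' e) ∨ (y = a ∧ K.ExtendsBwd t' e) := by
        simp only [ExtendsFwd, ExtendsBwd, List.getD_eq_getElem?_getD, he, Option.getD_some]
        rcases hword with ⟨rfl, rfl, hwd⟩ | ⟨rfl, rfl, hwd⟩
        · exact Or.inl ⟨rfl, by rw [hty, htU _ hx, hwd]⟩
        · exact Or.inr ⟨rfl, by rw [hty, htU _ hx, hwd]⟩
      refine ⟨insert y U, e :: T, t', by simp [h0], by rw [Finset.card_insert_of_notMem hy, hcard],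
        ?_, ?_, ?_⟩
      · intro u hu
        rcases Finset.mem_insert.mp hu with rfl | hu
        · exact Finset.mem_range.mpr hylt
        · exact hsub hu
      · intro u hu
        rcases Finset.mem_insert.mp hu with rfl | hu
        · refine Or.inr ⟨e, by simp, ?_⟩
          have e1 : (K.edges.getD e (0, 0)) = (a, b) := by
            rw [List.getD_eq_getElem?_getD, he]; rfl
          rw [e1]
          rcases hnew with ⟨h, h'⟩ | ⟨h, h'⟩
          · exact Or.inl ⟨h.symm, h'⟩
          · exact Or.inr ⟨h.symm, h'⟩
        · rcases h1 u hu with ⟨hu0, hu1⟩ | ⟨e', he', h'⟩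
          · exact Or.inl ⟨hu0, by rw [htU u hu, hu1]⟩
          · refine Or.inr ⟨e', by simp [he'], ?_⟩
            rwa [(hkeep e' he').1, (hkeep e' he').2]
      · intro e' he'
        rcases List.mem_cons.mp he' with rfl | he'
        · refine ⟨a, b, he, ?_, ?_, hnew.imp And.right And.right⟩
          · rcases hword with ⟨rfl, rfl, -⟩ | ⟨rfl, rfl, -⟩ <;> simp [hx]
          · rcases hword with ⟨rfl, rfl, -⟩ | ⟨rfl, rfl, -⟩ <;> simp [hx]
        · obtain ⟨a', b', hab', ha', hb', h'⟩ := h2 e' he'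
          exact ⟨a', b', hab', by simp [ha'], by simp [hb'],
            by rwa [(hkeep e' he').1, (hkeep e' he').2]⟩
  obtain ⟨U, T, t, h0, hcard, hsub, h1, h2⟩ := key (K.numVertices - 1) (by have := hc.1; omega)
  have hU : U = Finset.range K.numVertices := by
    apply Finset.eq_of_subset_of_card_le hsub
    rw [Finset.card_range, hcard]
    omega
  -- The paths are tabulated at the vertices, so that the certificate is finite data.
  have hget : ∀ u ∈ U, ((List.range K.numVertices).map t).getD u [] = t u := by
    intro u hu
    have := Finset.mem_range.mp (hsub hu)
    simp [List.getD_eq_getElem?_getD, this]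
  have hiff : ∀ e ∈ T, (K.ExtendsFwd (fun u => ((List.range K.numVertices).map t).getD u []) e ↔
      K.ExtendsFwd t e) ∧ (K.ExtendsBwd (fun u => ((List.range K.numVertices).map t).getD u []) e ↔
      K.ExtendsBwd t e) := by
    intro e he
    obtain ⟨a, b, hab, ha, hb, -⟩ := h2 e he
    simp only [ExtendsFwd, ExtendsBwd]
    rw [show K.edges.getD e (0, 0) = (a, b) by rw [List.getD_eq_getElem?_getD, hab]; rfl]
    simp only [hget a ha, hget b hb, and_self]
  refine ⟨T, (List.range K.numVertices).map t, fun u hu => ?_, fun e he => ?_⟩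
  · have huU : u ∈ U := hU ▸ Finset.mem_range.mpr hu
    rcases h1 u huU with ⟨hu0, hu1⟩ | ⟨e, he, h'⟩
    · exact Or.inl ⟨hu0, by simp only [hget u huU, hu1]⟩
    · refine Or.inr ⟨e, he, ?_⟩
      rwa [(hiff e he).1, (hiff e he).2]
  · rw [(hiff e he).1, (hiff e he).2]
    obtain ⟨a, b, hab, -, -, h'⟩ := h2 e he
    exact ⟨(List.getElem?_eq_some_iff.mp hab).1, h'⟩

end CellComplex3

/-! ## Primitive recursive functions and predicates -/

section

variable {α β γ : Type*} [Primcodable α] [Primcodable β] [Primcodable γ]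

namespace Primrec

theorem comp_fst {f : α → β × γ} (hf : Primrec f) : Primrec fun a => (f a).1 := fst.comp hf

theorem comp_snd {f : α → β × γ} (hf : Primrec f) : Primrec fun a => (f a).2 := snd.comp hf

theorem comp_add {f g : α → ℕ} (hf : Primrec f) (hg : Primrec g) : Primrec fun a => f a + g a :=
  nat_add.comp hf hg

theorem comp_sub {f g : α → ℕ} (hf : Primrec f) (hg : Primrec g) : Primrec fun a => f a - g a :=
  nat_sub.comp hf hg

theorem comp_mul {f g : α → ℕ} (hf : Primrec f) (hg : Primrec g) : Primrec fun a => f a * g a :=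
  nat_mul.comp hf hg

theorem comp_div {f g : α → ℕ} (hf : Primrec f) (hg : Primrec g) : Primrec fun a => f a / g a :=
  nat_div.comp hf hg

theorem comp_mod {f g : α → ℕ} (hf : Primrec f) (hg : Primrec g) : Primrec fun a => f a % g a :=
  nat_mod.comp hf hg

theorem comp_unpair {f : α → ℕ} (hf : Primrec f) : Primrec fun a => (f a).unpair :=
  unpair.comp hf

theorem comp_encode {f : α → β} (hf : Primrec f) : Primrec fun a => Encodable.encode (f a) :=
  Primrec.encode.comp hf

theorem comp_ofNat {β : Type*} [Denumerable β] {f : α → ℕ} (hf : Primrec f) :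
    Primrec fun a => Denumerable.ofNat β (f a) :=
  (Primrec.ofNat β).comp hf

theorem comp_ite {c : α → Prop} [DecidablePred c] {f g : α → β} (hc : PrimrecPred c)
    (hf : Primrec f) (hg : Primrec g) : Primrec fun a => if c a then f a else g a :=
  ite hc hf hg

theorem comp_cond {c : α → Bool} {f g : α → β} (hc : Primrec c)
    (hf : Primrec f) (hg : Primrec g) : Primrec fun a => bif c a then f a else g a :=
  cond hc hf hg

theorem comp_decide {c : α → Prop} [DecidablePred c] (hc : PrimrecPred c) :
    Primrec fun a => decide (c a) :=
  hc.decide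

theorem comp_not {c : α → Bool} (hc : Primrec c) : Primrec fun a => !c a :=
  Primrec.not.comp hc

theorem comp_some {f : α → β} (hf : Primrec f) : Primrec fun a => some (f a) :=
  option_some.comp hf

theorem comp_option_map {o : α → Option β} {f : α → β → γ} (ho : Primrec o)
    (hf : Primrec fun x : α × β => f x.1 x.2) : Primrec fun a => (o a).map (f a) :=
  option_map ho hf

theorem comp_range {f : α → ℕ} (hf : Primrec f) : Primrec fun a => List.range (f a) :=
  list_range.comp hf

theorem comp_length {L : α → List β} (hL : Primrec L) : Primrec fun a => (L a).length :=
  list_length.comp hL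

theorem comp_cons {f : α → β} {L : α → List β} (hf : Primrec f) (hL : Primrec L) :
    Primrec fun a => f a :: L a :=
  list_cons.comp hf hL

theorem comp_append {L M : α → List β} (hL : Primrec L) (hM : Primrec M) :
    Primrec fun a => L a ++ M a :=
  list_append.comp hL hM

theorem comp_reverse {L : α → List β} (hL : Primrec L) : Primrec fun a => (L a).reverse :=
  list_reverse.comp hL

theorem comp_tail {L : α → List β} (hL : Primrec L) : Primrec fun a => (L a).tail :=
  list_tail.comp hL

theorem comp_head? {L : α → List β} (hL : Primrec L) : Primrec fun a => (L a).head? :=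
  list_head?.comp hL

theorem comp_getD {L : α → List β} {f : α → ℕ} (hL : Primrec L) (hf : Primrec f) (b : β) :
    Primrec fun a => (L a).getD (f a) b :=
  (list_getD b).comp hL hf

theorem comp_map {L : α → List β} {f : α → β → γ} (hL : Primrec L)
    (hf : Primrec fun x : α × β => f x.1 x.2) : Primrec fun a => (L a).map (f a) :=
  list_map hL hf

theorem comp_flatMap {L : α → List β} {f : α → β → List γ} (hL : Primrec L)
    (hf : Primrec fun x : α × β => f x.1 x.2) : Primrec fun a => (L a).flatMap (f a) :=
  list_flatMap hL hf

theorem comp_foldr {L : α → List β} {s : α → γ} {f : α → β → γ → γ} (hL : Primrec L)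
    (hs : Primrec s) (hf : Primrec fun x : α × β × γ => f x.1 x.2.1 x.2.2) :
    Primrec fun a => (L a).foldr (f a) (s a) :=
  list_foldr (h := fun a x => f a x.1 x.2) hL hs hf

/-- Filtering is concatenation of lists with at most one element. The predicate may depend on the
parameter `a`. -/
theorem comp_filter {L : α → List β} {p : α → β → Prop} [∀ a, DecidablePred (p a)]
    (hL : Primrec L) (hp : PrimrecPred fun x : α × β => p x.1 x.2) :
    Primrec fun a => (L a).filter fun b => p a b := by
  refine (list_flatMap hL (g := fun a b => if p a b then [b] else [])
    (ite hp (list_cons.comp snd (const [])) (const []))).of_eq fun a => ?_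
  generalize L a = l
  induction l with
  | nil => rfl
  | cons b l ih =>
    rw [List.flatMap_cons, ih, List.filter_cons]
    by_cases h : p a b <;> simp [h]

end Primrec

namespace PrimrecPred

theorem comp_eq {f g : α → β} (hf : Primrec f) (hg : Primrec g) : PrimrecPred fun a => f a = g a :=
  Primrec.eq.comp hf hg

theorem comp_lt {f g : α → ℕ} (hf : Primrec f) (hg : Primrec g) : PrimrecPred fun a => f a < g a :=
  Primrec.nat_lt.comp hf hg

theorem comp_le {f g : α → ℕ} (hf : Primrec f) (hg : Primrec g) : PrimrecPred fun a => f a ≤ g a :=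
  Primrec.nat_le.comp hf hg

theorem comp_and {p q : α → Prop} (hp : PrimrecPred p) (hq : PrimrecPred q) :
    PrimrecPred fun a => p a ∧ q a :=
  hp.and hq

theorem comp_or {p q : α → Prop} (hp : PrimrecPred p) (hq : PrimrecPred q) :
    PrimrecPred fun a => p a ∨ q a :=
  hp.or hq

theorem comp_not {p : α → Prop} (hp : PrimrecPred p) : PrimrecPred fun a => ¬p a :=
  hp.not

theorem forall_mem {L : α → List β} {p : α → β → Prop} (hL : Primrec L)
    (hp : PrimrecPred fun x : α × β => p x.1 x.2) : PrimrecPred fun a => ∀ b ∈ L a, p a b :=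
  (PrimrecRel.forall_mem_list (R := fun b a => p a b)
    (hp.comp (Primrec.pair Primrec.snd Primrec.fst))).comp hL Primrec.id

theorem exists_mem {L : α → List β} {p : α → β → Prop} (hL : Primrec L)
    (hp : PrimrecPred fun x : α × β => p x.1 x.2) : PrimrecPred fun a => ∃ b ∈ L a, p a b :=
  (PrimrecRel.exists_mem_list (R := fun b a => p a b)
    (hp.comp (Primrec.pair Primrec.snd Primrec.fst))).comp hL Primrec.id

theorem comp_forall_lt {n : α → ℕ} {p : α → ℕ → Prop} (hn : Primrec n)
    (hp : PrimrecPred fun x : α × ℕ => p x.1 x.2) : PrimrecPred fun a => ∀ b < n a, p a b :=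
  (forall_mem (p := p) (Primrec.comp_range hn) hp).of_eq fun _ => by simp

theorem comp_mem {L : α → List β} {f : α → β} (hf : Primrec f) (hL : Primrec L) :
    PrimrecPred fun a => f a ∈ L a :=
  (exists_mem (p := fun a b => b = f a) hL (comp_eq Primrec.snd (hf.comp Primrec.fst))).of_eq
    fun _ => by simp

end PrimrecPred

-- The closure properties above are stated for functions of a parameter, so that `fun_prop` can
-- follow the shape of a term. Constructions built from them are then primitive recursive by
-- unfolding.
attribute [fun_prop] Primrec PrimrecPred

attribute [fun_prop] Primrec.id Primrec.const Primrec.comp Primrec.pair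
  Primrec.comp_fst Primrec.comp_snd Primrec.comp_add Primrec.comp_sub Primrec.comp_mul
  Primrec.comp_div Primrec.comp_mod Primrec.comp_unpair Primrec.comp_encode Primrec.comp_ofNat
  Primrec.comp_ite Primrec.comp_cond Primrec.comp_decide Primrec.comp_not Primrec.comp_some
  Primrec.comp_option_map Primrec.comp_range Primrec.comp_length Primrec.comp_cons
  Primrec.comp_append Primrec.comp_reverse Primrec.comp_tail Primrec.comp_head? Primrec.comp_getD
  Primrec.comp_map Primrec.comp_flatMap Primrec.comp_foldr Primrec.comp_filter

attribute [fun_prop] PrimrecPred.comp_eq PrimrecPred.comp_lt PrimrecPred.comp_le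
  PrimrecPred.comp_and PrimrecPred.comp_or PrimrecPred.comp_not
  PrimrecPred.forall_mem PrimrecPred.exists_mem PrimrecPred.comp_forall_lt PrimrecPred.comp_mem

/-! ### Integers -/

namespace Primrec

/-- The code of an integer is `2n` for `n ≥ 0` and `2n - 1` for `-n < 0`. Its parity gives the sign,
which reduces integer arithmetic to natural numbers. -/
theorem encode_int (z : ℤ) : Encodable.encode z =
    if 0 ≤ z then 2 * z.toNat else 2 * (-z).toNat - 1 := by
  have : Encodable.encode z = Equiv.intEquivNat z := rfl
  rw [this]
  cases z with
  | ofNat n => 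
    rw [if_pos (show 0 ≤ Int.ofNat n from Int.natCast_nonneg n),
      show (Int.ofNat n).toNat = n from rfl]
    rfl
  | negSucc n => 
    simp [Equiv.intEquivNat, Equiv.intEquivNatSumNat]
    omega

theorem comp_toNat {f : α → ℤ} (hf : Primrec f) : Primrec fun a => (f a).toNat := by
  have : Primrec fun a => if Encodable.encode (f a) % 2 = 0 then
      Encodable.encode (f a) / 2 else 0 := by
    fun_prop
  refine this.of_eq fun a => ?_
  rw [encode_int]
  split_ifs <;> omega

theorem comp_neg_toNat {f : α → ℤ} (hf : Primrec f) : Primrec fun a => (-f a).toNat := by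
  have : Primrec fun a => if Encodable.encode (f a) % 2 = 0 then 0 else
      Encodable.encode (f a) / 2 + 1 := by
    fun_prop
  refine this.of_eq fun a => ?_
  rw [encode_int]
  split_ifs <;> omega

/-- An integer is the difference of its positive and negative parts, so the remaining arithmetic
operations follow from this one. -/
theorem comp_natCast_sub {f g : α → ℕ} (hf : Primrec f) (hg : Primrec g) :
    Primrec fun a => (f a : ℤ) - (g a : ℤ) := by
  have : Primrec fun a => if g a ≤ f a then 2 * (f a - g a) else 2 * (g a - f a) - 1 := by
    fun_prop
  refine encode_iff.mp (this.of_eq fun a => ?_)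
  rw [encode_int]
  split_ifs <;> omega

theorem comp_natCast {f : α → ℕ} (hf : Primrec f) : Primrec fun a => (f a : ℤ) :=
  (comp_natCast_sub hf (const 0)).of_eq fun a => by simp

theorem comp_int_add {f g : α → ℤ} (hf : Primrec f) (hg : Primrec g) :
    Primrec fun a => f a + g a :=
  (comp_natCast_sub (comp_add (comp_toNat hf) (comp_toNat hg))
    (comp_add (comp_neg_toNat hf) (comp_neg_toNat hg))).of_eq fun a => by omega

theorem comp_int_neg {f : α → ℤ} (hf : Primrec f) : Primrec fun a => -f a :=
  (comp_natCast_sub (comp_neg_toNat hf) (comp_toNat hf)).of_eq fun a => by omega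

theorem comp_int_sub {f g : α → ℤ} (hf : Primrec f) (hg : Primrec g) :
    Primrec fun a => f a - g a :=
  (comp_int_add hf (comp_int_neg hg)).of_eq fun a => by omega

theorem comp_natAbs {f : α → ℤ} (hf : Primrec f) : Primrec fun a => (f a).natAbs :=
  (comp_add (comp_toNat hf) (comp_neg_toNat hf)).of_eq fun a => by omega

theorem comp_int_mul {f g : α → ℤ} (hf : Primrec f) (hg : Primrec g) :
    Primrec fun a => f a * g a := by
  refine (comp_natCast_sub
    (comp_add (comp_mul (comp_toNat hf) (comp_toNat hg))
      (comp_mul (comp_neg_toNat hf) (comp_neg_toNat hg)))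
    (comp_add (comp_mul (comp_toNat hf) (comp_neg_toNat hg))
      (comp_mul (comp_neg_toNat hf) (comp_toNat hg)))).of_eq fun a => ?_
  have h1 : f a = (f a).toNat - (-f a).toNat := by omega
  have h2 : g a = (g a).toNat - (-g a).toNat := by omega
  conv_rhs => rw [h1, h2]
  push_cast
  ring

theorem comp_sum {L : α → List ℕ} (hL : Primrec L) : Primrec fun a => (L a).sum :=
  comp_foldr hL (const 0) (comp_add (fst.comp snd) (snd.comp snd))

end Primrec

attribute [fun_prop] Primrec.comp_toNat Primrec.comp_natCast Primrec.comp_int_add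
  Primrec.comp_int_neg Primrec.comp_int_sub Primrec.comp_natAbs Primrec.comp_int_mul
  Primrec.comp_sum

theorem Primrec.comp_int_sum {L : α → List ℤ} (hL : Primrec L) : Primrec fun a => (L a).sum :=
  comp_foldr hL (const 0) (by fun_prop)

theorem PrimrecPred.comp_int_nonneg {f : α → ℤ} (hf : Primrec f) : PrimrecPred fun a => 0 ≤ f a :=
  (PrimrecPred.comp_eq (Primrec.comp_natCast (Primrec.comp_toNat hf)) hf).of_eq
    fun a => by omega

attribute [fun_prop] Primrec.comp_int_sum PrimrecPred.comp_int_nonneg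

end

/-! ## Computability of the constructions -/

section

variable {α : Type*} {β : Type} [Primcodable α] [Primcodable β]

namespace Primrec

theorem comp_gens {P : α → FinPresentation β} (hP : Primrec P) : Primrec fun a => (P a).gens :=
  comp_fst ((of_equiv (e := FinPresentation.equivProd)).comp hP)

theorem comp_rels {P : α → FinPresentation β} (hP : Primrec P) : Primrec fun a => (P a).rels :=
  comp_snd ((of_equiv (e := FinPresentation.equivProd)).comp hP)

theorem comp_finPresentation {g : α → List β} {r : α → List (List (β × Bool))} (hg : Primrec g)
    (hr : Primrec r) : Primrec fun a => FinPresentation.mk (g a) (r a) :=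
  (of_equiv_symm (e := FinPresentation.equivProd)).comp (pair hg hr)

end Primrec

variable {K : α → CellComplex3} {P : α → FinPresentation ℕ}

namespace Primrec

theorem comp_numVertices (hK : Primrec K) : Primrec fun a => (K a).numVertices :=
  comp_fst ((of_equiv (e := CellComplex3.equivProd)).comp hK)

theorem comp_edges (hK : Primrec K) : Primrec fun a => (K a).edges :=
  comp_fst (comp_snd ((of_equiv (e := CellComplex3.equivProd)).comp hK))

theorem comp_faces (hK : Primrec K) : Primrec fun a => (K a).faces :=
  comp_fst (comp_snd (comp_snd ((of_equiv (e := CellComplex3.equivProd)).comp hK)))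

theorem comp_solids (hK : Primrec K) : Primrec fun a => (K a).solids :=
  comp_snd (comp_snd (comp_snd ((of_equiv (e := CellComplex3.equivProd)).comp hK)))

attribute [fun_prop] comp_gens comp_rels comp_finPresentation comp_numVertices comp_edges
  comp_faces comp_solids

theorem comp_signedCount {x : α → ℕ} {w : α → List (ℕ × Bool)} (hx : Primrec x) (hw : Primrec w) :
    Primrec fun a => signedCount (x a) (w a) := by
  unfold signedCount
  fun_prop

theorem comp_genBound (hP : Primrec P) : Primrec fun a => (P a).genBound := by
  unfold FinPresentation.genBound
  fun_prop

attribute [fun_prop] comp_signedCount comp_genBound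

theorem comp_allRels (hP : Primrec P) : Primrec fun a => (P a).allRels := by
  unfold FinPresentation.allRels
  fun_prop

attribute [fun_prop] comp_allRels

theorem comp_relCoeff {x i : α → ℕ} (hP : Primrec P) (hx : Primrec x) (hi : Primrec i) :
    Primrec fun a => (P a).relCoeff (x a) (i a) := by
  unfold FinPresentation.relCoeff
  fun_prop

theorem comp_wordOf {c : α → ℕ → ℤ} (hP : Primrec P)
    (hc : Primrec fun x : α × ℕ => c x.1 x.2) : Primrec fun a => (P a).wordOf (c a) := by
  unfold FinPresentation.wordOf
  fun_prop

theorem comp_solidCoeff {s j : α → ℕ} (hK : Primrec K) (hs : Primrec s) (hj : Primrec j) :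
    Primrec fun a => (K a).solidCoeff (s a) (j a) := by
  unfold CellComplex3.solidCoeff
  fun_prop

theorem comp_faceCoeff {j e : α → ℕ} (hK : Primrec K) (hj : Primrec j) (he : Primrec e) :
    Primrec fun a => (K a).faceCoeff (j a) (e a) := by
  unfold CellComplex3.faceCoeff
  fun_prop

theorem comp_linBlock {t n k : α → ℕ} (ht : Primrec t) (hn : Primrec n) (hk : Primrec k) :
    Primrec fun a => linBlock (t a) (n a) (k a) := by
  unfold linBlock
  fun_prop

theorem comp_tableAt {L : α → List ℤ} {f : α → β} (hL : Primrec L) (hf : Primrec f) :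
    Primrec fun a => tableAt (L a) (f a) := by
  unfold tableAt
  fun_prop

attribute [fun_prop] comp_relCoeff comp_wordOf comp_solidCoeff comp_faceCoeff comp_linBlock
  comp_tableAt

theorem comp_outside {T : α → List ℕ} (hK : Primrec K) (hT : Primrec T) :
    Primrec fun a => (K a).outside (T a) := by
  unfold CellComplex3.outside
  fun_prop

theorem comp_invRev {w : α → List (β × Bool)} (hw : Primrec w) :
    Primrec fun a => FreeGroup.invRev (w a) := by
  unfold FreeGroup.invRev
  fun_prop

end Primrec

/-- The defaults `b`, `c` are never read, since the index stays below both lengths. -/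
theorem List.zipWith_eq_map_range {β γ δ : Type*} (f : β → γ → δ) (l : List β) (l' : List γ)
    (b : β) (c : γ) : List.zipWith f l l' =
      (List.range (min l.length l'.length)).map fun i => f (l.getD i b) (l'.getD i c) := by
  refine List.ext_getElem (by simp) fun i h₁ h₂ => ?_
  simp only [List.length_zipWith, lt_min_iff] at h₁
  simp [h₁.1, h₁.2]

section

variable {γ δ : Type} [Primcodable γ] [Primcodable δ]

namespace Primrec

theorem comp_inl {f : α → β} (hf : Primrec f) : Primrec fun a => (Sum.inl (f a) : β ⊕ γ) :=
  sumInl.comp hf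

theorem comp_inr {f : α → γ} (hf : Primrec f) : Primrec fun a => (Sum.inr (f a) : β ⊕ γ) :=
  sumInr.comp hf

attribute [fun_prop] comp_outside comp_invRev comp_inl comp_inr

theorem comp_zipWith {L : α → List β} {M : α → List γ} {f : α → β → γ → δ} (hL : Primrec L)
    (hM : Primrec M) (hf : Primrec fun x : α × β × γ => f x.1 x.2.1 x.2.2) (b : β) (c : γ) :
    Primrec fun a => List.zipWith (f a) (L a) (M a) := by
  simp only [List.zipWith_eq_map_range _ _ _ b c]
  exact comp_map (comp_range (nat_min.comp (by fun_prop) (by fun_prop)))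
    (hf.comp (g := fun x : α × ℕ => (x.1, (L x.1).getD x.2 b, (M x.1).getD x.2 c)) (by fun_prop))

end Primrec

end

namespace Primrec

theorem comp_centralPresentation {T : α → List ℕ} {w : α → List (List (ℕ × Bool))}
    (hK : Primrec K) (hT : Primrec T) (hP : Primrec P) (hw : Primrec w) :
    Primrec fun a => (K a).centralPresentation (T a) (P a) (w a) := by
  unfold CellComplex3.centralPresentation
  -- The maps `Prod.map Sum.inl id` and `Prod.map Sum.inr id` are written as explicit pairs,
  -- definitionally equal to them, to which the closure lemmas apply.
  have h : Primrec fun a => List.zipWith (fun (f : ℕ × List (ℕ × Bool)) w =>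
      ((f.2.filter (fun l => l.1 ∉ T a)).map fun l => ((Sum.inl l.1 : ℕ ⊕ ℕ), l.2)) ++
      FreeGroup.invRev (w.map fun l => ((Sum.inr l.1 : ℕ ⊕ ℕ), l.2))) (K a).faces (w a) :=
    comp_zipWith (by fun_prop) hw (by fun_prop) (0, []) []
  have h' : Primrec fun a => (P a).rels.map fun r =>
      r.map fun l => ((Sum.inr l.1 : ℕ ⊕ ℕ), l.2) := by
    fun_prop
  exact comp_finPresentation (by fun_prop) (comp_append (comp_append h' h) (by fun_prop))

theorem comp_unrank {d : α → List ℕ} {n : α → ℕ} (hd : Primrec d) (hn : Primrec n) :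
    Primrec fun a => unrank (d a) (n a) := by
  unfold unrank radixDigits digitStep
  fun_prop

attribute [fun_prop] comp_centralPresentation comp_unrank

theorem comp_cocycleList {d : α → List ℕ} {z : α → List ℤ} {n : α → ℕ} (hK : Primrec K)
    (hP : Primrec P) (hd : Primrec d) (hz : Primrec z) (hn : Primrec n) :
    Primrec fun a => CellComplex3.cocycleList (K a) (P a) (d a)
      (fun i j x => tableAt (z a) (i, j, x)) (n a) := by
  unfold CellComplex3.cocycleList CellComplex3.cochainWords CellComplex3.combination
  fun_prop

end Primrec

/-- A `LinSystem` contains functions and is not itself finite data; its fields are therefore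
supplied separately, each primitive recursive in the parameter and the indices. -/
theorem PrimrecPred.comp_check {u e r k : α → List LinIndex} {g f h : α → LinIndex → LinIndex → ℤ}
    {c : α → ℤ × List ℤ × List ℤ} (hu : Primrec u) (he : Primrec e) (hr : Primrec r)
    (hk : Primrec k) (hg : Primrec fun x : α × LinIndex × LinIndex => g x.1 x.2.1 x.2.2)
    (hf : Primrec fun x : α × LinIndex × LinIndex => f x.1 x.2.1 x.2.2)
    (hh : Primrec fun x : α × LinIndex × LinIndex => h x.1 x.2.1 x.2.2) (hc : Primrec c) :
    PrimrecPred fun a => (LinSystem.mk (u a) (e a) (r a) (k a) (g a) (f a) (h a)).Check (c a) := by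
  unfold LinSystem.Check
  have hf' : Primrec fun x : (α × LinIndex) × LinIndex => f x.1.1 x.1.2 x.2 :=
    hf.comp (g := fun x : (α × LinIndex) × LinIndex => (x.1.1, x.1.2, x.2)) (by fun_prop)
  have hg' : Primrec fun x : ((α × LinIndex) × LinIndex) × LinIndex => g x.1.1.1 x.2 x.1.2 :=
    hg.comp (g := fun x : ((α × LinIndex) × LinIndex) × LinIndex => (x.1.1.1, x.2, x.1.2))
      (by fun_prop)
  have hh' : Primrec fun x : ((α × LinIndex) × LinIndex) × LinIndex => h x.1.1.1 x.1.1.2 x.2 :=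
    hh.comp (g := fun x : ((α × LinIndex) × LinIndex) × LinIndex => (x.1.1.1, x.1.1.2, x.2))
      (by fun_prop)
  fun_prop

namespace Primrec

theorem comp_relMatrix {r c : α → LinIndex} (hP : Primrec P) (hr : Primrec r) (hc : Primrec c) :
    Primrec fun a => (P a).relMatrix (r a) (c a) := by
  unfold FinPresentation.relMatrix
  fun_prop

attribute [fun_prop] comp_relMatrix

theorem comp_genMatrix {z : α → List ℤ} {r c : α → LinIndex} (hK : Primrec K) (hP : Primrec P)
    (hz : Primrec z) (hr : Primrec r) (hc : Primrec c) :
    Primrec fun a => (K a).genMatrix (P a) (fun i j x => tableAt (z a) (i, j, x)) (r a) (c a) := by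
  unfold CellComplex3.genMatrix
  fun_prop

theorem comp_coboundaryCols (hK : Primrec K) (hP : Primrec P) :
    Primrec fun a => (K a).coboundaryCols (P a) := by
  unfold CellComplex3.coboundaryCols
  fun_prop

attribute [fun_prop] comp_genMatrix comp_coboundaryCols

end Primrec

namespace PrimrecPred

theorem comp_treeCertificate {T : α → List ℕ} {t : α → List (List (ℕ × Bool))} (hK : Primrec K)
    (hT : Primrec T) (ht : Primrec t) :
    PrimrecPred fun a => (K a).TreeCertificate (T a) fun u => (t a).getD u [] := by
  unfold CellComplex3.TreeCertificate CellComplex3.ExtendsFwd CellComplex3.ExtendsBwd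
  fun_prop

variable {d : α → List ℕ} {z : α → List ℤ} {c : α → ℤ × List ℤ × List ℤ}

theorem comp_cocycleSystem (hK : Primrec K) (hP : Primrec P) (hd : Primrec d) (hz : Primrec z)
    (hc : Primrec c) : PrimrecPred fun a => ((K a).cocycleSystem (P a) (d a)
      fun i j x => tableAt (z a) (i, j, x)).Check (c a) := by
  unfold CellComplex3.cocycleSystem
  apply comp_check <;> fun_prop

theorem comp_orderSystem (hK : Primrec K) (hP : Primrec P) (hd : Primrec d) (hz : Primrec z)
    (hc : Primrec c) : PrimrecPred fun a => ((K a).orderSystem (P a) (d a)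
      fun i j x => tableAt (z a) (i, j, x)).Check (c a) := by
  unfold CellComplex3.orderSystem
  apply comp_check <;> fun_prop

theorem comp_spanSystem (hK : Primrec K) (hP : Primrec P) (hd : Primrec d) (hz : Primrec z)
    (hc : Primrec c) : PrimrecPred fun a => ((K a).spanSystem (P a) (d a)
      fun i j x => tableAt (z a) (i, j, x)).Check (c a) := by
  unfold CellComplex3.spanSystem
  apply comp_check <;> fun_prop

theorem comp_indepSystem (hK : Primrec K) (hP : Primrec P) (hd : Primrec d) (hz : Primrec z)
    (hc : Primrec c) : PrimrecPred fun a => ((K a).indepSystem (P a) (d a)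
      fun i j x => tableAt (z a) (i, j, x)).Check (c a) := by
  unfold CellComplex3.indepSystem
  apply comp_check <;> fun_prop

end PrimrecPred

end

/-! ## The enumeration of the central extensions -/

/-- Unbounded search for witnesses of a decidable relation. -/
theorem PrimrecPred.exists_partrec_choice {α β : Type*} [Primcodable α] [Primcodable β]
    {p : α → β → Prop} (hp : PrimrecPred fun x : α × β => p x.1 x.2) :
    ∃ f : α →. β, Partrec f ∧ ∀ a, (∃ b, p a b) → ∃ b, p a b ∧ f a = Part.some b := by
  classical
  -- Every number is decoded and tested; the first candidate that passes is returned.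
  set q : α → ℕ → Option β := fun a n => (Encodable.decode n).bind fun b =>
    if p a b then some b else none with hq
  have hmem : ∀ a n b, b ∈ q a n → p a b := by
    intro a n b hb
    simp only [hq, Option.mem_def, Option.bind_eq_some_iff, Option.ite_none_right_eq_some,
      Option.some.injEq] at hb
    obtain ⟨b', -, h, rfl⟩ := hb
    exact h
  have hprim : Primrec₂ q :=
    Primrec.option_bind (Primrec.decode.comp Primrec.snd)
      (Primrec.ite (hp.comp (Primrec.pair (Primrec.fst.comp Primrec.fst) Primrec.snd))
        (Primrec.option_some.comp Primrec.snd) (Primrec.const none))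
  refine ⟨fun a => Nat.rfindOpt (q a), Partrec.rfindOpt hprim.to_comp, fun a ⟨b, hb⟩ => ?_⟩
  have hdom : (Nat.rfindOpt (q a)).Dom := by
    refine Nat.rfindOpt_dom.mpr ⟨Encodable.encode b, b, ?_⟩
    simp [hq, hb]
  obtain ⟨n, hn⟩ := Nat.rfindOpt_spec (Part.get_mem hdom)
  exact ⟨_, hmem a n _ hn, (Part.some_get hdom).symm⟩

namespace CellComplex3

variable {K : CellComplex3} {P : FinPresentation ℕ}

theorem vecCoboundaries_congr {σ σ' : ℕ → ℕ → ℤ} (h : σ ∈ K.vecCoboundaries P)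
    (hσ : ∀ j < K.faces.length, ∀ x < P.genBound, σ' j x = σ j x) : σ' ∈ K.vecCoboundaries P := by
  obtain ⟨t, ht⟩ := h
  exact ⟨t, fun j hj => (ht j hj).congr fun x hx => by rw [hσ j hj x hx]⟩

/-- Only entries in a finite box matter, so a basis may be replaced by its table. -/
theorem IsCohomologyBasis.congr {d : List ℕ} {z z' : ℕ → ℕ → ℕ → ℤ}
    (h : K.IsCohomologyBasis P d z) (hz : ∀ i < d.length, ∀ j < K.faces.length,
      ∀ x < P.genBound, z' i j x = z i j x) : K.IsCohomologyBasis P d z' := by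
  have hsum : ∀ n : ℕ → ℤ, ∀ j < K.faces.length, ∀ x < P.genBound,
      (∑ i ∈ Finset.range d.length, n i • z' i) j x =
        (∑ i ∈ Finset.range d.length, n i • z i) j x := by
    intro n j hj x hx
    simp only [Finset.sum_apply, Pi.smul_apply]
    exact Finset.sum_congr rfl fun i hi => by rw [hz i (Finset.mem_range.mp hi) j hj x hx]
  refine ⟨fun i hi s hs => (h.cocycle i hi s hs).congr fun x hx =>
    Finset.sum_congr rfl fun j hj => ?_, fun i hi => ?_, fun σ hσ => ?_, fun n hn => ?_⟩
  · rw [hz i hi j (Finset.mem_range.mp hj) x hx]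
  · exact vecCoboundaries_congr (h.order i hi) fun j hj x hx => by
      simp only [Pi.smul_apply, hz i hi j hj x hx]
  · obtain ⟨n, hn⟩ := h.span σ hσ
    exact ⟨n, vecCoboundaries_congr hn fun j hj x hx => by
      simp only [Pi.sub_apply, hsum n j hj x hx]⟩
  · exact h.indep n (vecCoboundaries_congr hn fun j hj x hx => (hsum n j hj x hx).symm)

variable (K P)

/-- The data that certify a maximal tree and a basis of the second cohomology. -/
abbrev ExtensionCertificate : Type :=
  (List ℕ × List (List (ℕ × Bool))) × (List ℕ × List ℤ) ×
    (ℤ × List ℤ × List ℤ) × (ℤ × List ℤ × List ℤ) × (ℤ × List ℤ × List ℤ) × (ℤ × List ℤ × List ℤ)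

/-- The data certify a maximal tree and a basis of the second cohomology. -/
def IsExtensionCertificate (c : ExtensionCertificate) : Prop :=
  (K.TreeCertificate c.1.1 fun u => c.1.2.getD u []) ∧
  ((∀ k ∈ c.2.1.1, k ≠ 0) ∨ c.2.1.1.head? = some 0) ∧
  (K.cocycleSystem P c.2.1.1 fun i j x => tableAt c.2.1.2 (i, j, x)).Check c.2.2.1 ∧
  (K.orderSystem P c.2.1.1 fun i j x => tableAt c.2.1.2 (i, j, x)).Check c.2.2.2.1 ∧
  (K.spanSystem P c.2.1.1 fun i j x => tableAt c.2.1.2 (i, j, x)).Check c.2.2.2.2.1 ∧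
  (K.indepSystem P c.2.1.1 fun i j x => tableAt c.2.1.2 (i, j, x)).Check c.2.2.2.2.2

theorem primrecPred_isExtensionCertificate :
    PrimrecPred fun x : (CellComplex3 × FinPresentation ℕ) × ExtensionCertificate =>
      x.1.1.IsExtensionCertificate x.1.2 x.2 := by
  refine (PrimrecPred.comp_treeCertificate ?_ ?_ ?_).and (PrimrecPred.and ?_
    ((PrimrecPred.comp_cocycleSystem ?_ ?_ ?_ ?_ ?_).and
    ((PrimrecPred.comp_orderSystem ?_ ?_ ?_ ?_ ?_).and
    ((PrimrecPred.comp_spanSystem ?_ ?_ ?_ ?_ ?_).and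
    (PrimrecPred.comp_indepSystem ?_ ?_ ?_ ?_ ?_))))) <;> fun_prop

variable {K P}

theorem exists_isExtensionCertificate (hK : K.WellFormed) (hc : K.Connected) :
    ∃ c, K.IsExtensionCertificate P c := by
  obtain ⟨T, t, ht⟩ := exists_treeCertificate hK hc
  obtain ⟨d, z, hz, hd⟩ := exists_isCohomologyBasis K P
  obtain ⟨L, hL⟩ := exists_table (fun y : ℕ × ℕ × ℕ => z y.1 y.2.1 y.2.2)
    (List.range d.length ×ˢ List.range K.faces.length ×ˢ List.range P.genBound)
  have hz' : K.IsCohomologyBasis P d fun i j x => tableAt L (i, j, x) :=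
    hz.congr fun i hi j hj x hx => hL (i, j, x) (by simp [hi, hj, hx])
  obtain ⟨⟨c₁, h₁⟩, ⟨c₂, h₂⟩, ⟨c₃, h₃⟩, c₄, h₄⟩ := isCohomologyBasis_iff.mp hz'
  exact ⟨((T, t), (d, L), c₁, c₂, c₃, c₄), ht, hd, h₁, h₂, h₃, h₄⟩

/-- The words listed for a certificate. -/
def certifiedList (K : CellComplex3) (P : FinPresentation ℕ) (c : ExtensionCertificate) (n : ℕ) :
    Option (List (List (ℕ × Bool))) :=
  K.cocycleList P c.2.1.1 (fun i j x => tableAt c.2.1.2 (i, j, x)) n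

theorem IsExtensionCertificate.isCohomologyBasis {c : ExtensionCertificate}
    (h : K.IsExtensionCertificate P c) :
    K.IsCohomologyBasis P c.2.1.1 fun i j x => tableAt c.2.1.2 (i, j, x) :=
  isCohomologyBasis_iff.mpr ⟨⟨_, h.2.2.1⟩, ⟨_, h.2.2.2.1⟩, ⟨_, h.2.2.2.2.1⟩, _, h.2.2.2.2.2⟩

/-- There is an algorithm that finds certificates and lists the corresponding presentations. -/
theorem exists_partrec_enum :
    ∃ enum : (CellComplex3 × FinPresentation ℕ) × ℕ →. Option (FinPresentation (ℕ ⊕ ℕ)),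
      Partrec enum ∧ ∀ (K : CellComplex3) (P : FinPresentation ℕ), K.WellFormed → K.Connected →
        ∃ c, K.IsExtensionCertificate P c ∧ ∀ n, enum ((K, P), n) =
          Part.some ((K.certifiedList P c n).map (K.centralPresentation c.1.1 P)) := by
  obtain ⟨f, hf, hf'⟩ := PrimrecPred.exists_partrec_choice
    (p := fun (x : CellComplex3 × FinPresentation ℕ) c => x.1.IsExtensionCertificate x.2 c)
    primrecPred_isExtensionCertificate
  -- The search sees only `K` and `P`, not the position `n`, so all entries of the list use the same
  -- certificate and hence the same tree.
  refine ⟨fun x => (f x.1).map fun c =>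
      (x.1.1.certifiedList x.1.2 c x.2).map (x.1.1.centralPresentation c.1.1 x.1.2),
    (hf.comp Computable.fst).map (Primrec.to_comp ?_), fun K P hK hc => ?_⟩
  · have h : Primrec fun x : ((CellComplex3 × FinPresentation ℕ) × ℕ) × ExtensionCertificate =>
        x.1.1.1.certifiedList x.1.1.2 x.2 x.1.2 := by
      unfold certifiedList
      apply Primrec.comp_cocycleList <;> fun_prop
    exact Primrec.comp_option_map h (by fun_prop)
  · obtain ⟨c, hc, hfc⟩ := hf' (K, P) (exists_isExtensionCertificate hK hc)
    refine ⟨c, hc, fun n => ?_⟩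
    simp only [hfc, Part.map_some]

end CellComplex3

/-! ### The main theorem -/

theorem mainTheorem9 :
    -- Every cellular 2-cocycle gives a central extension by the explicit presentation, two of these
    -- are equivalent exactly when the cocycles are cohomologous, and every central extension is
    -- the one given by the cocycle `j ↦ r_j(lifts)`.
    (∀ (K : CellComplex3) (T : List ℕ) (P : FinPresentation ℕ) (v : ℕ)
        (G : Type*) [Group G] (A : Type*) [CommGroup A]
        (φ : K.Pi1 v ≃* G) (ψ : P.Presented ≃* A),
        K.IsThreeSkeleton → K.IsMaximalTree T → P.WellFormed → v < K.numVertices →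
        (∀ a, K.CocycleWords P a →
          ∃ S : GroupExtension A (K.centralPresentation T P a).Presented G,
            S.IsCentral ∧ K.IsStandardExtension T P a φ ψ S) ∧
        (∀ a b, K.CocycleWords P a → K.CocycleWords P b →
          ∀ (S : GroupExtension A (K.centralPresentation T P a).Presented G)
            (S' : GroupExtension A (K.centralPresentation T P b).Presented G),
            K.IsStandardExtension T P a φ ψ S → K.IsStandardExtension T P b φ ψ S' →
            (Nonempty (S.Equiv S') ↔ K.Cohomologous (P.cochain a) (P.cochain b))) ∧
        (∀ (E : Type*) [Group E] (R : GroupExtension A E G), R.IsCentral →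
          (∃ τ, K.IsLift T φ R τ) ∧
          ∀ τ, K.IsLift T φ R τ → ∃ a, K.CocycleWords P a ∧
            (∀ j f, K.faces[j]? = some f →
              R.inl (ψ (P.cochain a j)) = FreeGroup.lift τ (FreeGroup.mk f.2)) ∧
            ∃ S : GroupExtension A (K.centralPresentation T P a).Presented G,
              K.IsStandardExtension T P a φ ψ S ∧ Nonempty (S.Equiv R))) ∧
    -- There is one algorithm which, for every 3-skeleton `K` of a `K(G, 1)` and every finite
    -- presentation `P` of an abelian group `A`, lists such presentations (`none` means that the
    -- list has ended), exactly one for each equivalence class of central extensions.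
    (∃ enum : (CellComplex3 × FinPresentation ℕ) × ℕ →. Option (FinPresentation (ℕ ⊕ ℕ)),
      Partrec enum ∧
      ∀ (K : CellComplex3) (P : FinPresentation ℕ), K.IsThreeSkeleton → P.WellFormed →
        (∀ x y : P.Presented, x * y = y * x) →
        ∃ (T : List ℕ) (a : ℕ → Option (List (List (ℕ × Bool)))),
          K.IsMaximalTree T ∧
          (∀ n, enum ((K, P), n) = Part.some ((a n).map (K.centralPresentation T P))) ∧
          (∀ n, a n = none → a (n + 1) = none) ∧
          (∀ n c, a n = some c → K.CocycleWords P c) ∧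
          ∀ (v : ℕ) (G : Type*) [Group G] (A : Type*) [CommGroup A]
            (φ : K.Pi1 v ≃* G) (ψ : P.Presented ≃* A), v < K.numVertices →
            ∀ (E : Type*) [Group E] (R : GroupExtension A E G), R.IsCentral →
              ∃! n, ∃ c, a n = some c ∧
                ∃ S : GroupExtension A (K.centralPresentation T P c).Presented G,
                  K.IsStandardExtension T P c φ ψ S ∧ Nonempty (S.Equiv R)) := by
  refine ⟨fun K T P v G _ A _ φ ψ hK hT _ hv => CellComplex3.classification hK hT hv φ ψ, ?_⟩
  obtain ⟨enum, henum, h⟩ := CellComplex3.exists_partrec_enum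
  refine ⟨enum, henum, fun K P hK _ hP => ?_⟩
  obtain ⟨c, hc, hcn⟩ := h K P hK.wellFormed hK.connected
  have hT := hc.1.isMaximalTree hK.wellFormed
  have hbasis := hc.isCohomologyBasis
  have hwords : ∀ n w, K.certifiedList P c n = some w → K.CocycleWords P w := by
    intro n w hw
    -- Here `A` is `P.Presented` itself, so the listed words do not depend on any later choice of
    -- `A` and `ψ`.
    let _ : CommGroup P.Presented := { (inferInstance : Group P.Presented) with mul_comm := hP }
    obtain ⟨u, -, rfl⟩ := Option.map_eq_some_iff.mp hw
    exact hbasis.cocycleWords (MulEquiv.refl P.Presented) u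
  refine ⟨c.1.1, K.certifiedList P c, hT, hcn, fun n hn => ?_, hwords, ?_⟩
  · rw [CellComplex3.certifiedList, CellComplex3.cocycleList, Option.map_eq_none_iff] at hn ⊢
    exact unrank_succ_eq_none hc.2.1 hn
  · intro v G _ A _ φ ψ hv E _ R hR
    obtain ⟨-, h₂, h₃⟩ := CellComplex3.classification hK hT hv φ ψ
    obtain ⟨⟨τ, hτ⟩, h₄⟩ := h₃ E R hR
    obtain ⟨a, ha, -, S, hS, ⟨eS⟩⟩ := h₄ τ hτ
    -- With `a` a cocycle of the given extension, being equivalent to a listed extension means being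
    -- cohomologous to its cocycle. This reduces the claim to the list of classes.
    refine (existsUnique_congr fun n => exists_congr fun w => and_congr_right fun hw => ?_).mp
      (hbasis.existsUnique_cocycleList ψ hK.wellFormed ha)
    have hw' := hwords n w hw
    constructor
    · intro hcoh
      obtain ⟨S', -, hS'⟩ := CellComplex3.exists_standardExtension hK hT hv φ ψ hw'
      obtain ⟨e⟩ := (h₂ a w ha hw' S S' hS hS').mpr hcoh
      exact ⟨S', hS', ⟨e.symm.trans eS⟩⟩
    · rintro ⟨S', hS', ⟨e⟩⟩
      exact (h₂ a w ha hw' S S' hS hS').mp ⟨eS.trans e.symm⟩
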